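/- Let $L>0$, $c\in\mathbb R$ and let $\beta\in L^\infty(0,L)$ be real-valued. Let $H^1_{(0)}(0,L)=\{g\in H^1(0,L): g(0)=0\}$, and let $\mathcal H^0=L^2(0,L)\times H^1_{(0)}(0,L)\times L^2(0,L)$ be the Hilbert space of complex-valued triples with inner product $\langle (f_1,g_1,h_1),(f_2,g_2,h_2)\rangle=\int_0^L(f_1\overline{f_2}+g_1'\overline{g_2'}+h_1\overline{h_2})$. For $\alpha\ge 0$ consider the operator $$\mathcal A^{(\alpha)}(f,g,h)=(f''+cf+\beta g,\;h,\;g'')$$ with domain the set of $(f,g,h)\in H^2(0,L)\times H^2(0,L)\times H^1(0,L)$ with $f(0)=f(L)=g(0)=h(0)=0$ and $g'(L)+\alpha h(L)=0$. Put $\mathcal A_0=\mathcal A^{(0)}$ and, for $\alpha>1$ such that $$c\ne\frac1{2L}\log\Big(\frac{\alpha-1}{\alpha+1}\Big)+\frac{n^2\pi^2}{L^2}\qquad\text{for all integers } n\ge1,\tag{1}$$ put $\mathcal A=\mathcal A^{(\alpha)}$. In both cases let $\lambda_{1,n}=c-\frac{n^2\pi^2}{L^2}$ and $\phi_{1,n}=\big(\sqrt{2/L}\,\sin(n\pi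 x/L),0,0\big)$ for $n\ge1$. Moreover, for $m\in\mathbb Z$: * for $\mathcal A_0$ let $\lambda_{2,m}=\frac{(2m+1)i\pi}{2L}$ and $A_m=\frac{|2m+1|\pi}{2\sqrt L}$; * for $\mathcal A$ let $\mu=-\frac1{2L}\log\big(\frac{\alpha-1}{\alpha+1}\big)>0$, $\lambda_{2,m}=-\mu+i\frac{m\pi}L$ and $A_m=\frac1{L\sqrt{2\mu}}\sqrt{(\mu^2L^2+m^2\pi^2)\sinh(2\mu L)}$. Let $r_m$ be a square root of $\lambda_{2,m}-c$ with nonnegative real part and let $\phi_{2,m}=(\phi_{2,m}^1,\phi_{2,m}^2,\phi_{2,m}^3)$, where $\phi^2_{2,m}(x)=\frac1{A_m}\sinh(\lambda_{2,m}x)$, $\phi^3_{2,m}(x)=\frac{\lambda_{2,m}}{A_m}\sinh(\lambda_{2,m}x)$ and $$\phi^1_{2,m}(x)=\frac1{A_mr_m}\int_x^L\beta(s)\sinh(\lambda_{2,m}s)\sinh(r_m(x-s))\,ds+\frac{\sinh(r_m(L-x))}{A_mr_m\sinh(r_mL)}\int_0^L\beta(s)\sinh(\lambda_{2,m}s)\sinh(r_ms)\,ds,$$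 the right-hand side being replaced by its limit as $r_m\to0$ in case $r_m=0$. Then, for $\mathcal A_0$ and for $\mathcal A$, each with its own families: 1. $\Phi=\{\phi_{1,n}: n\ge1\}\cup\{\phi_{2,m}: m\in\mathbb Z\}$ is a Riesz basis of $\mathcal H^0$; it has a dual Riesz basis $\Psi=\{\psi_{1,n}\}\cup\{\psi_{2,m}\}$, that is, a Riesz basis biorthogonal to $\Phi$. 2. The operator is Riesz-spectral: it is closed, its eigenvalues are exactly the $\lambda_{1,n}$ $(n\ge 1)$ and $\lambda_{2,m}$ $(m\in\mathbb Z)$, they are pairwise distinct and simple, with the eigenvectors $\phi_{1,n}$ and $\phi_{2,m}$, which form a Riesz basis, and the closure of the set of eigenvalues is totally disconnected. 3. $\|\phi^1_{2,m}\|_{L^\infty(0,L)}=O(1/m^2)$ as $|m|\to\infty$. 4. The operator generates a $C_0$-semigroup $(T(t))_{t\ge0}$ on $\mathcal H^0$, given for all $t\ge0$ and $X\in\mathcal H^0$ by $$T(t)X=\sum_{n\ge1}e^{\lambda_{1,n}t}\langle X,\psi_{1,n}\rangle\phi_{1,n}+\sum_{m\in\mathbb Z}e^{\lambda_{2,m}t}\langle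 X,\psi_{2,m}\rangle\phi_{2,m}.$$ -/

import Mathlib

open MeasureTheory Filter Topology Set
open scoped ENNReal NNReal

noncomputable section

namespace WaveHeat

/-! ### Abstract notions: Riesz bases, semigroups, Riesz-spectral operators -/

section Abstract

variable {H : Type*} [NormedAddCommGroup H] [InnerProductSpace ℂ H] {ι : Type*}

/-- `φ` is a Riesz basis of `H`: its span is dense and finite linear combinations are bounded
above and below by the `ℓ²` norm of their coefficients. -/
structure IsRieszBasis (φ : ι → H) : Prop where
  dense_span : Dense (Submodule.span ℂ (range φ) : Set H)
  bounds : ∃ m M : ℝ, 0 < m ∧ 0 < M ∧ ∀ (s : Finset ι) (a : ι → ℂ),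
    m * ∑ i ∈ s, ‖a i‖ ^ 2 ≤ ‖∑ i ∈ s, a i • φ i‖ ^ 2 ∧
      ‖∑ i ∈ s, a i • φ i‖ ^ 2 ≤ M * ∑ i ∈ s, ‖a i‖ ^ 2

/-- `ψ` is the dual Riesz basis of `φ`: a Riesz basis that is biorthogonal to `φ`.
(`inner ℂ` is conjugate-linear in its first argument.) -/
structure IsDualRieszBasis (φ ψ : ι → H) : Prop where
  isRieszBasis : IsRieszBasis ψ
  inner_self : ∀ i, inner ℂ (ψ i) (φ i) = 1
  inner_of_ne : ∀ i j, i ≠ j → inner ℂ (ψ j) (φ i) = 0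

/-- `A` is a Riesz-spectral operator with eigenvalues `ev` and eigenvectors `φ`: `A` is closed,
its eigenvalues are exactly the `ev i`, they are simple (pairwise distinct, and without any
further eigenvectors or generalized eigenvectors), the eigenvectors `φ i` form a Riesz basis,
and the closure of the set of eigenvalues is totally disconnected. -/
structure IsRieszSpectral (A : H →ₗ.[ℂ] H) (ev : ι → ℂ) (φ : ι → H) : Prop where
  isClosed : A.IsClosed
  eigenvector : ∀ i, φ i ≠ 0 ∧ (φ i, ev i • φ i) ∈ A.graph
  eigenvalue : ∀ z : ℂ, (∃ x : H, x ≠ 0 ∧ (x, z • x) ∈ A.graph) → ∃ i, z = ev i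
  distinct : Function.Injective ev
  simple : ∀ (i : ι) (x y : H), (x, y) ∈ A.graph →
    y - ev i • x ∈ Submodule.span ℂ {φ i} → x ∈ Submodule.span ℂ {φ i}
  isRieszBasis : IsRieszBasis φ
  totallyDisconnected : IsTotallyDisconnected (closure (range ev))

/-- `T` is a `C₀`-semigroup of bounded operators. -/
structure IsC0Semigroup (T : ℝ≥0 → H →L[ℂ] H) : Prop where
  map_zero : T 0 = ContinuousLinearMap.id ℂ H
  map_add : ∀ s t, T (s + t) = (T s).comp (T t)
  strongly_continuous : ∀ x, Continuous fun t => T t x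

/-- `A` (with its domain) is the infinitesimal generator of `T`. -/
def IsGenerator (A : H →ₗ.[ℂ] H) (T : ℝ≥0 → H →L[ℂ] H) : Prop :=
  ∀ x y : H, (x, y) ∈ A.graph ↔
    Tendsto (fun t : ℝ≥0 => (((t : ℝ) : ℂ))⁻¹ • (T t x - x)) (𝓝[>] 0) (𝓝 y)

/-- The family `T` is given by the modal expansion
`T(t) x = ∑ᵢ exp (evᵢ t) ⟨x, ψᵢ⟩ φᵢ`. -/
def HasModalExpansion (T : ℝ≥0 → H →L[ℂ] H) (ev : ι → ℂ) (φ ψ : ι → H) : Prop :=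
  ∀ (t : ℝ≥0) (x : H),
    HasSum (fun i => (Complex.exp (ev i * ((t : ℝ) : ℂ)) * inner ℂ (ψ i) x) • φ i) (T t x)

end Abstract

/-! ### Sobolev functions on `(0, L)` and the state space -/

/-- Lebesgue measure on `(0, L)`. -/
def leb (L : ℝ) : Measure ℝ := volume.restrict (Ioo 0 L)

/-- The space `L²(0, L)` of complex-valued functions. -/
abbrev L2 (L : ℝ) : Type := Lp ℂ 2 (leb L)

/-- `f` (restricted to `[0, L]`) is the continuous representative of an element of `H¹(0, L)`
and `w ∈ L²(0, L)` is its derivative: in dimension one, `H¹` consists of the absolutely continuous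
functions on `[0, L]` whose derivative is in `L²`. -/
def HasH1Deriv (L : ℝ) (f w : ℝ → ℂ) : Prop :=
  MemLp w 2 (leb L) ∧ ∀ x ∈ Icc 0 L, f x = f 0 + ∫ s in (0 : ℝ)..x, w s

theorem integral_congr_leb {L : ℝ} {f g : ℝ → ℂ} (h : f =ᵐ[leb L] g) {x : ℝ}
    (hx : x ∈ Icc 0 L) : ∫ s in (0 : ℝ)..x, f s = ∫ s in (0 : ℝ)..x, g s := by
  rw [intervalIntegral.integral_of_le hx.1, intervalIntegral.integral_of_le hx.1]
  apply integral_congr_ae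
  rw [leb, Measure.restrict_congr_set Ioo_ae_eq_Ioc] at h
  exact ae_restrict_of_ae_restrict_of_subset (Ioc_subset_Ioc_right hx.2) h

theorem intervalIntegrable_of_memLp {L : ℝ} {w : ℝ → ℂ} (hw : MemLp w 2 (leb L)) {x : ℝ}
    (hx : x ∈ Icc 0 L) : IntervalIntegrable w volume 0 x := by
  rw [intervalIntegrable_iff_integrableOn_Ioc_of_le hx.1]
  have : IsFiniteMeasure (leb L) := by unfold leb; infer_instance
  have h := hw.integrable (by norm_num)
  rw [leb, Measure.restrict_congr_set Ioo_ae_eq_Ioc] at h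
  exact IntegrableOn.mono_set h (Ioc_subset_Ioc_right hx.2)

/-- The space `H¹₍₀₎(0, L)` of `g ∈ H¹(0, L)` with `g(0) = 0`: pairs `(g, g')` with `g' ∈ L²(0, L)` and
`g(x) = ∫₀ˣ g'` on `[0, L]`. -/
def H10Submodule (L : ℝ) : Submodule ℂ ((Icc (0 : ℝ) L → ℂ) × L2 L) where
  carrier := {p | ∀ x : Icc (0 : ℝ) L, p.1 x = ∫ s in (0 : ℝ)..x, p.2 s}
  zero_mem' := by
    intro x
    show (0 : ℂ) = ∫ s in (0 : ℝ)..x, (0 : L2 L) s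
    rw [integral_congr_leb (Lp.coeFn_zero ℂ 2 (leb L)) x.2]
    simp
  add_mem' := by
    intro p q hp hq x
    have hp' := hp x
    have hq' := hq x
    show p.1 x + q.1 x = ∫ s in (0 : ℝ)..x, (p.2 + q.2 : L2 L) s
    rw [integral_congr_leb (Lp.coeFn_add p.2 q.2) x.2, hp', hq']
    exact (intervalIntegral.integral_add (intervalIntegrable_of_memLp (Lp.memLp p.2) x.2)
      (intervalIntegrable_of_memLp (Lp.memLp q.2) x.2)).symm
  smul_mem' := by
    intro a p hp x
    have hp' := hp x
    show a • p.1 x = ∫ s in (0 : ℝ)..x, (a • p.2 : L2 L) s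
    rw [integral_congr_leb (Lp.coeFn_smul a p.2) x.2, hp']
    exact (intervalIntegral.integral_smul a _).symm

/-- The space `H¹₍₀₎(0, L)`, normed by `‖g‖ = ‖g'‖`. -/
def H10 (L : ℝ) : Type := H10Submodule L

namespace H10

variable {L : ℝ}

instance : AddCommGroup (H10 L) := inferInstanceAs (AddCommGroup (H10Submodule L))
instance : Module ℂ (H10 L) := inferInstanceAs (Module ℂ (H10Submodule L))

/-- The function `g` on `[0, L]`. -/
def toFun (g : H10 L) : Icc (0 : ℝ) L → ℂ := g.1.1

/-- The derivative `g'`, as a linear map into `L²(0, L)`. -/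
def deriv : H10 L →ₗ[ℂ] L2 L :=
  (LinearMap.snd ℂ (Icc (0 : ℝ) L → ℂ) (L2 L)).comp (H10Submodule L).subtype

theorem toFun_eq (g : H10 L) (x : Icc (0 : ℝ) L) : g.toFun x = ∫ s in (0 : ℝ)..x, deriv g s :=
  g.2 x

theorem deriv_injective : Function.Injective (deriv : H10 L → L2 L) := by
  intro g₁ g₂ h
  apply Subtype.ext
  apply Prod.ext
  · funext x
    have h₁ := toFun_eq g₁ x
    rw [h, ← toFun_eq g₂ x] at h₁
    exact h₁
  · exact h

instance : NormedAddCommGroup (H10 L) :=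
  NormedAddCommGroup.induced (H10 L) (L2 L) deriv deriv_injective

/-- The inner product `⟨g₁, g₂⟩ = ∫ g₁' conj(g₂')` (in Mathlib's order of arguments). -/
instance : InnerProductSpace ℂ (H10 L) where
  norm_smul_le a g := by
    show ‖deriv (a • g)‖ ≤ ‖a‖ * ‖deriv g‖
    rw [map_smul]
    exact norm_smul_le a _
  inner g₁ g₂ := inner ℂ (deriv g₁) (deriv g₂)
  norm_sq_eq_re_inner g := norm_sq_eq_re_inner (𝕜 := ℂ) (deriv g)
  conj_inner_symm g₁ g₂ := inner_conj_symm (deriv g₁) (deriv g₂)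
  add_left g₁ g₂ g₃ := by rw [map_add]; exact inner_add_left _ _ _
  smul_left g₁ g₂ a := by rw [map_smul]; exact inner_smul_left _ _ _

theorem deriv_surjective : Function.Surjective (deriv : H10 L → L2 L) := fun w =>
  ⟨⟨(fun x => ∫ s in (0 : ℝ)..x, w s, w), fun _ => rfl⟩, rfl⟩

instance : CompleteSpace (H10 L) :=
  (LinearIsometryEquiv.ofSurjective (⟨deriv, fun _ => rfl⟩ : H10 L →ₗᵢ[ℂ] L2 L)
    deriv_surjective).isometry.isUniformInducing.completeSpace
      (by
        rw [(LinearIsometryEquiv.ofSurjective (⟨deriv, fun _ => rfl⟩ : H10 L →ₗᵢ[ℂ] L2 L)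
          deriv_surjective).surjective.range_eq]
        exact isComplete_univ)

end H10

/-- The Hilbert space `H⁰ = L²(0, L) × H¹₍₀₎(0, L) × L²(0, L)` with inner product
`∫ (f₁ conj(f₂) + g₁' conj(g₂') + h₁ conj(h₂))`. -/
abbrev H0 (L : ℝ) : Type := WithLp 2 (L2 L × WithLp 2 (H10 L × L2 L))

/-- The state `X` is the triple of functions `(f, g, h)`. -/
def Represents {L : ℝ} (X : H0 L) (f g h : ℝ → ℂ) : Prop :=
  X.fst =ᵐ[leb L] f ∧ (∀ x : Icc (0 : ℝ) L, X.snd.fst.toFun x = g x) ∧ X.snd.snd =ᵐ[leb L] h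

/-! ### The operators -/

/-- `X` belongs to the domain of the cascade operator and `Y` is its image:
`X = (f, g, h)` with `f, g ∈ H²(0, L)`, `h ∈ H¹(0, L)`,
`f(0) = f(L) = g(0) = h(0) = 0`, `g'(L) + α h(L) = 0`, and `Y = (f'' + c f + β g, h, g'')`. -/
def CascadeRel (L c : ℝ) (β : ℝ → ℝ) (α : ℝ) (X Y : H0 L) : Prop :=
  ∃ f f' f'' g g' g'' h h' : ℝ → ℂ,
    (HasH1Deriv L f f' ∧ HasH1Deriv L f' f'') ∧
    (HasH1Deriv L g g' ∧ HasH1Deriv L g' g'') ∧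
    HasH1Deriv L h h' ∧
    (f 0 = 0 ∧ f L = 0 ∧ g 0 = 0 ∧ h 0 = 0 ∧ g' L + α * h L = 0) ∧
    Represents X f g h ∧
    Represents Y (fun x => f'' x + c * f x + β x * g x) h g''

theorem HasH1Deriv.add {L : ℝ} {f w f₁ w₁ : ℝ → ℂ} (h : HasH1Deriv L f w)
    (h₁ : HasH1Deriv L f₁ w₁) : HasH1Deriv L (f + f₁) (w + w₁) := by
  refine ⟨h.1.add h₁.1, fun x hx => ?_⟩
  have e : ∫ s in (0 : ℝ)..x, (w + w₁) s = (∫ s in (0 : ℝ)..x, w s) + ∫ s in (0 : ℝ)..x, w₁ s :=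
    intervalIntegral.integral_add (intervalIntegrable_of_memLp h.1 hx)
      (intervalIntegrable_of_memLp h₁.1 hx)
  rw [e, Pi.add_apply, Pi.add_apply, h.2 x hx, h₁.2 x hx]
  ring

theorem HasH1Deriv.smul {L : ℝ} {f w : ℝ → ℂ} (h : HasH1Deriv L f w) (a : ℂ) :
    HasH1Deriv L (a • f) (a • w) := by
  refine ⟨h.1.const_smul a, fun x hx => ?_⟩
  have e : ∫ s in (0 : ℝ)..x, (a • w) s = a • ∫ s in (0 : ℝ)..x, w s :=
    intervalIntegral.integral_smul a _
  rw [e, Pi.smul_apply, Pi.smul_apply, h.2 x hx, smul_add]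

theorem HasH1Deriv.zero (L : ℝ) : HasH1Deriv L 0 0 :=
  ⟨MemLp.zero, fun x _ => by simp⟩

theorem Represents.zero (L : ℝ) : Represents (0 : H0 L) 0 0 0 :=
  ⟨Lp.coeFn_zero ℂ 2 (leb L), fun _ => rfl, Lp.coeFn_zero ℂ 2 (leb L)⟩

theorem Represents.add {L : ℝ} {X X₁ : H0 L} {f g h f₁ g₁ h₁ : ℝ → ℂ} (H : Represents X f g h)
    (H₁ : Represents X₁ f₁ g₁ h₁) : Represents (X + X₁) (f + f₁) (g + g₁) (h + h₁) := by
  refine ⟨(Lp.coeFn_add _ _).trans (H.1.add H₁.1), fun x => ?_,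
    (Lp.coeFn_add _ _).trans (H.2.2.add H₁.2.2)⟩
  have e : (X + X₁).snd.fst.toFun x = X.snd.fst.toFun x + X₁.snd.fst.toFun x := rfl
  rw [e, H.2.1 x, H₁.2.1 x, Pi.add_apply]

theorem Represents.smul {L : ℝ} {X : H0 L} {f g h : ℝ → ℂ} (H : Represents X f g h) (a : ℂ) :
    Represents (a • X) (a • f) (a • g) (a • h) := by
  refine ⟨(Lp.coeFn_smul a _).trans (H.1.const_smul a), fun x => ?_,
    (Lp.coeFn_smul a _).trans (H.2.2.const_smul a)⟩
  have e : (a • X).snd.fst.toFun x = a • X.snd.fst.toFun x := rfl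
  rw [e, H.2.1 x, Pi.smul_apply]

/-- The graph of the cascade operator. -/
def cascadeGraph (L c : ℝ) (β : ℝ → ℝ) (α : ℝ) : Submodule ℂ (H0 L × H0 L) where
  carrier := {p | CascadeRel L c β α p.1 p.2}
  zero_mem' := by
    refine ⟨0, 0, 0, 0, 0, 0, 0, 0, ⟨.zero L, .zero L⟩, ⟨.zero L, .zero L⟩, .zero L, by simp,
      .zero L, ?_⟩
    have e : (fun x : ℝ => (0 : ℝ → ℂ) x + c * (0 : ℝ → ℂ) x + β x * (0 : ℝ → ℂ) x) = 0 := by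
      funext x; simp
    rw [e]
    exact .zero L
  add_mem' := by
    rintro p q ⟨f, f', f'', g, g', g'', h, h', hf, hg, hh, hb, hX, hY⟩
      ⟨k, k', k'', l, l', l'', m, m', hk, hl, hm, hb₁, hX₁, hY₁⟩
    refine ⟨f + k, f' + k', f'' + k'', g + l, g' + l', g'' + l'', h + m, h' + m',
      ⟨hf.1.add hk.1, hf.2.add hk.2⟩, ⟨hg.1.add hl.1, hg.2.add hl.2⟩, hh.add hm, ?_,
      hX.add hX₁, ?_⟩
    · obtain ⟨b1, b2, b3, b4, b5⟩ := hb
      obtain ⟨d1, d2, d3, d4, d5⟩ := hb₁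
      refine ⟨by simp [b1, d1], by simp [b2, d2], by simp [b3, d3], by simp [b4, d4], ?_⟩
      simp only [Pi.add_apply]
      linear_combination b5 + d5
    · convert! hY.add hY₁ using 1
      funext x
      simp only [Pi.add_apply]
      ring
  smul_mem' := by
    rintro a p ⟨f, f', f'', g, g', g'', h, h', hf, hg, hh, hb, hX, hY⟩
    refine ⟨a • f, a • f', a • f'', a • g, a • g', a • g'', a • h, a • h',
      ⟨hf.1.smul a, hf.2.smul a⟩, ⟨hg.1.smul a, hg.2.smul a⟩, hh.smul a, ?_, hX.smul a, ?_⟩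
    · obtain ⟨b1, b2, b3, b4, b5⟩ := hb
      refine ⟨by simp [b1], by simp [b2], by simp [b3], by simp [b4], ?_⟩
      simp only [Pi.smul_apply, smul_eq_mul]
      linear_combination a * b5
    · convert! hY.smul a using 1
      funext x
      simp only [Pi.smul_apply, smul_eq_mul]
      ring

/-- The unbounded operator
`(f, g, h) ↦ (f'' + c f + β g, h, g'')` on `H⁰` with boundary conditions
`f(0) = f(L) = g(0) = h(0) = 0` and `g'(L) + α h(L) = 0`. -/
def cascadeOp (L c : ℝ) (β : ℝ → ℝ) (α : ℝ) : H0 L →ₗ.[ℂ] H0 L :=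
  (cascadeGraph L c β α).toLinearPMap

theorem HasH1Deriv.ae_eq_zero {L : ℝ} (hL : 0 < L) {f w : ℝ → ℂ} (h : HasH1Deriv L f w)
    (hf : ∀ x ∈ Icc 0 L, f x = 0) : w =ᵐ[leb L] 0 := by
  have hi := intervalIntegrable_of_memLp h.1 (right_mem_Icc.2 hL.le)
  have hz : ∀ x ∈ Icc 0 L, ∫ s in (0 : ℝ)..x, w s = 0 := by
    intro x hx
    have := h.2 x hx
    rw [hf x hx, hf 0 (left_mem_Icc.2 hL.le), zero_add] at this
    exact this.symm
  rw [leb, Filter.EventuallyEq, ae_restrict_iff' measurableSet_Ioo]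
  filter_upwards [hi.ae_hasDerivAt_integral] with x hx hxI
  have hx' : x ∈ uIcc 0 L := by rw [uIcc_of_le hL.le]; exact Ioo_subset_Icc_self hxI
  have hd := hx hx' 0 (by simp)
  have hc : (fun y => ∫ s in (0 : ℝ)..y, w s) =ᶠ[𝓝 x] fun _ => 0 := by
    filter_upwards [isOpen_Ioo.mem_nhds hxI] with y hy
    exact hz y (Ioo_subset_Icc_self hy)
  exact hd.unique ((hasDerivAt_const x (0 : ℂ)).congr_of_eventuallyEq hc)

theorem HasH1Deriv.eq_zero_of_ae {L : ℝ} (hL : 0 < L) {f w : ℝ → ℂ} (h : HasH1Deriv L f w)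
    (hf : f =ᵐ[leb L] 0) : ∀ x ∈ Icc 0 L, f x = 0 := by
  have hi := intervalIntegrable_of_memLp h.1 (right_mem_Icc.2 hL.le)
  have hc : ContinuousOn f (Icc 0 L) := by
    have h1 : ContinuousOn (fun x => ∫ s in (0 : ℝ)..x, w s) (uIcc 0 L) :=
      intervalIntegral.continuousOn_primitive_interval' hi left_mem_uIcc
    rw [uIcc_of_le hL.le] at h1
    exact (continuousOn_const.add h1).congr h.2
  rw [leb, Measure.restrict_congr_set Ioo_ae_eq_Icc] at hf
  exact Measure.eqOn_Icc_of_ae_eq volume hL.ne hf hc continuousOn_const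

/-- The relation defining the operator is functional, so `cascadeOp` has the intended graph. -/
theorem cascadeOp_graph {L : ℝ} (hL : 0 < L) (c : ℝ) (β : ℝ → ℝ) (α : ℝ) (X Y : H0 L) :
    (X, Y) ∈ (cascadeOp L c β α).graph ↔ CascadeRel L c β α X Y := by
  have key : ∀ p : H0 L × H0 L, p ∈ cascadeGraph L c β α → p.1 = 0 → p.2 = 0 := by
    rintro ⟨X, Y⟩ ⟨f, f', f'', g, g', g'', h, h', hf, hg, hh, -, hX, hY⟩ hX0
    simp only at hX hY hX0 ⊢
    subst hX0
    have f0 := hf.1.eq_zero_of_ae hL (hX.1.symm.trans (Lp.coeFn_zero ℂ 2 (leb L)))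
    have f1 := hf.2.eq_zero_of_ae hL (hf.1.ae_eq_zero hL f0)
    have f2 := hf.2.ae_eq_zero hL f1
    have g0 : ∀ x ∈ Icc 0 L, g x = 0 := fun x hx => (hX.2.1 ⟨x, hx⟩).symm
    have g1 := hg.2.eq_zero_of_ae hL (hg.1.ae_eq_zero hL g0)
    have g2 := hg.2.ae_eq_zero hL g1
    have h0 := hh.eq_zero_of_ae hL (hX.2.2.symm.trans (Lp.coeFn_zero ℂ 2 (leb L)))
    have hmem : ∀ᵐ x ∂leb L, x ∈ Icc 0 L := by
      rw [leb]
      filter_upwards [ae_restrict_mem measurableSet_Ioo] with x hx using Ioo_subset_Icc_self hx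
    have y1 : Y.fst = 0 := by
      apply Lp.ext
      filter_upwards [hY.1, f2, hmem, Lp.coeFn_zero ℂ 2 (leb L)] with x a1 a2 a3 a4
      rw [a1, a2, f0 x a3, g0 x a3, a4]
      simp
    have y3 : Y.snd.snd = 0 := by
      apply Lp.ext
      filter_upwards [hY.2.2, g2, Lp.coeFn_zero ℂ 2 (leb L)] with x a1 a2 a4
      rw [a1, a2, a4]
    have y2 : Y.snd.fst = 0 := by
      apply H10.deriv_injective
      rw [map_zero]
      apply Lp.ext
      have hd : HasH1Deriv L (fun x => ∫ s in (0 : ℝ)..x, H10.deriv Y.snd.fst s)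
          (H10.deriv Y.snd.fst) := ⟨Lp.memLp _, fun x _ => by simp⟩
      refine (hd.ae_eq_zero hL fun x hx => ?_).trans (Lp.coeFn_zero ℂ 2 (leb L)).symm
      have := H10.toFun_eq Y.snd.fst ⟨x, hx⟩
      rw [hY.2.1 ⟨x, hx⟩, h0 x hx] at this
      exact this.symm
    apply (WithLp.equiv 2 _).injective
    refine Prod.ext y1 ?_
    apply (WithLp.equiv 2 _).injective
    exact Prod.ext y2 y3
  rw [cascadeOp, Submodule.toLinearPMap_graph_eq _ key]
  rfl

/-- The operator `A₀`: boundary condition `g'(L) = 0`. -/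
def opA0 (L c : ℝ) (β : ℝ → ℝ) : H0 L →ₗ.[ℂ] H0 L := cascadeOp L c β 0

/-- The operator `A` with velocity feedback: boundary condition `g'(L) + α h(L) = 0`. -/
def opA (L c : ℝ) (β : ℝ → ℝ) (α : ℝ) : H0 L →ₗ.[ℂ] H0 L := cascadeOp L c β α

/-! ### Eigenvalues and eigenvectors -/

/-- Parabolic eigenvalues `c - n² π² / L²`, `n ≥ 1`. -/
def heatEv (L c : ℝ) (n : ℕ+) : ℂ := ((c - (n : ℝ) ^ 2 * Real.pi ^ 2 / L ^ 2 : ℝ) : ℂ)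

/-- Hyperbolic eigenvalues `(2m + 1) i π / (2L)` of `A₀`. -/
def waveEv0 (L : ℝ) (m : ℤ) : ℂ := (2 * (m : ℂ) + 1) * Complex.I * Real.pi / (2 * L)

/-- Hyperbolic eigenvalues `(1 / 2L) log ((α - 1) / (α + 1)) + i m π / L` of `A`. -/
def waveEv (L α : ℝ) (m : ℤ) : ℂ :=
  ((1 / (2 * L) * Real.log ((α - 1) / (α + 1)) : ℝ) : ℂ) + Complex.I * (m : ℂ) * Real.pi / L

/-- The normalization `A_m = |2m + 1| π / (2 √L)` for `A₀`. -/
def normConst0 (L : ℝ) (m : ℤ) : ℝ := |2 * (m : ℝ) + 1| * Real.pi / (2 * √L)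

/-- `μ = - (1 / 2L) log ((α - 1) / (α + 1))`. -/
def decay (L α : ℝ) : ℝ := -(1 / (2 * L)) * Real.log ((α - 1) / (α + 1))

/-- The normalization
`A_m = (1 / (L √(2μ))) √((μ² L² + m² π²) sinh (2 μ L))` for `A`. -/
def normConst (L α : ℝ) (m : ℤ) : ℝ :=
  1 / (L * √(2 * decay L α)) *
    √((decay L α ^ 2 * L ^ 2 + (m : ℝ) ^ 2 * Real.pi ^ 2) * Real.sinh (2 * decay L α * L))

/-- `sinh (r x) / r`, extended by its limit `x` at `r = 0`. -/
def sinhDiv (r : ℂ) (x : ℝ) : ℂ := if r = 0 then (x : ℂ) else Complex.sinh (r * x) / r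

/-- First component of the parabolic eigenvectors: `√(2/L) sin (n π x / L)`. -/
def heatFun (L : ℝ) (n : ℕ+) (x : ℝ) : ℂ := ((√(2 / L) * Real.sin (n * Real.pi / L * x) : ℝ) : ℂ)

/-- First component of the hyperbolic eigenvectors, for the eigenvalue `ev`, a square root `r`
of `ev - c` and the normalization `a`. When `r ≠ 0` this is
`1/(a r) ∫ₓᴸ β(s) sinh(ev s) sinh(r(x-s)) ds
  + sinh(r(L-x)) / (a r sinh(r L)) ∫₀ᴸ β(s) sinh(ev s) sinh(r s) ds`,
and when `r = 0` it is the limit of this expression. -/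
def waveFun1 (L : ℝ) (β : ℝ → ℝ) (ev r : ℂ) (a : ℝ) (x : ℝ) : ℂ :=
  1 / (a : ℂ) * (∫ s in x..L, (β s : ℂ) * Complex.sinh (ev * s) * sinhDiv r (x - s)) +
    sinhDiv r (L - x) / (a * sinhDiv r L) *
      ∫ s in (0 : ℝ)..L, (β s : ℂ) * Complex.sinh (ev * s) * sinhDiv r s

/-- Second component of the hyperbolic eigenvectors: `sinh (ev x) / a`. -/
def waveFun2 (ev : ℂ) (a : ℝ) (x : ℝ) : ℂ := 1 / (a : ℂ) * Complex.sinh (ev * x)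

/-- Third component of the hyperbolic eigenvectors: `ev sinh (ev x) / a`. -/
def waveFun3 (ev : ℂ) (a : ℝ) (x : ℝ) : ℂ := ev / (a : ℂ) * Complex.sinh (ev * x)

/-- `Φ : ℕ* ⊔ ℤ → H⁰` is the family of eigenvectors
`φ_{1,n} = (√(2/L) sin (n π x / L), 0, 0)` and
`φ_{2,m} = (φ¹_{2,m}, sinh (λ_{2,m} x) / A_m, λ_{2,m} sinh (λ_{2,m} x) / A_m)`,
for the hyperbolic eigenvalues `ev`, the square roots `r` and the normalizations `a`. -/
def IsEigenFamily {L : ℝ} (β : ℝ → ℝ) (ev r : ℤ → ℂ) (a : ℤ → ℝ) (Φ : ℕ+ ⊕ ℤ → H0 L) : Prop :=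
  (∀ n : ℕ+, Represents (Φ (Sum.inl n)) (heatFun L n) 0 0) ∧
  (∀ m : ℤ, Represents (Φ (Sum.inr m)) (waveFun1 L β (ev m) (r m) (a m))
    (waveFun2 (ev m) (a m)) (waveFun3 (ev m) (a m)))

end WaveHeat

end

/-! Everything rests on one bounded isomorphism `R` from the state space onto `ℓ²(ℕ+ ⊕ ℤ)` that
carries the eigenvectors to the unit vectors (`exists_equiv_ellTwo`). The heat eigenvectors are the
orthonormal sine basis of `L²(0, L)`. For the wave part, both families of eigenvalues have the form
`λ_m = κ + i m π / L`, and both normalizations are a constant multiple `γ |λ_m|`. Hence `g' = (λ_m /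
A_m) cosh (λ_m x)` and `h = (λ_m / A_m) sinh (λ_m x)` arise from the pair `(exp (i m π x / L), exp
(-i m π x / L))` by a phase, a multiplication by `exp (± κ x)`, and sums and differences. These
pairs, normalized, form an orthonormal basis of `L²(0, L) × L²(0, L)`, which is `L²(-L, L)` with its
left half reflected.

The coupling component `φ¹` is estimated by the Dirichlet Green's function of `f'' - r² f`: it is at
most a constant over `|A_m| |r_m| Re r_m`, and both `|A_m|` and `|r_m| Re r_m` grow at least
linearly in `|m|` (`norm_waveFun1_le`, `norm_mul_re_ge`). The resulting `O(1/m²)` makes the norms of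
`φ¹` summable, so `φ¹` is the image of the wave basis under a bounded operator `C`
(`exists_clm_hilbertBasis_eq`). Adding it is the shear `(f, F) ↦ (f + C F, N F)`, which is
invertible however large `C` is.

It remains to show that the operator is exactly the diagonal operator in the coordinates of `R`
(`mem_graph_iff_of_eigenvectors`). It is closed, because its graph is cut out by equations between
bounded operators (`cascadeRel_iff`), so it extends the diagonal operator. The extension cannot be
proper: the diagonal operator is boundedly invertible after subtracting a real `z` to the right of
all the eigenvalues, and the boundary value problem has no nonzero solution for such `z`
(`eq_zero_of_cascadeRel_smul`). The spectral claims, the semigroup, its generator and the modal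
expansion are then statements about diagonal operators on `ℓ²`. -/

open MeasureTheory Filter Topology Set
open scoped ENNReal NNReal

noncomputable section

namespace WaveHeat

/-! ### Diagonal operators on `ℓ²` -/

section Diagonal

variable {ι : Type*}

/-- The Hilbert space `ℓ²(ι)`. -/
abbrev EllTwo (ι : Type*) : Type _ := lp (fun _ : ι => ℂ) 2

theorem EllTwo.hasSum_norm_sq (a : EllTwo ι) : HasSum (fun i => ‖a i‖ ^ 2) (‖a‖ ^ 2) := by
  have := lp.hasSum_norm (p := 2) (by norm_num) a
  simpa using this

theorem EllTwo.memℓp_of_summable {f : ι → ℂ} (h : Summable fun i => ‖f i‖ ^ 2) : Memℓp f 2 :=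
  memℓp_gen (by simpa using h)

theorem EllTwo.norm_le_mul {a b : EllTwo ι} {M : ℝ} (hM : 0 ≤ M) (h : ∀ i, ‖a i‖ ≤ M * ‖b i‖) :
    ‖a‖ ≤ M * ‖b‖ := by
  have h1 : ‖a‖ ^ 2 ≤ (M * ‖b‖) ^ 2 := by
    rw [mul_pow]
    refine hasSum_le (fun i => ?_) a.hasSum_norm_sq (b.hasSum_norm_sq.mul_left (M ^ 2))
    rw [← mul_pow]
    exact pow_le_pow_left₀ (norm_nonneg _) (h i) 2
  exact le_of_sq_le_sq h1 (by positivity)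

theorem EllTwo.continuous_apply (i : ι) : Continuous fun a : EllTwo ι => a i := by
  refine (LipschitzWith.of_dist_le_mul (K := 1) fun a b => ?_).continuous
  rw [dist_eq_norm, dist_eq_norm, NNReal.coe_one, one_mul]
  exact lp.norm_apply_le_norm (by norm_num) (a - b) i

/-- Dominated convergence in `ℓ²`. -/
theorem EllTwo.tendsto_of_dominated {α : Type*} {l : Filter α} {F : α → EllTwo ι}
    {g : EllTwo ι} {B : ι → ℝ} (hB : Summable fun i => B i ^ 2) (hg : ∀ i, ‖g i‖ ≤ B i)
    (hF : ∀ᶠ a in l, ∀ i, ‖F a i‖ ≤ B i) (hlim : ∀ i, Tendsto (fun a => F a i) l (𝓝 (g i))) :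
    Tendsto F l (𝓝 g) := by
  rw [tendsto_iff_norm_sub_tendsto_zero]
  have h1 : Tendsto (fun a => ∑' i, ‖F a i - g i‖ ^ 2) l (𝓝 (∑' _ : ι, 0)) := by
    refine tendsto_tsum_of_dominated_convergence (bound := fun i => 4 * B i ^ 2)
      (hB.mul_left 4) (fun i => ?_) ?_
    · have := ((hlim i).sub_const (g i)).norm.pow 2
      simpa using this
    · filter_upwards [hF] with a ha i
      rw [Real.norm_of_nonneg (by positivity)]
      have h2 : ‖F a i - g i‖ ≤ 2 * B i := by
        refine (norm_sub_le _ _).trans ?_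
        linarith [ha i, hg i]
      calc ‖F a i - g i‖ ^ 2 ≤ (2 * B i) ^ 2 := pow_le_pow_left₀ (norm_nonneg _) h2 2
        _ = 4 * B i ^ 2 := by ring
  have h3 : ∀ a, ∑' i, ‖F a i - g i‖ ^ 2 = ‖F a - g‖ ^ 2 := fun a =>
    (F a - g).hasSum_norm_sq.tsum_eq
  simp only [h3, tsum_zero] at h1
  have h4 := h1.sqrt
  simpa [Real.sqrt_sq] using h4

/-- Multiplication by a bounded sequence on `ℓ²`. -/
def diagOp (d : ι → ℂ) {M : ℝ} (h : ∀ i, ‖d i‖ ≤ M) : EllTwo ι →L[ℂ] EllTwo ι :=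
  LinearMap.mkContinuous
    { toFun := fun a => ⟨fun i => d i * a i, EllTwo.memℓp_of_summable <| by
        refine (a.hasSum_norm_sq.summable.mul_left (M ^ 2)).of_nonneg_of_le
          (fun i => by positivity) fun i => ?_
        rw [norm_mul, mul_pow]
        have := h i
        gcongr⟩
      map_add' := fun a b => by
        ext i
        exact mul_add _ _ _
      map_smul' := fun k a => by
        ext i
        exact mul_left_comm _ _ _ } |M| fun a => by
    refine EllTwo.norm_le_mul (abs_nonneg _) fun i => ?_
    change ‖d i * a i‖ ≤ _
    rw [norm_mul]
    have := (h i).trans (le_abs_self M)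
    gcongr

theorem diagOp_apply (d : ι → ℂ) {M : ℝ} (h : ∀ i, ‖d i‖ ≤ M) (a : EllTwo ι) (i : ι) :
    diagOp d h a i = d i * a i := rfl

end Diagonal

/-! ### Riesz bases given by an isomorphism with `ℓ²` -/

section RieszEquiv

variable {H : Type*} [NormedAddCommGroup H] [InnerProductSpace ℂ H] {ι : Type*}

theorem EllTwo.hasSum_single [DecidableEq ι] (a : EllTwo ι) :
    HasSum (fun i => a i • lp.single (E := fun _ : ι => ℂ) 2 i (1 : ℂ)) a := by
  have := lp.hasSum_single (E := fun _ : ι => ℂ) (p := 2) (by norm_num) a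
  refine this.congr_fun ?_
  intro i
  rw [← lp.single_smul]
  simp

/-- The `ℓ²` norm of the coefficients is the norm of the image under `R`, so the lower bound comes
from `‖R‖` and the upper one from `‖R⁻¹‖`. The added `1` keeps both constants positive even on the
trivial space. -/
theorem isRieszBasis_of_equiv [DecidableEq ι] (R : H ≃L[ℂ] EllTwo ι) {φ : ι → H}
    (hφ : ∀ i, R (φ i) = lp.single 2 i (1 : ℂ)) : IsRieszBasis φ where
  dense_span := by
    intro x
    have h1 : HasSum (fun i => R x i • φ i) x := by
      have := (EllTwo.hasSum_single (R x)).mapL (R.symm : EllTwo ι →L[ℂ] H)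
      simpa [← hφ] using this
    refine mem_closure_of_tendsto h1 (Eventually.of_forall fun s => ?_)
    exact Submodule.sum_mem _ fun i _ => Submodule.smul_mem _ _
      (Submodule.subset_span (mem_range_self i))
  bounds := by
    refine ⟨1 / (‖(R : H →L[ℂ] EllTwo ι)‖ ^ 2 + 1), ‖(R.symm : EllTwo ι →L[ℂ] H)‖ ^ 2 + 1,
      by positivity, by positivity, fun s a => ?_⟩
    set y : EllTwo ι := ∑ i ∈ s, lp.single 2 i (a i) with hy
    have hR : R (∑ i ∈ s, a i • φ i) = y := by
      rw [map_sum, hy]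
      refine Finset.sum_congr rfl fun i _ => ?_
      rw [map_smul, hφ, ← lp.single_smul]
      simp
    have hRs : R.symm y = ∑ i ∈ s, a i • φ i := by rw [← hR, R.symm_apply_apply]
    have hn : ‖y‖ ^ 2 = ∑ i ∈ s, ‖a i‖ ^ 2 := by
      have := lp.norm_sum_single (E := fun _ : ι => ℂ) (p := 2) (by norm_num) a s
      simpa using this
    have h1 := (R : H →L[ℂ] EllTwo ι).le_opNorm (∑ i ∈ s, a i • φ i)
    have h2 := (R.symm : EllTwo ι →L[ℂ] H).le_opNorm y
    simp only [ContinuousLinearEquiv.coe_coe] at h1 h2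
    rw [hR] at h1
    rw [hRs] at h2
    rw [← hn]
    constructor
    · rw [one_div, inv_mul_le_iff₀ (by positivity)]
      have := pow_le_pow_left₀ (norm_nonneg _) h1 2
      nlinarith [sq_nonneg ‖∑ i ∈ s, a i • φ i‖]
    · have := pow_le_pow_left₀ (norm_nonneg _) h2 2
      nlinarith [sq_nonneg ‖y‖]

/-- The family dual to the one that corresponds to the unit vectors of `ℓ²`. -/
def dualFamily [DecidableEq ι] [CompleteSpace H] (R : H ≃L[ℂ] EllTwo ι) (i : ι) : H :=
  ContinuousLinearMap.adjoint (R : H →L[ℂ] EllTwo ι) (lp.single 2 i (1 : ℂ))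

theorem inner_dualFamily [DecidableEq ι] [CompleteSpace H] (R : H ≃L[ℂ] EllTwo ι) (i : ι) (x : H) :
    inner ℂ (dualFamily R i) x = R x i := by
  rw [dualFamily, ContinuousLinearMap.adjoint_inner_left, lp.inner_single_left]
  simp

/-- The adjoint of `R⁻¹` is an isomorphism onto `ℓ²` with inverse the adjoint of `R`, so it sends
the dual family to the unit vectors. Biorthogonality holds because pairing with the `i`-th dual
vector reads off the `i`-th coordinate of `R x`. -/
theorem isDualRieszBasis_dualFamily [DecidableEq ι] [CompleteSpace H] (R : H ≃L[ℂ] EllTwo ι)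
    {φ : ι → H} (hφ : ∀ i, R (φ i) = lp.single 2 i (1 : ℂ)) :
    IsDualRieszBasis φ (dualFamily R) where
  isRieszBasis := by
    have h1 : ∀ x, ContinuousLinearMap.adjoint (R.symm : EllTwo ι →L[ℂ] H)
        (ContinuousLinearMap.adjoint (R : H →L[ℂ] EllTwo ι) x) = x := fun x => by
      refine ext_inner_right ℂ fun v => ?_
      rw [ContinuousLinearMap.adjoint_inner_left, ContinuousLinearMap.adjoint_inner_left]
      simp
    have h2 : ∀ x, ContinuousLinearMap.adjoint (R : H →L[ℂ] EllTwo ι)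
        (ContinuousLinearMap.adjoint (R.symm : EllTwo ι →L[ℂ] H) x) = x := fun x => by
      refine ext_inner_right ℂ fun v => ?_
      rw [ContinuousLinearMap.adjoint_inner_left, ContinuousLinearMap.adjoint_inner_left]
      simp
    exact isRieszBasis_of_equiv (ContinuousLinearEquiv.equivOfInverse _ _ h2 h1) fun i => h1 _
  inner_self i := by rw [inner_dualFamily, hφ]; simp
  inner_of_ne i j hij := by
    rw [inner_dualFamily, hφ]
    exact lp.single_apply_ne _ _ _ hij.symm

/-! ### Diagonal semigroups -/

theorem norm_exp_mul_le {ev : ι → ℂ} {ω : ℝ} (hω : ∀ i, (ev i).re ≤ ω) (t : ℝ≥0) (i : ι) :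
    ‖Complex.exp (ev i * ((t : ℝ) : ℂ))‖ ≤ Real.exp (ω * t) := by
  rw [Complex.norm_exp, Complex.re_mul_ofReal]
  exact Real.exp_le_exp.2 (mul_le_mul_of_nonneg_right (hω i) t.2)

theorem norm_exp_mul_le_of_le {ev : ι → ℂ} {ω : ℝ} (hω : ∀ i, (ev i).re ≤ ω) {t : ℝ≥0} {τ : ℝ}
    (ht : t ≤ τ) (i : ι) :
    ‖Complex.exp (ev i * ((t : ℝ) : ℂ))‖ ≤ Real.exp (|ω| * τ) := by
  refine (norm_exp_mul_le hω t i).trans (Real.exp_le_exp.2 ?_)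
  exact mul_le_mul (le_abs_self ω) ht t.2 (abs_nonneg _)

/-- The semigroup that is diagonal in the coordinates given by `R`. -/
def diagSemigroup (R : H ≃L[ℂ] EllTwo ι) {ev : ι → ℂ} {ω : ℝ} (hω : ∀ i, (ev i).re ≤ ω)
    (t : ℝ≥0) : H →L[ℂ] H :=
  (R.symm : EllTwo ι →L[ℂ] H) ∘L diagOp _ (norm_exp_mul_le hω t) ∘L (R : H →L[ℂ] EllTwo ι)

variable (R : H ≃L[ℂ] EllTwo ι) {ev : ι → ℂ} {ω : ℝ} (hω : ∀ i, (ev i).re ≤ ω)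

theorem equiv_diagSemigroup_apply (t : ℝ≥0) (x : H) (i : ι) :
    R (diagSemigroup R hω t x) i = Complex.exp (ev i * ((t : ℝ) : ℂ)) * R x i := by
  simp [diagSemigroup, diagOp_apply]

theorem isC0Semigroup_diagSemigroup : IsC0Semigroup (diagSemigroup R hω) where
  map_zero := by
    ext x
    apply R.injective
    ext i
    simp [equiv_diagSemigroup_apply]
  map_add s t := by
    ext x
    apply R.injective
    ext i
    rw [equiv_diagSemigroup_apply, ContinuousLinearMap.comp_apply, equiv_diagSemigroup_apply,
      equiv_diagSemigroup_apply, ← mul_assoc, ← Complex.exp_add]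
    push_cast
    rw [mul_add]
  strongly_continuous x := by
    suffices h : Continuous fun t => R (diagSemigroup R hω t x) by
      have := R.symm.continuous.comp h
      simpa [Function.comp_def] using this
    rw [continuous_iff_continuousAt]
    intro t₀
    -- On `t < t₀ + 1` all the exponentials share one bound. It uses `|ω|` because `ω * t` is not
    -- increasing in `t` when `ω` is negative.
    refine EllTwo.tendsto_of_dominated (B := fun i => Real.exp (|ω| * (t₀ + 1)) * ‖R x i‖)
      ?_ ?_ ?_ ?_
    · simp only [mul_pow]
      exact (R x).hasSum_norm_sq.summable.mul_left _
    · intro i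
      rw [equiv_diagSemigroup_apply, norm_mul]
      exact mul_le_mul_of_nonneg_right (norm_exp_mul_le_of_le hω (by simp) i) (norm_nonneg _)
    · have h1 : ∀ᶠ t : ℝ≥0 in 𝓝 t₀, t < t₀ + 1 := by
        apply gt_mem_nhds
        simp
      filter_upwards [h1] with t ht i
      rw [equiv_diagSemigroup_apply, norm_mul]
      exact mul_le_mul_of_nonneg_right (norm_exp_mul_le_of_le hω (by exact_mod_cast ht.le) i)
        (norm_nonneg _)
    · intro i
      simp only [equiv_diagSemigroup_apply]
      have : Continuous fun t : ℝ≥0 => Complex.exp (ev i * ((t : ℝ) : ℂ)) * R x i := by fun_prop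
      exact this.tendsto t₀

theorem hasModalExpansion_diagSemigroup [DecidableEq ι] [CompleteSpace H] {φ : ι → H}
    (hφ : ∀ i, R (φ i) = lp.single 2 i (1 : ℂ)) :
    HasModalExpansion (diagSemigroup R hω) ev φ (dualFamily R) := by
  intro t x
  have := (EllTwo.hasSum_single (R (diagSemigroup R hω t x))).mapL (R.symm : EllTwo ι →L[ℂ] H)
  simpa [← hφ, equiv_diagSemigroup_apply, inner_dualFamily] using this

/-- Mean value inequality along the segment from `0` to `z`. Only the real part of `z` enters the
exponential factor, so the bound stays useful for eigenvalues with arbitrarily large imaginary part.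
-/
theorem norm_exp_sub_one_le_mul_exp (z : ℂ) {M : ℝ} (hM : ∀ s ∈ Icc (0 : ℝ) 1, s * z.re ≤ M) :
    ‖Complex.exp z - 1‖ ≤ Real.exp M * ‖z‖ := by
  have hd : ∀ s ∈ Icc (0 : ℝ) 1, HasDerivWithinAt (fun s : ℝ => Complex.exp (s * z))
      (Complex.exp (s * z) * z) (Icc 0 1) s := fun s _ => by
    have h1 : HasDerivAt (fun s : ℝ => (s : ℂ) * z) z s := by
      simpa using (Complex.ofRealCLM.hasDerivAt (x := s)).mul_const z
    exact h1.cexp.hasDerivWithinAt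
  have := Convex.norm_image_sub_le_of_norm_hasDerivWithin_le hd (C := Real.exp M * ‖z‖)
    (fun s hs => by
      rw [norm_mul, Complex.norm_exp, Complex.re_ofReal_mul]
      gcongr
      exact hM s hs) (convex_Icc 0 1) (left_mem_Icc.2 zero_le_one) (right_mem_Icc.2 zero_le_one)
  simpa using this

/-- The generator of a diagonal semigroup is the diagonal operator. -/
theorem tendsto_diagSemigroup_iff (x y : H) :
    Tendsto (fun t : ℝ≥0 => (((t : ℝ) : ℂ))⁻¹ • (diagSemigroup R hω t x - x)) (𝓝[>] 0) (𝓝 y) ↔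
      ∀ i, R y i = ev i * R x i := by
  have hcoord : ∀ (t : ℝ≥0) i, R ((((t : ℝ) : ℂ))⁻¹ • (diagSemigroup R hω t x - x)) i =
      (((t : ℝ) : ℂ))⁻¹ * (Complex.exp (ev i * ((t : ℝ) : ℂ)) - 1) * R x i := fun t i => by
    rw [map_smul, map_sub, lp.coeFn_smul, Pi.smul_apply, lp.coeFn_sub, Pi.sub_apply,
      equiv_diagSemigroup_apply, smul_eq_mul]
    ring
  have hlim : ∀ i, Tendsto (fun t : ℝ≥0 => R ((((t : ℝ) : ℂ))⁻¹ • (diagSemigroup R hω t x - x)) i)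
      (𝓝[>] 0) (𝓝 (ev i * R x i)) := fun i => by
    simp only [hcoord]
    refine Tendsto.mul_const _ ?_
    have h1 : HasDerivAt (fun s : ℝ => Complex.exp (ev i * (s : ℂ))) (ev i) 0 := by
      have h2 : HasDerivAt (fun s : ℝ => ev i * (s : ℂ)) (ev i) 0 := by
        simpa using (Complex.ofRealCLM.hasDerivAt (x := 0)).const_mul (ev i)
      simpa using h2.cexp
    have h3 := h1.tendsto_slope_zero_right
    have h4 : Tendsto (fun t : ℝ≥0 => (t : ℝ)) (𝓝[>] 0) (𝓝[>] 0) := by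
      refine tendsto_nhdsWithin_iff.2 ⟨?_, ?_⟩
      · have : Tendsto (fun t : ℝ≥0 => (t : ℝ)) (𝓝 0) (𝓝 0) := NNReal.continuous_coe.tendsto 0
        exact this.mono_left nhdsWithin_le_nhds
      · filter_upwards [self_mem_nhdsWithin] with t ht
        exact ht
    have h5 := h3.comp h4
    refine h5.congr fun t => ?_
    simp [Complex.real_smul]
  constructor
  · intro h i
    have h1 : Tendsto (fun t : ℝ≥0 => R ((((t : ℝ) : ℂ))⁻¹ • (diagSemigroup R hω t x - x)) i)
        (𝓝[>] 0) (𝓝 (R y i)) := by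
      have h2 : Continuous fun z : H => R z i :=
        (EllTwo.continuous_apply i).comp R.continuous
      exact (h2.tendsto y).comp h
    exact tendsto_nhds_unique h1 (hlim i)
  · intro h
    suffices h' : Tendsto (fun t : ℝ≥0 => R ((((t : ℝ) : ℂ))⁻¹ • (diagSemigroup R hω t x - x)))
        (𝓝[>] 0) (𝓝 (R y)) by
      have := (R.symm.continuous.tendsto (R y)).comp h'
      simpa only [Function.comp_def, R.symm_apply_apply] using this
    -- For `0 < t ≤ 1` the difference quotient of `exp (ev i * t)` is at most `exp |ω| * ‖ev i‖`.
    -- The product `ev i * R x i` is `R y i`, so the hypothesis itself supplies the square-summable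
    -- majorant.
    refine EllTwo.tendsto_of_dominated (B := fun i => Real.exp |ω| * ‖R y i‖) ?_ ?_ ?_ ?_
    · simp only [mul_pow]
      exact (R y).hasSum_norm_sq.summable.mul_left _
    · intro i
      exact le_mul_of_one_le_left (norm_nonneg _) (Real.one_le_exp (abs_nonneg _))
    · have h1 : ∀ᶠ t : ℝ≥0 in 𝓝[>] 0, t < 1 :=
        nhdsWithin_le_nhds (gt_mem_nhds zero_lt_one)
      filter_upwards [h1, self_mem_nhdsWithin] with t ht ht0 i
      have ht0' : (0 : ℝ) < t := ht0
      have ht1 : (t : ℝ) ≤ 1 := by exact_mod_cast ht.le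
      rw [hcoord, h i, norm_mul, norm_mul, norm_mul, norm_inv, Complex.norm_real,
        Real.norm_of_nonneg ht0'.le]
      have h2 := norm_exp_sub_one_le_mul_exp (ev i * ((t : ℝ) : ℂ)) (M := |ω|) fun s hs => by
        rw [Complex.re_mul_ofReal]
        have h3 : (ev i).re ≤ |ω| := (hω i).trans (le_abs_self ω)
        have h4 : s * t ≤ 1 := mul_le_one₀ hs.2 ht0'.le ht1
        have h5 : 0 ≤ s * t := mul_nonneg hs.1 ht0'.le
        nlinarith [abs_nonneg ω]
      rw [norm_mul, Complex.norm_real, Real.norm_of_nonneg ht0'.le] at h2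
      calc (t : ℝ)⁻¹ * ‖Complex.exp (ev i * ((t : ℝ) : ℂ)) - 1‖ * ‖R x i‖
          ≤ (t : ℝ)⁻¹ * (Real.exp |ω| * (‖ev i‖ * t)) * ‖R x i‖ := by gcongr
        _ = Real.exp |ω| * (‖ev i‖ * ‖R x i‖) := by field_simp
    · intro i
      rw [h i]
      exact hlim i

/-! ### Operators that are diagonal in a Riesz basis -/

/-- A closed operator with a Riesz basis of eigenvectors whose eigenvalues have bounded real
parts, and without eigenvalue at some point to the right of them, is a diagonal operator. -/
theorem mem_graph_iff_of_eigenvectors [DecidableEq ι] (R : H ≃L[ℂ] EllTwo ι) {ev : ι → ℂ} {ω : ℝ}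
    (hω : ∀ i, (ev i).re ≤ ω) {φ : ι → H} (hφ : ∀ i, R (φ i) = lp.single 2 i (1 : ℂ))
    {A : H →ₗ.[ℂ] H} (hA : A.IsClosed) (hev : ∀ i, (φ i, ev i • φ i) ∈ A.graph)
    {z : ℂ} (hz : ω < z.re) (hzA : ∀ x, (x, z • x) ∈ A.graph → x = 0) (x y : H) :
    (x, y) ∈ A.graph ↔ ∀ i, R y i = ev i * R x i := by
  have hsum : ∀ x : H, HasSum (fun i => R x i • φ i) x := fun x => by
    have := (EllTwo.hasSum_single (R x)).mapL (R.symm : EllTwo ι →L[ℂ] H)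
    simpa [← hφ] using this
  have hsup : ∀ x y : H, (∀ i, R y i = ev i * R x i) → (x, y) ∈ A.graph := by
    intro x y h
    -- The partial sums lie in the graph and converge in the product space, so closedness puts the
    -- limit in the graph.
    have h1 : HasSum (fun i => R x i • (φ i, ev i • φ i)) (x, y) := by
      have h2 : HasSum (fun i => ((R x i • φ i, R y i • φ i) : H × H)) (x, y) :=
        (hsum x).prodMk (hsum y)
      refine h2.congr_fun ?_
      intro i
      rw [Prod.smul_mk, smul_smul, h i, mul_comm]
    refine (hA : _root_.IsClosed (A.graph : Set (H × H))).mem_of_tendsto h1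
      (Eventually.of_forall fun s => ?_)
    exact Submodule.sum_mem _ fun i _ => Submodule.smul_mem _ _ (hev i)
  refine ⟨fun hxy => ?_, hsup x y⟩
  have hpos : 0 < z.re - ω := sub_pos.2 hz
  have hb : ∀ i, z.re - ω ≤ ‖ev i - z‖ := fun i => by
    have h1 := Complex.abs_re_le_norm (ev i - z)
    rw [Complex.sub_re, abs_sub_comm] at h1
    linarith [le_abs_self (z.re - (ev i).re), hω i]
  have hne : ∀ i, ev i - z ≠ 0 := fun i => norm_pos_iff.1 (hpos.trans_le (hb i))
  have hb' : ∀ i, ‖(ev i - z)⁻¹‖ ≤ (z.re - ω)⁻¹ := fun i => by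
    rw [norm_inv]
    exact inv_anti₀ hpos (hb i)
  -- `x'` is the resolvent at `z` of the diagonal operator, applied to `y - z x`. Then `A x' - z x'
  -- = A x - z x`, so `x - x'` lies in the kernel of `A - z`, which is trivial.
  set x' : H := R.symm (diagOp _ hb' (R (y - z • x))) with hx'
  have hRx' : ∀ i, R x' i = (ev i - z)⁻¹ * (R y i - z * R x i) := fun i => by
    rw [hx', R.apply_symm_apply, diagOp_apply, map_sub, map_smul]
    rfl
  have h1 : (x', y - z • x + z • x') ∈ A.graph := by
    refine hsup _ _ fun i => ?_
    rw [map_add, map_sub, map_smul, map_smul, lp.coeFn_add, Pi.add_apply, lp.coeFn_sub,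
      Pi.sub_apply, lp.coeFn_smul, Pi.smul_apply, lp.coeFn_smul, Pi.smul_apply, smul_eq_mul,
      smul_eq_mul, hRx' i]
    have := hne i
    field_simp
    ring
  have h2 : (x - x', z • (x - x')) ∈ A.graph := by
    have := A.graph.sub_mem hxy h1
    rw [Prod.mk_sub_mk] at this
    convert! this using 2
    module
  have h3 : x = x' := sub_eq_zero.1 (hzA _ h2)
  intro i
  have h4 := hRx' i
  rw [← h3] at h4
  have := hne i
  field_simp at h4
  linear_combination -h4

/-- Everything is read off in coordinates. An eigenvector has a nonzero coordinate, which identifies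
its eigenvalue. If `(A - ev i) x` is a multiple of `φ i`, then `(ev j - ev i) * R x j = 0` for `j ≠
i`, and injectivity of `ev` leaves only the `i`-th coordinate. -/
theorem isRieszSpectral_of_eigenvectors [DecidableEq ι] (R : H ≃L[ℂ] EllTwo ι) {ev : ι → ℂ}
    {ω : ℝ} (hω : ∀ i, (ev i).re ≤ ω) {φ : ι → H} (hφ : ∀ i, R (φ i) = lp.single 2 i (1 : ℂ))
    {A : H →ₗ.[ℂ] H} (hA : A.IsClosed) (hev : ∀ i, (φ i, ev i • φ i) ∈ A.graph)
    {z : ℂ} (hz : ω < z.re) (hzA : ∀ x, (x, z • x) ∈ A.graph → x = 0)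
    (hinj : Function.Injective ev) (htd : IsTotallyDisconnected (closure (range ev))) :
    IsRieszSpectral A ev φ where
  isClosed := hA
  eigenvector i := by
    refine ⟨fun h0 => ?_, hev i⟩
    have h1 := congrArg (fun a : EllTwo ι => a i) (hφ i)
    simp [h0] at h1
  eigenvalue w := by
    rintro ⟨x, hx0, hx⟩
    rw [mem_graph_iff_of_eigenvectors R hω hφ hA hev hz hzA] at hx
    obtain ⟨i, hi⟩ : ∃ i, R x i ≠ 0 := by
      by_contra! hcon
      apply hx0
      apply R.injective
      ext i
      rw [hcon i, map_zero]
      rfl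
    refine ⟨i, mul_right_cancel₀ hi ?_⟩
    rw [← hx i, map_smul]
    rfl
  distinct := hinj
  simple i x y hxy h := by
    rw [mem_graph_iff_of_eigenvectors R hω hφ hA hev hz hzA] at hxy
    obtain ⟨k, hk⟩ := Submodule.mem_span_singleton.1 h
    refine Submodule.mem_span_singleton.2 ⟨R x i, ?_⟩
    apply R.injective
    ext j
    rw [map_smul, hφ, lp.coeFn_smul, Pi.smul_apply, smul_eq_mul]
    by_cases hij : j = i
    · subst hij
      simp
    · have h1 := congrArg (fun v => R v j) hk
      simp only [map_smul, map_sub, hφ, lp.coeFn_smul, Pi.smul_apply, lp.coeFn_sub, Pi.sub_apply,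
        smul_eq_mul, hxy j] at h1
      rw [lp.single_apply_ne _ _ _ hij, mul_zero] at h1 ⊢
      have h2 : ev j - ev i ≠ 0 := sub_ne_zero.2 fun h => hij (hinj h)
      have h3 : (ev j - ev i) * R x j = 0 := by linear_combination -h1
      exact ((mul_eq_zero.1 h3).resolve_left h2).symm
  isRieszBasis := isRieszBasis_of_equiv R hφ
  totallyDisconnected := htd

end RieszEquiv

/-! ### Calculus in `H¹(0, L)` -/

instance (L : ℝ) : IsFiniteMeasure (leb L) := by unfold leb; infer_instance

theorem ae_leb_mem (L : ℝ) : ∀ᵐ x ∂leb L, x ∈ Icc 0 L := by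
  rw [leb]
  filter_upwards [ae_restrict_mem measurableSet_Ioo] with x hx using Ioo_subset_Icc_self hx

theorem leb_eq_restrict_Ioc (L : ℝ) : leb L = volume.restrict (Ioc 0 L) :=
  Measure.restrict_congr_set Ioo_ae_eq_Ioc

theorem leb_eq_restrict_Icc (L : ℝ) : leb L = volume.restrict (Icc 0 L) :=
  Measure.restrict_congr_set Ioo_ae_eq_Icc

theorem integral_leb {L : ℝ} (hL : 0 ≤ L) (f : ℝ → ℂ) :
    ∫ x, f x ∂leb L = ∫ x in (0 : ℝ)..L, f x := by
  rw [leb_eq_restrict_Ioc, intervalIntegral.integral_of_le hL]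

theorem memLp_leb_of_continuousOn {L : ℝ} {f : ℝ → ℂ} (hf : ContinuousOn f (Icc 0 L))
    (p : ℝ≥0∞) : MemLp f p (leb L) := by
  obtain ⟨C, hC⟩ := isCompact_Icc.exists_bound_of_continuousOn hf
  refine MemLp.of_bound ?_ C ?_
  · rw [leb_eq_restrict_Icc]
    exact hf.aestronglyMeasurable measurableSet_Icc
  · filter_upwards [ae_leb_mem L] with x hx using hC x hx

theorem MemLp.continuousOn_mul {L : ℝ} {u w : ℝ → ℂ} (hu : ContinuousOn u (Icc 0 L))
    (hw : MemLp w 2 (leb L)) : MemLp (fun x => u x * w x) 2 (leb L) :=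
  hw.mul' (memLp_leb_of_continuousOn hu ⊤)

namespace HasH1Deriv

variable {L : ℝ} {f w : ℝ → ℂ}

theorem congr_deriv (h : HasH1Deriv L f w) {w' : ℝ → ℂ} (hw : w =ᵐ[leb L] w') :
    HasH1Deriv L f w' :=
  ⟨(memLp_congr_ae hw).1 h.1, fun x hx => by rw [h.2 x hx, integral_congr_leb hw hx]⟩

theorem congr_fun (h : HasH1Deriv L f w) {f' : ℝ → ℂ} (hf : ∀ x ∈ Icc 0 L, f' x = f x) :
    HasH1Deriv L f' w :=
  ⟨h.1, fun x hx => by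
    rw [hf x hx, hf 0 (left_mem_Icc.2 (hx.1.trans hx.2)), h.2 x hx]⟩

theorem continuousOn (h : HasH1Deriv L f w) : ContinuousOn f (Icc 0 L) := by
  rcases le_or_gt 0 L with hL | hL
  · have hi := intervalIntegrable_of_memLp h.1 (right_mem_Icc.2 hL)
    have h1 : ContinuousOn (fun x => ∫ s in (0 : ℝ)..x, w s) (uIcc 0 L) :=
      intervalIntegral.continuousOn_primitive_interval' hi left_mem_uIcc
    rw [uIcc_of_le hL] at h1
    exact (continuousOn_const.add h1).congr h.2
  · rw [Icc_eq_empty hL.not_ge]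
    exact continuousOn_empty _

theorem memLp (h : HasH1Deriv L f w) : MemLp f 2 (leb L) :=
  memLp_leb_of_continuousOn h.continuousOn 2

theorem of_hasDerivAt {u u' : ℝ → ℂ} (hu : ∀ x, HasDerivAt u (u' x) x) (hu' : Continuous u') :
    HasH1Deriv L u u' := by
  refine ⟨memLp_leb_of_continuousOn hu'.continuousOn 2, fun x _ => ?_⟩
  rw [intervalIntegral.integral_eq_sub_of_hasDerivAt (fun x _ => hu x)
    (hu'.intervalIntegrable 0 x)]
  ring

theorem integral (hw : MemLp w 2 (leb L)) : HasH1Deriv L (fun x => ∫ s in (0 : ℝ)..x, w s) w :=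
  ⟨hw, fun x _ => by simp⟩

theorem const (L : ℝ) (a : ℂ) : HasH1Deriv L (fun _ => a) 0 :=
  ⟨MemLp.zero, fun x _ => by simp⟩

theorem sub {f₁ w₁ : ℝ → ℂ} (h : HasH1Deriv L f w) (h₁ : HasH1Deriv L f₁ w₁) :
    HasH1Deriv L (f - f₁) (w - w₁) := by
  have := h.add (h₁.smul (-1))
  simpa [sub_eq_add_neg] using this

end HasH1Deriv

/-- Fubini on the triangle `0 < t ≤ s ≤ x`; this is the integration by parts behind the product rule
when one factor is merely absolutely continuous. -/
theorem integral_mul_primitive {u u' w : ℝ → ℂ} (hu : ∀ x, HasDerivAt u (u' x) x)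
    (hu' : Continuous u') {x : ℝ} (hx : 0 ≤ x) (hw : IntervalIntegrable w volume 0 x) :
    ∫ s in (0 : ℝ)..x, u' s * ∫ t in (0 : ℝ)..s, w t =
      ∫ t in (0 : ℝ)..x, (u x - u t) * w t := by
  have hwI : Integrable w (volume.restrict (Ioc 0 x)) := by
    rwa [intervalIntegrable_iff_integrableOn_Ioc_of_le hx] at hw
  have huI : Integrable u' (volume.restrict (Ioc 0 x)) := by
    have := hu'.intervalIntegrable (μ := volume) 0 x
    rwa [intervalIntegrable_iff_integrableOn_Ioc_of_le hx] at this
  have hint : Integrable (Function.uncurry fun s t => (Iic s).indicator (fun t => u' s * w t) t)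
      ((volume.restrict (Ioc 0 x)).prod (volume.restrict (Ioc 0 x))) := by
    have h1 := (huI.mul_prod hwI).indicator
      (measurableSet_le measurable_snd measurable_fst : MeasurableSet {p : ℝ × ℝ | p.2 ≤ p.1})
    refine h1.congr (Eventually.of_forall fun p => ?_)
    simp [Function.uncurry, indicator]
  have hswap := integral_integral_swap hint
  rw [intervalIntegral.integral_of_le hx, intervalIntegral.integral_of_le hx]
  calc ∫ s in Ioc 0 x, u' s * ∫ t in (0 : ℝ)..s, w t
      = ∫ s in Ioc 0 x, ∫ t in Ioc 0 x, (Iic s).indicator (fun t => u' s * w t) t := by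
        refine setIntegral_congr_fun measurableSet_Ioc fun s hs => ?_
        rw [setIntegral_indicator measurableSet_Iic, integral_const_mul,
          intervalIntegral.integral_of_le hs.1.le]
        congr 3
        ext t
        simp only [mem_Ioc, mem_inter_iff, mem_Iic]
        exact ⟨fun h => ⟨⟨h.1, h.2.trans hs.2⟩, h.2⟩, fun h => ⟨h.1.1, h.2⟩⟩
    _ = ∫ t in Ioc 0 x, ∫ s in Ioc 0 x, (Iic s).indicator (fun t => u' s * w t) t := hswap
    _ = ∫ t in Ioc 0 x, (u x - u t) * w t := by
        refine setIntegral_congr_fun measurableSet_Ioc fun t ht => ?_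
        have h1 : ∀ s, (Iic s).indicator (fun t => u' s * w t) t
            = (Ici t).indicator (fun s => u' s * w t) s := fun s => by
          simp [indicator]
        simp only [h1]
        rw [setIntegral_indicator measurableSet_Ici, integral_mul_const]
        congr 1
        have h2 : Ioc 0 x ∩ Ici t = Icc t x := by
          ext s
          simp only [mem_Ioc, mem_inter_iff, mem_Ici, mem_Icc]
          exact ⟨fun h => ⟨h.2, h.1.2⟩, fun h => ⟨⟨ht.1.trans_le h.1, h.2⟩, h.1⟩⟩
        rw [h2, integral_Icc_eq_integral_Ioc, ← intervalIntegral.integral_of_le ht.2,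
          intervalIntegral.integral_eq_sub_of_hasDerivAt (fun x _ => hu x)
            (hu'.intervalIntegrable t x)]

/-- The product rule, for a `C¹` function and a function in `H¹`. -/
theorem HasH1Deriv.mul_left {L : ℝ} {f w : ℝ → ℂ} (h : HasH1Deriv L f w) {u u' : ℝ → ℂ}
    (hu : ∀ x, HasDerivAt u (u' x) x) (hu' : Continuous u') :
    HasH1Deriv L (fun x => u x * f x) (fun x => u' x * f x + u x * w x) := by
  have huc : Continuous u := continuous_iff_continuousAt.2 fun x => (hu x).continuousAt
  refine ⟨(MemLp.continuousOn_mul hu'.continuousOn h.memLp).add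
    (MemLp.continuousOn_mul huc.continuousOn h.1), fun x hx => ?_⟩
  have hw := intervalIntegrable_of_memLp h.1 hx
  have h1 : IntervalIntegrable (fun s => u' s * f s) volume 0 x :=
    intervalIntegrable_of_memLp (MemLp.continuousOn_mul hu'.continuousOn h.memLp) hx
  have h2 : IntervalIntegrable (fun s => u s * w s) volume 0 x :=
    hw.continuousOn_mul huc.continuousOn
  have h3 : ∫ s in (0 : ℝ)..x, u' s * f s
      = (u x - u 0) * f 0 + ∫ s in (0 : ℝ)..x, u' s * ∫ t in (0 : ℝ)..s, w t := by
    rw [← intervalIntegral.integral_eq_sub_of_hasDerivAt (fun x _ => hu x)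
      (hu'.intervalIntegrable 0 x), ← intervalIntegral.integral_mul_const,
      ← intervalIntegral.integral_add]
    · refine intervalIntegral.integral_congr fun s hs => ?_
      rw [uIcc_of_le hx.1] at hs
      rw [h.2 s ⟨hs.1, hs.2.trans hx.2⟩]
      ring
    · exact (hu'.mul continuous_const).intervalIntegrable _ _
    · refine IntervalIntegrable.continuousOn_mul ?_ hu'.continuousOn
      apply ContinuousOn.intervalIntegrable
      exact intervalIntegral.continuousOn_primitive_interval' hw left_mem_uIcc
  rw [intervalIntegral.integral_add h1 h2, h3, integral_mul_primitive hu hu' hx.1 hw]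
  have h4 : ∫ t in (0 : ℝ)..x, (u x - u t) * w t
      = u x * (∫ t in (0 : ℝ)..x, w t) - ∫ t in (0 : ℝ)..x, u t * w t := by
    simp only [sub_mul]
    rw [intervalIntegral.integral_sub (hw.const_mul _) h2, intervalIntegral.integral_const_mul]
  rw [h4]
  linear_combination u x * h.2 x hx

theorem hasDerivAt_cexp_mul (k : ℂ) (x : ℝ) :
    HasDerivAt (fun x : ℝ => Complex.exp (k * x)) (k * Complex.exp (k * x)) x := by
  have h1 : HasDerivAt (fun s : ℝ => k * (s : ℂ)) k x := by
    simpa using (Complex.ofRealCLM.hasDerivAt (x := x)).const_mul k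
  simpa [mul_comm] using h1.cexp

theorem hasDerivAt_sinh_mul (k : ℂ) (x : ℝ) :
    HasDerivAt (fun x : ℝ => Complex.sinh (k * x)) (k * Complex.cosh (k * x)) x := by
  have h1 : HasDerivAt (fun s : ℂ => k * s) k x := by
    simpa using (hasDerivAt_id (x : ℂ)).const_mul k
  simpa [mul_comm] using h1.csinh.comp_ofReal

theorem hasDerivAt_cosh_mul (k : ℂ) (x : ℝ) :
    HasDerivAt (fun x : ℝ => Complex.cosh (k * x)) (k * Complex.sinh (k * x)) x := by
  have h1 : HasDerivAt (fun s : ℂ => k * s) k x := by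
    simpa using (hasDerivAt_id (x : ℂ)).const_mul k
  simpa [mul_comm] using h1.ccosh.comp_ofReal

/-- Integrating factor: `exp (-k x) f(x)` has zero derivative in `H¹`, hence is constant. -/
theorem HasH1Deriv.eq_exp_of_deriv_eq_mul {L : ℝ} {f w : ℝ → ℂ} (h : HasH1Deriv L f w) {k : ℂ}
    (hw : ∀ᵐ x ∂leb L, w x = k * f x) {x : ℝ} (hx : x ∈ Icc 0 L) :
    f x = f 0 * Complex.exp (k * x) := by
  have h1 := h.mul_left (hasDerivAt_cexp_mul (-k)) (by fun_prop)
  have h2 := (h1.congr_deriv (w' := 0) (by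
    filter_upwards [hw] with x hx
    rw [hx, Pi.zero_apply]
    ring)).2 x hx
  simp only [Pi.zero_apply, intervalIntegral.integral_zero, Complex.ofReal_zero, mul_zero,
    Complex.exp_zero, one_mul, add_zero] at h2
  rw [← h2, mul_right_comm, ← Complex.exp_add]
  simp

/-- Solutions of `u'' = k² u` with `u(0) = 0`. -/
theorem eq_sinh_of_deriv_deriv_eq {L : ℝ} {u v w : ℝ → ℂ} (huv : HasH1Deriv L u v)
    (hvw : HasH1Deriv L v w) {k : ℂ} (hw : ∀ᵐ x ∂leb L, w x = k ^ 2 * u x) (h0 : u 0 = 0)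
    {x : ℝ} (hx : x ∈ Icc 0 L) :
    k * u x = v 0 * Complex.sinh (k * x) ∧ v x = v 0 * Complex.cosh (k * x) := by
  -- `v + k u` and `v - k u` solve the first-order equations with rates `k` and `-k`, both starting
  -- from `v 0`. Half their difference and half their sum give the claim, without dividing by `k`.
  have h1 := (hvw.add (huv.smul k)).eq_exp_of_deriv_eq_mul (k := k) (by
    filter_upwards [hw] with x hx
    simp only [Pi.add_apply, Pi.smul_apply, smul_eq_mul, hx]
    ring) hx
  have h2 := (hvw.add (huv.smul (-k))).eq_exp_of_deriv_eq_mul (k := -k) (by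
    filter_upwards [hw] with x hx
    simp only [Pi.add_apply, Pi.smul_apply, smul_eq_mul, hx]
    ring) hx
  simp only [Pi.add_apply, Pi.smul_apply, smul_eq_mul, h0, mul_zero, add_zero, neg_mul] at h1 h2
  rw [Complex.sinh, Complex.cosh]
  constructor
  · linear_combination (h1 - h2) / 2
  · linear_combination (h1 + h2) / 2

/-! ### Bounded operators on `L²(0, L)` -/

section Operators

variable {L : ℝ}

/-- Multiplication by an essentially bounded function. -/
def mulOp (b : ℝ → ℂ) (hb : MemLp b ⊤ (leb L)) : L2 L →L[ℂ] L2 L :=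
  (ContinuousLinearMap.mul ℂ ℂ).holderL (leb L) ⊤ 2 2 hb.toLp

theorem mulOp_coe (b : ℝ → ℂ) (hb : MemLp b ⊤ (leb L)) (w : L2 L) :
    mulOp b hb w =ᵐ[leb L] fun x => b x * w x := by
  have h1 : mulOp b hb w =ᵐ[leb L] fun x => (hb.toLp b : ℝ → ℂ) x * w x :=
    (ContinuousLinearMap.mul ℂ ℂ).coeFn_holder (r := 2) (hb.toLp b) w
  filter_upwards [h1, hb.coeFn_toLp] with x h2 h3
  rw [h2, h3]

/-- Cauchy–Schwarz against the indicator of `(0, x]`, whose norm is `√x ≤ √L`. -/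
theorem norm_integral_le (w : L2 L) {x : ℝ} (hx : x ∈ Icc 0 L) :
    ‖∫ s in (0 : ℝ)..x, w s‖ ≤ √L * ‖w‖ := by
  have h1 : ∫ s in (0 : ℝ)..x, w s =
      inner ℂ (indicatorConstLp 2 (measurableSet_Ioc (a := (0 : ℝ)) (b := x))
        (measure_ne_top (leb L) _) (1 : ℂ)) w := by
    have h2 : (leb L).restrict (Ioc 0 x) = volume.restrict (Ioc 0 x) := by
      rw [leb_eq_restrict_Ioc, Measure.restrict_restrict measurableSet_Ioc,
        inter_eq_self_of_subset_left (Ioc_subset_Ioc_right hx.2)]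
    rw [L2.inner_indicatorConstLp_one, intervalIntegral.integral_of_le hx.1, h2]
  rw [h1]
  refine (norm_inner_le_norm _ _).trans ?_
  refine mul_le_mul_of_nonneg_right ?_ (norm_nonneg _)
  refine (norm_indicatorConstLp_le).trans ?_
  rw [norm_one, one_mul, ENNReal.toReal_ofNat, ← Real.sqrt_eq_rpow]
  refine Real.sqrt_le_sqrt ?_
  rw [leb_eq_restrict_Ioc, measureReal_restrict_apply measurableSet_Ioc,
    inter_eq_self_of_subset_left (Ioc_subset_Ioc_right hx.2), Real.volume_real_Ioc_of_le hx.1]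
  linarith [hx.2]

theorem integral_Lp_add (v w : L2 L) {x : ℝ} (hx : x ∈ Icc 0 L) :
    ∫ s in (0 : ℝ)..x, (v + w : L2 L) s
      = (∫ s in (0 : ℝ)..x, v s) + ∫ s in (0 : ℝ)..x, w s := by
  rw [integral_congr_leb (Lp.coeFn_add v w) hx]
  exact intervalIntegral.integral_add (intervalIntegrable_of_memLp (Lp.memLp v) hx)
    (intervalIntegrable_of_memLp (Lp.memLp w) hx)

theorem integral_Lp_smul (a : ℂ) (w : L2 L) {x : ℝ} (hx : x ∈ Icc 0 L) :
    ∫ s in (0 : ℝ)..x, (a • w : L2 L) s = a * ∫ s in (0 : ℝ)..x, w s := by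
  rw [integral_congr_leb (Lp.coeFn_smul a w) hx]
  exact intervalIntegral.integral_smul a _

/-- The integral over `(0, L)`. -/
def intOp (hL : 0 ≤ L) : L2 L →L[ℂ] ℂ :=
  LinearMap.mkContinuous
    { toFun := fun w => ∫ s in (0 : ℝ)..L, w s
      map_add' := fun v w => integral_Lp_add v w (right_mem_Icc.2 hL)
      map_smul' := fun a w => integral_Lp_smul a w (right_mem_Icc.2 hL) }
    (√L) fun w => norm_integral_le w (right_mem_Icc.2 hL)

theorem intOp_apply (hL : 0 ≤ L) (w : L2 L) : intOp hL w = ∫ s in (0 : ℝ)..L, w s := rfl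

theorem memLp_primitive (w : L2 L) : MemLp (fun x => ∫ s in (0 : ℝ)..x, w s) 2 (leb L) :=
  (HasH1Deriv.integral (Lp.memLp w)).memLp

/-- The operator `(V w)(x) = ∫₀ˣ w`. -/
def primOp (L : ℝ) : L2 L →L[ℂ] L2 L :=
  LinearMap.mkContinuousOfExistsBound
    { toFun := fun w => (memLp_primitive w).toLp
      map_add' := fun v w => by
        rw [← MemLp.toLp_add]
        apply MemLp.toLp_congr
        filter_upwards [ae_leb_mem L] with x hx using integral_Lp_add v w hx
      map_smul' := fun a w => by
        rw [RingHom.id_apply, ← MemLp.toLp_const_smul]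
        apply MemLp.toLp_congr
        filter_upwards [ae_leb_mem L] with x hx using integral_Lp_smul a w hx } <| by
    refine ⟨(leb L).real univ ^ (2 : ℝ≥0∞).toReal⁻¹ * √L, fun w => ?_⟩
    rw [mul_assoc]
    refine Lp.norm_le_of_ae_bound (by positivity) ?_
    filter_upwards [ae_leb_mem L, (memLp_primitive w).coeFn_toLp] with x hx h1
    simp only [LinearMap.coe_mk, AddHom.coe_mk]
    rw [h1]
    exact norm_integral_le w hx

theorem primOp_coe (w : L2 L) : primOp L w =ᵐ[leb L] fun x => ∫ s in (0 : ℝ)..x, w s :=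
  (memLp_primitive w).coeFn_toLp

theorem hasH1Deriv_primitive (w : L2 L) : HasH1Deriv L (fun x => ∫ s in (0 : ℝ)..x, w s) w :=
  .integral (Lp.memLp w)

theorem hasH1Deriv_primitive_primitive (w : L2 L) :
    HasH1Deriv L (fun x => ∫ s in (0 : ℝ)..x, primOp L w s) (fun x => ∫ s in (0 : ℝ)..x, w s) :=
  (hasH1Deriv_primitive (primOp L w)).congr_deriv (primOp_coe w)

/-- The constant function `1`. -/
def oneL2 (L : ℝ) : L2 L := (memLp_const (1 : ℂ)).toLp

theorem oneL2_coe (L : ℝ) : oneL2 L =ᵐ[leb L] fun _ => 1 := MemLp.coeFn_toLp _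

theorem integral_oneL2 {x : ℝ} (hx : x ∈ Icc 0 L) : ∫ s in (0 : ℝ)..x, oneL2 L s = x := by
  rw [integral_congr_leb (oneL2_coe L) hx]
  simp

theorem primOp_oneL2_coe : primOp L (oneL2 L) =ᵐ[leb L] fun x => (x : ℂ) := by
  filter_upwards [primOp_coe (oneL2 L), ae_leb_mem L] with x h1 hx
  rw [h1, integral_oneL2 hx]

/-- Differentiation, as an isometric isomorphism. -/
def H10.derivEquiv (L : ℝ) : H10 L ≃ₗᵢ[ℂ] L2 L :=
  LinearIsometryEquiv.ofSurjective (⟨H10.deriv, fun _ => rfl⟩ : H10 L →ₗᵢ[ℂ] L2 L)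
    H10.deriv_surjective

theorem H10.hasH1Deriv {g : H10 L} {u : ℝ → ℂ} (h : ∀ x : Icc (0 : ℝ) L, g.toFun x = u x) :
    HasH1Deriv L u (H10.deriv g) :=
  (hasH1Deriv_primitive (H10.deriv g)).congr_fun fun x hx => by
    rw [← h ⟨x, hx⟩, H10.toFun_eq]

theorem H10.primOp_deriv_coe {g : H10 L} {u : ℝ → ℂ}
    (h : ∀ x : Icc (0 : ℝ) L, g.toFun x = u x) : primOp L (H10.deriv g) =ᵐ[leb L] u := by
  filter_upwards [primOp_coe (H10.deriv g), ae_leb_mem L] with x h1 hx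
  rw [h1, ← h ⟨x, hx⟩, H10.toFun_eq]

theorem HasH1Deriv.deriv_unique (hL : 0 < L) {f v w : ℝ → ℂ} (h : HasH1Deriv L f v)
    (h' : HasH1Deriv L f w) : v =ᵐ[leb L] w := by
  have := (h.sub h').ae_eq_zero hL fun x _ => by simp
  filter_upwards [this] with x hx
  simpa [sub_eq_zero] using hx

/-- An element of `H10` is determined by its derivative, so pointwise identities can be checked
almost everywhere on derivatives. -/
theorem H10.toFun_eq_iff {g : H10 L} {u v : ℝ → ℂ} (hL : 0 < L) (h : HasH1Deriv L u v)
    (h0 : u 0 = 0) : (∀ x : Icc (0 : ℝ) L, g.toFun x = u x) ↔ H10.deriv g =ᵐ[leb L] v := by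
  constructor
  · intro hg
    exact (H10.hasH1Deriv hg).deriv_unique hL h
  · intro hg x
    rw [H10.toFun_eq, integral_congr_leb hg x.2, h.2 x x.2, h0, zero_add]

end Operators

/-! ### The operator is closed -/

section Closed

variable {L : ℝ} (hL : 0 < L) (c : ℝ) {β : ℝ → ℝ}
  (hβ : MemLp (fun x => (β x : ℂ)) ⊤ (leb L)) (α : ℝ)

/-- The second derivative `f''` of the first component, expressed through `X` and `A X = Y`. -/
def heatSource (X Y : H0 L) : L2 L :=
  Y.fst - (c : ℂ) • X.fst - mulOp _ hβ (primOp L (H10.deriv X.snd.fst))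

theorem heatSource_coe {X Y : H0 L} {f g h : ℝ → ℂ} (hX : Represents X f g h) :
    heatSource c hβ X Y =ᵐ[leb L] fun x => Y.fst x - c * f x - β x * g x := by
  have h1 := H10.primOp_deriv_coe hX.2.1
  filter_upwards [Lp.coeFn_sub (Y.fst - (c : ℂ) • X.fst)
      (mulOp _ hβ (primOp L (H10.deriv X.snd.fst))), Lp.coeFn_sub Y.fst ((c : ℂ) • X.fst),
    Lp.coeFn_smul (c : ℂ) X.fst, mulOp_coe _ hβ (primOp L (H10.deriv X.snd.fst)), h1, hX.1]
    with x e1 e2 e3 e4 e5 e6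
  rw [heatSource, e1, Pi.sub_apply, e2, Pi.sub_apply, e3, Pi.smul_apply, e4, e5, e6, smul_eq_mul]

/-- The graph of the operator, described by equations between bounded operators. -/
theorem cascadeRel_iff (X Y : H0 L) : CascadeRel L c β α X Y ↔
    (X.fst = primOp L (primOp L (heatSource c hβ X Y)) -
      ((L : ℂ)⁻¹ * intOp hL.le (primOp L (heatSource c hβ X Y))) • primOp L (oneL2 L)) ∧
    X.snd.snd = primOp L (H10.deriv Y.snd.fst) ∧
    H10.deriv X.snd.fst = primOp L Y.snd.snd -
      (intOp hL.le Y.snd.snd + α * intOp hL.le (H10.deriv Y.snd.fst)) • oneL2 L := by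
  have hLc : (L : ℂ) ≠ 0 := by exact_mod_cast hL.ne'
  have hLm : L ∈ Icc 0 L := right_mem_Icc.2 hL.le
  constructor
  · rintro ⟨f, f', f'', g, g', g'', h, h', hf, hg, hh, ⟨b1, b2, b3, b4, b5⟩, hX, hY⟩
    set p := heatSource c hβ X Y with hp
    have hf'' : f'' =ᵐ[leb L] p := by
      filter_upwards [heatSource_coe c hβ (Y := Y) hX, hY.1] with x e1 e2
      rw [hp, e1, e2]
      ring
    have hf' : ∀ x ∈ Icc 0 L, f' x = f' 0 + ∫ s in (0 : ℝ)..x, p s := fun x hx => by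
      rw [hf.2.2 x hx, integral_congr_leb hf'' hx]
    -- The only unknown left is `f' 0`; the condition `f L = 0` eliminates it below.
    have hfx : ∀ x ∈ Icc 0 L, f x = f' 0 * x + ∫ s in (0 : ℝ)..x, primOp L p s := fun x hx => by
      have e1 : f' =ᵐ[leb L] (f' 0 • oneL2 L + primOp L p : L2 L) := by
        filter_upwards [ae_leb_mem L, primOp_coe p, oneL2_coe L,
          Lp.coeFn_add (f' 0 • oneL2 L) (primOp L p), Lp.coeFn_smul (f' 0) (oneL2 L)]
          with s hs e1 e2 e3 e4
        rw [e3, Pi.add_apply, e4, Pi.smul_apply, e1, e2, hf' s hs]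
        simp
      rw [hf.1.2 x hx, b1, integral_congr_leb e1 hx, integral_Lp_add _ _ hx,
        integral_Lp_smul _ _ hx, integral_oneL2 hx, zero_add]
    refine ⟨?_, ?_, ?_⟩
    · have e0 := hfx L hLm
      rw [b2] at e0
      apply Lp.ext
      filter_upwards [ae_leb_mem L, hX.1, primOp_coe (primOp L p), primOp_oneL2_coe (L := L),
        Lp.coeFn_sub (primOp L (primOp L p))
          (((L : ℂ)⁻¹ * intOp hL.le (primOp L p)) • primOp L (oneL2 L)),
        Lp.coeFn_smul ((L : ℂ)⁻¹ * intOp hL.le (primOp L p)) (primOp L (oneL2 L))]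
        with x hx e1 e2 e3 e4 e5
      rw [e1, e4, Pi.sub_apply, e5, Pi.smul_apply, e2, e3, hfx x hx, intOp_apply, smul_eq_mul]
      field_simp
      linear_combination -x * e0
    · apply Lp.ext
      exact hX.2.2.trans (H10.primOp_deriv_coe hY.2.1).symm
    · have e0 : g' L = g' 0 + ∫ s in (0 : ℝ)..L, Y.snd.snd s := by
        rw [hg.2.2 L hLm, integral_congr_leb hY.2.2 hLm]
      have e1 : h L = ∫ s in (0 : ℝ)..L, H10.deriv Y.snd.fst s := by
        rw [← hY.2.1 ⟨L, hLm⟩, H10.toFun_eq]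
      apply Lp.ext
      filter_upwards [ae_leb_mem L, (H10.toFun_eq_iff hL hg.1 b3).1 hX.2.1,
        primOp_coe Y.snd.snd, oneL2_coe L, Lp.coeFn_sub (primOp L Y.snd.snd)
          ((intOp hL.le Y.snd.snd + α * intOp hL.le (H10.deriv Y.snd.fst)) • oneL2 L),
        Lp.coeFn_smul (intOp hL.le Y.snd.snd + α * intOp hL.le (H10.deriv Y.snd.fst)) (oneL2 L)]
        with x hx e2 e3 e4 e5 e6
      rw [e2, e5, Pi.sub_apply, e6, Pi.smul_apply, e3, e4, intOp_apply, intOp_apply, ← e1,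
        hg.2.2 x hx, integral_congr_leb hY.2.2.symm hx, smul_eq_mul]
      linear_combination b5 - e0
  · rintro ⟨hf, hh, hg⟩
    set p := heatSource c hβ X Y with hp
    -- The slope that makes the double primitive of `p`, corrected by `-k x`, vanish at `L`.
    set k : ℂ := (L : ℂ)⁻¹ * intOp hL.le (primOp L p) with hk
    -- The value of `-g' 0` dictated by the condition at `L`: the integral of `H10.deriv Y.snd.fst`
    -- over `(0, L)` is `h L`, so `g' L = -α h L`.
    set k' : ℂ := intOp hL.le Y.snd.snd + α * intOp hL.le (H10.deriv Y.snd.fst) with hk'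
    have hid : HasH1Deriv L (fun x : ℝ => (x : ℂ)) (fun _ => 1) :=
      .of_hasDerivAt (fun x => Complex.ofRealCLM.hasDerivAt) continuous_const
    have hg1 : HasH1Deriv L ((fun x => ∫ s in (0 : ℝ)..x, primOp L Y.snd.snd s) -
        k' • fun x : ℝ => (x : ℂ)) ((fun x => ∫ s in (0 : ℝ)..x, Y.snd.snd s) -
        k' • fun _ => 1) :=
      (hasH1Deriv_primitive_primitive Y.snd.snd).sub (hid.smul k')
    have hX : Represents X
        ((fun x => ∫ s in (0 : ℝ)..x, primOp L p s) - k • fun x : ℝ => (x : ℂ))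
        ((fun x => ∫ s in (0 : ℝ)..x, primOp L Y.snd.snd s) - k' • fun x : ℝ => (x : ℂ))
        (fun x => ∫ s in (0 : ℝ)..x, H10.deriv Y.snd.fst s) := by
      refine ⟨?_, ?_, ?_⟩
      · filter_upwards [primOp_coe (primOp L p), primOp_oneL2_coe (L := L),
          Lp.coeFn_sub (primOp L (primOp L p)) (k • primOp L (oneL2 L)),
          Lp.coeFn_smul k (primOp L (oneL2 L))] with x e1 e2 e3 e4
        rw [hf, e3, Pi.sub_apply, e4, Pi.smul_apply, e1, e2]
        rfl
      · rw [H10.toFun_eq_iff hL hg1 (by simp)]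
        filter_upwards [primOp_coe Y.snd.snd, oneL2_coe L,
          Lp.coeFn_sub (primOp L Y.snd.snd) (k' • oneL2 L),
          Lp.coeFn_smul k' (oneL2 L)] with x e1 e2 e3 e4
        rw [hg, e3, Pi.sub_apply, e4, Pi.smul_apply, e1, e2]
        rfl
      · rw [hh]
        exact primOp_coe _
    refine ⟨_, (fun x => ∫ s in (0 : ℝ)..x, p s) - k • fun _ => 1, p, _, _, Y.snd.snd, _,
      H10.deriv Y.snd.fst, ⟨(hasH1Deriv_primitive_primitive p).sub (hid.smul k), ?_⟩,
      ⟨hg1, ?_⟩, hasH1Deriv_primitive _, ⟨?_, ?_, ?_, ?_, ?_⟩, hX, ?_, ?_, ?_⟩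
    · have := (hasH1Deriv_primitive p).sub ((HasH1Deriv.const L 1).smul k)
      simpa using this
    · have := (hasH1Deriv_primitive Y.snd.snd).sub ((HasH1Deriv.const L 1).smul k')
      simpa using this
    · simp
    · simp only [Pi.sub_apply, Pi.smul_apply, smul_eq_mul, hk, intOp_apply]
      field_simp
      ring
    · simp
    · simp
    · simp only [Pi.sub_apply, Pi.smul_apply, smul_eq_mul, hk', intOp_apply]
      ring
    · filter_upwards [heatSource_coe c hβ (Y := Y) hX] with x e1
      rw [hp, e1]
      ring
    · intro x
      rw [H10.toFun_eq]
    · rfl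

end Closed

/-- By `cascadeRel_iff` the graph is the set where three pairs of continuous maps agree. -/
theorem cascadeOp_isClosed {L : ℝ} (hL : 0 < L) (c : ℝ) {β : ℝ → ℝ}
    (hβ : MemLp (fun x => (β x : ℂ)) ⊤ (leb L)) (α : ℝ) : (cascadeOp L c β α).IsClosed := by
  have h1 : ((cascadeOp L c β α).graph : Set (H0 L × H0 L)) =
      {q | CascadeRel L c β α q.1 q.2} := by
    ext ⟨X, Y⟩
    exact cascadeOp_graph hL c β α X Y
  rw [LinearPMap.IsClosed, h1]
  simp only [cascadeRel_iff hL c hβ α]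
  have cd : Continuous fun g : H10 L => H10.deriv g := (H10.derivEquiv L).continuous
  have c1 : Continuous fun q : H0 L × H0 L => q.1.fst := by fun_prop
  have c2 : Continuous fun q : H0 L × H0 L => H10.deriv q.1.snd.fst := cd.comp (by fun_prop)
  have c3 : Continuous fun q : H0 L × H0 L => q.1.snd.snd := by fun_prop
  have d1 : Continuous fun q : H0 L × H0 L => q.2.fst := by fun_prop
  have d2 : Continuous fun q : H0 L × H0 L => H10.deriv q.2.snd.fst := cd.comp (by fun_prop)
  have d3 : Continuous fun q : H0 L × H0 L => q.2.snd.snd := by fun_prop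
  have hp : Continuous fun q : H0 L × H0 L => heatSource c hβ q.1 q.2 := by
    unfold heatSource
    fun_prop
  refine (isClosed_eq c1 ?_).inter ((isClosed_eq c3 ?_).inter (isClosed_eq c2 ?_))
  all_goals fun_prop

/-- There are no real eigenvalues to the right of `0` and `c`. -/
theorem eq_zero_of_cascadeRel_smul {L : ℝ} (hL : 0 < L) {c : ℝ} {β : ℝ → ℝ} {α : ℝ} (hα : 0 ≤ α)
    {z : ℝ} (hz : 0 < z) (hzc : c < z) {X : H0 L}
    (h : CascadeRel L c β α X ((z : ℂ) • X)) : X = 0 := by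
  obtain ⟨f, f', f'', g, g', g'', h, h', hf, hg, hh, ⟨b1, b2, b3, b4, b5⟩, hX, hY⟩ := h
  have hLm : L ∈ Icc 0 L := right_mem_Icc.2 hL.le
  have hzX := hX.smul (z : ℂ)
  have e2 : ∀ x ∈ Icc 0 L, h x = z * g x := fun x hx =>
    (hY.2.1 ⟨x, hx⟩).symm.trans (hzX.2.1 ⟨x, hx⟩)
  have e3 : ∀ᵐ x ∂leb L, g'' x = (z : ℂ) ^ 2 * g x := by
    filter_upwards [hY.2.2, hzX.2.2, hX.2.2, ae_leb_mem L] with x a1 a2 a3 hx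
    rw [← a1, a2, Pi.smul_apply, e2 x hx, smul_eq_mul]
    ring
  have hgs := fun x (hx : x ∈ Icc 0 L) => eq_sinh_of_deriv_deriv_eq hg.1 hg.2 e3 b3 hx
  have hz0 : (z : ℂ) ≠ 0 := by exact_mod_cast hz.ne'
  -- Here `h = z g` and `g'' = z² g`, so the condition at `L` reads `g' 0 * (cosh (z L) + α sinh (z
  -- L)) = 0`. The factor is positive since `z > 0` and `α ≥ 0`.
  have hg0 : g' 0 = 0 := by
    have h1 := hgs L hLm
    have h2 : g' 0 * ((Real.cosh (z * L) + α * Real.sinh (z * L) : ℝ) : ℂ) = 0 := by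
      push_cast
      linear_combination b5 - h1.2 - α * h1.1 - α * e2 L hLm
    refine (mul_eq_zero.1 h2).resolve_right ?_
    have h3 : 0 < Real.sinh (z * L) := Real.sinh_pos_iff.2 (by positivity)
    have h4 := Real.cosh_pos (z * L)
    exact_mod_cast (by positivity : Real.cosh (z * L) + α * Real.sinh (z * L) ≠ 0)
  have g0 : ∀ x ∈ Icc 0 L, g x = 0 := fun x hx => by
    have := (hgs x hx).1
    rw [hg0, zero_mul] at this
    exact (mul_eq_zero.1 this).resolve_left hz0
  -- With `g = 0` the first component decouples: `f'' = (z - c) f` with Dirichlet conditions, and `z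
  -- > c` rules out oscillation.
  have hk : 0 < √(z - c) := Real.sqrt_pos.2 (sub_pos.2 hzc)
  have hk0 : ((√(z - c) : ℝ) : ℂ) ≠ 0 := by exact_mod_cast hk.ne'
  have e1 : ∀ᵐ x ∂leb L, f'' x = ((√(z - c) : ℝ) : ℂ) ^ 2 * f x := by
    rw [← Complex.ofReal_pow, Real.sq_sqrt (sub_pos.2 hzc).le]
    filter_upwards [hY.1, hzX.1, ae_leb_mem L] with x a1 a2 hx
    rw [a2, g0 x hx, Pi.smul_apply, smul_eq_mul] at a1
    push_cast
    linear_combination -a1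
  have hfs := fun x (hx : x ∈ Icc 0 L) => eq_sinh_of_deriv_deriv_eq hf.1 hf.2 e1 b1 hx
  have hf0 : f' 0 = 0 := by
    have h1 := (hfs L hLm).1
    rw [b2, mul_zero] at h1
    refine (mul_eq_zero.1 h1.symm).resolve_right ?_
    have h3 : 0 < Real.sinh (√(z - c) * L) := Real.sinh_pos_iff.2 (by positivity)
    exact_mod_cast h3.ne'
  have f0 : ∀ x ∈ Icc 0 L, f x = 0 := fun x hx => by
    have := (hfs x hx).1
    rw [hf0, zero_mul] at this
    exact (mul_eq_zero.1 this).resolve_left hk0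
  have y1 : X.fst = 0 := by
    apply Lp.ext
    filter_upwards [hX.1, ae_leb_mem L, Lp.coeFn_zero ℂ 2 (leb L)] with x a1 hx a2
    rw [a1, a2, f0 x hx, Pi.zero_apply]
  have y3 : X.snd.snd = 0 := by
    apply Lp.ext
    filter_upwards [hX.2.2, ae_leb_mem L, Lp.coeFn_zero ℂ 2 (leb L)] with x a1 hx a2
    rw [a1, a2, e2 x hx, g0 x hx, mul_zero, Pi.zero_apply]
  have y2 : X.snd.fst = 0 := by
    apply H10.deriv_injective
    rw [map_zero]
    apply Lp.ext
    refine ((H10.toFun_eq_iff hL (HasH1Deriv.zero L) rfl).1 fun x => ?_).trans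
      (Lp.coeFn_zero ℂ 2 (leb L)).symm
    rw [hX.2.1 x, g0 x x.2, Pi.zero_apply]
  apply (WithLp.equiv 2 _).injective
  refine Prod.ext y1 ?_
  apply (WithLp.equiv 2 _).injective
  exact Prod.ext y2 y3

/-! ### The function `sinh (r x) / r` -/

section SinhDiv

variable (r : ℂ)

theorem mul_sinhDiv (x : ℝ) : r * sinhDiv r x = Complex.sinh (r * x) := by
  unfold sinhDiv
  split_ifs with h
  · simp [h]
  · field_simp

theorem sinhDiv_zero_right : sinhDiv r 0 = 0 := by
  simp [sinhDiv]

theorem hasDerivAt_sinhDiv (x : ℝ) : HasDerivAt (sinhDiv r) (Complex.cosh (r * x)) x := by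
  by_cases h : r = 0
  · have h1 : sinhDiv r = fun x : ℝ => (x : ℂ) := by
      funext x
      simp [sinhDiv, h]
    rw [h1, h, zero_mul, Complex.cosh_zero]
    exact Complex.ofRealCLM.hasDerivAt
  · have h1 : sinhDiv r = fun x : ℝ => Complex.sinh (r * x) / r := by
      funext x
      simp [sinhDiv, h]
    rw [h1]
    have := (hasDerivAt_sinh_mul r x).div_const r
    rwa [mul_div_cancel_left₀ _ h] at this

theorem continuous_sinhDiv : Continuous (sinhDiv r) :=
  continuous_iff_continuousAt.2 fun x => (hasDerivAt_sinhDiv r x).continuousAt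

theorem hasDerivAt_cosh_mul_sinhDiv (x : ℝ) :
    HasDerivAt (fun x : ℝ => Complex.cosh (r * x)) (r ^ 2 * sinhDiv r x) x := by
  have := hasDerivAt_cosh_mul r x
  rwa [← mul_sinhDiv, ← mul_assoc, ← pow_two] at this

theorem sinhDiv_sub (x s : ℝ) : sinhDiv r (x - s) =
    sinhDiv r x * Complex.cosh (r * s) - Complex.cosh (r * x) * sinhDiv r s := by
  unfold sinhDiv
  split_ifs with h
  · simp [h]
  · push_cast
    rw [mul_sub, Complex.sinh_sub]
    ring

theorem cosh_sq_sub_sinhDiv_sq (x : ℝ) :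
    Complex.cosh (r * x) ^ 2 - r ^ 2 * sinhDiv r x ^ 2 = 1 := by
  rw [← mul_pow, mul_sinhDiv, Complex.cosh_sq_sub_sinh_sq]

/-- Turns the two terms of `waveFun1` into the product form of Green's function. Estimating them
separately would miss the cancellation of their exponentially large parts. -/
theorem sinhDiv_green (L x s : ℝ) :
    sinhDiv r (x - s) * sinhDiv r L + sinhDiv r (L - x) * sinhDiv r s =
      sinhDiv r x * sinhDiv r (L - s) := by
  rw [sinhDiv_sub, sinhDiv_sub, sinhDiv_sub]
  ring

end SinhDiv

theorem norm_sinh_le (z : ℂ) : ‖Complex.sinh z‖ ≤ Real.cosh z.re := by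
  rw [Complex.sinh, norm_div, Complex.norm_ofNat, Real.cosh_eq]
  have := norm_sub_le (Complex.exp z) (Complex.exp (-z))
  rw [Complex.norm_exp, Complex.norm_exp, Complex.neg_re] at this
  linarith

/-- Reverse triangle inequality for `exp z - exp (-z)`; it keeps the denominator `sinh (r L)` of
Green's function away from zero. -/
theorem sinh_re_le_norm_sinh (z : ℂ) : Real.sinh z.re ≤ ‖Complex.sinh z‖ := by
  rw [Complex.sinh, norm_div, Complex.norm_ofNat, Real.sinh_eq]
  have := norm_sub_norm_le (Complex.exp z) (Complex.exp (-z))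
  rw [Complex.norm_exp, Complex.norm_exp, Complex.neg_re] at this
  linarith

/-! ### The first component of the hyperbolic eigenvectors -/

section WaveFun

variable {L : ℝ} {β : ℝ → ℝ}

theorem memLp_top_mul_continuous (hβ : MemLp (fun x => (β x : ℂ)) ⊤ (leb L)) {u : ℝ → ℂ}
    (hu : Continuous u) : MemLp (fun x => (β x : ℂ) * u x) 2 (leb L) :=
  have h := (memLp_leb_of_continuousOn hu.continuousOn 2).mul' hβ
  h

/-- Variation of constants for the first component of the hyperbolic eigenvectors. -/
theorem waveFun1_eq (hL : 0 < L) (hβ : MemLp (fun x => (β x : ℂ)) ⊤ (leb L)) {ev r : ℂ} (a : ℝ)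
    (hr : sinhDiv r L ≠ 0) {x : ℝ} (hx : x ∈ Icc 0 L) :
    waveFun1 L β ev r a x = 1 / (a : ℂ) *
      (sinhDiv r x * ((∫ s in (0 : ℝ)..L, (β s : ℂ) * Complex.sinh (ev * s) * Complex.cosh (r * s))
          - (∫ s in (0 : ℝ)..L, (β s : ℂ) * Complex.sinh (ev * s) * sinhDiv r s) / sinhDiv r L *
            Complex.cosh (r * L)
          - ∫ s in (0 : ℝ)..x, (β s : ℂ) * Complex.sinh (ev * s) * Complex.cosh (r * s))
        + Complex.cosh (r * x) *
          ∫ s in (0 : ℝ)..x, (β s : ℂ) * Complex.sinh (ev * s) * sinhDiv r s) := by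
  have hLm : L ∈ Icc 0 L := right_mem_Icc.2 hL.le
  have hS := continuous_sinhDiv r
  have hPi : ∀ y ∈ Icc 0 L, IntervalIntegrable
      (fun s : ℝ => (β s : ℂ) * Complex.sinh (ev * s) * Complex.cosh (r * s)) volume 0 y :=
    fun y hy => by
      simp only [mul_assoc (β _ : ℂ)]
      exact intervalIntegrable_of_memLp (memLp_top_mul_continuous hβ (by fun_prop)) hy
  have hQi : ∀ y ∈ Icc 0 L, IntervalIntegrable
      (fun s : ℝ => (β s : ℂ) * Complex.sinh (ev * s) * sinhDiv r s) volume 0 y :=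
    fun y hy => by
      simp only [mul_assoc (β _ : ℂ)]
      exact intervalIntegrable_of_memLp (memLp_top_mul_continuous hβ (by fun_prop)) hy
  have h1 : ∫ s in x..L, (β s : ℂ) * Complex.sinh (ev * s) * sinhDiv r (x - s) =
      sinhDiv r x * (∫ s in x..L, (β s : ℂ) * Complex.sinh (ev * s) * Complex.cosh (r * s)) -
      Complex.cosh (r * x) * ∫ s in x..L, (β s : ℂ) * Complex.sinh (ev * s) * sinhDiv r s := by
    rw [← intervalIntegral.integral_const_mul, ← intervalIntegral.integral_const_mul,
      ← intervalIntegral.integral_sub]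
    · refine intervalIntegral.integral_congr fun s _ => ?_
      simp only [sinhDiv_sub]
      ring
    · exact ((hPi x hx).symm.trans (hPi L hLm)).const_mul _
    · exact ((hQi x hx).symm.trans (hQi L hLm)).const_mul _
  rw [waveFun1, h1, ← intervalIntegral.integral_interval_sub_left (hPi L hLm) (hPi x hx),
    ← intervalIntegral.integral_interval_sub_left (hQi L hLm) (hQi x hx), sinhDiv_sub,
    mul_comm (a : ℂ), ← div_div]
  generalize (∫ s in (0 : ℝ)..L, (β s : ℂ) * Complex.sinh (ev * s) * Complex.cosh (r * s)) = p₁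
  generalize (∫ s in (0 : ℝ)..x, (β s : ℂ) * Complex.sinh (ev * s) * Complex.cosh (r * s)) = p₂
  generalize (∫ s in (0 : ℝ)..L, (β s : ℂ) * Complex.sinh (ev * s) * sinhDiv r s) = q₁
  generalize (∫ s in (0 : ℝ)..x, (β s : ℂ) * Complex.sinh (ev * s) * sinhDiv r s) = q₂
  have hk : q₁ / sinhDiv r L * sinhDiv r L = q₁ := div_mul_cancel₀ _ hr
  linear_combination 1 / (a : ℂ) * Complex.cosh (r * x) * hk

/-- Differentiate the form in `waveFun1_eq`. The contributions of the variable integrals cancel in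
the first derivative. In the second they leave `-β sinh (ev x) / a` times `cosh² (r x) - r² (sinhDiv
r x)² = 1`. -/
theorem hasH1Deriv_waveFun1 (hL : 0 < L) (hβ : MemLp (fun x => (β x : ℂ)) ⊤ (leb L)) {ev r : ℂ}
    (a : ℝ) (hr : sinhDiv r L ≠ 0) :
    ∃ f' : ℝ → ℂ, HasH1Deriv L (waveFun1 L β ev r a) f' ∧
      HasH1Deriv L f' (fun x => r ^ 2 * waveFun1 L β ev r a x - β x * waveFun2 ev a x) := by
  have hS := continuous_sinhDiv r
  set K : ℂ := (∫ s in (0 : ℝ)..L, (β s : ℂ) * Complex.sinh (ev * s) * Complex.cosh (r * s))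
      - (∫ s in (0 : ℝ)..L, (β s : ℂ) * Complex.sinh (ev * s) * sinhDiv r s) / sinhDiv r L *
        Complex.cosh (r * L) with hK
  have hP : MemLp (fun s : ℝ => (β s : ℂ) * Complex.sinh (ev * s) * Complex.cosh (r * s)) 2
      (leb L) := by
    simp only [mul_assoc (β _ : ℂ)]
    exact memLp_top_mul_continuous hβ (by fun_prop)
  have hQ : MemLp (fun s : ℝ => (β s : ℂ) * Complex.sinh (ev * s) * sinhDiv r s) 2 (leb L) := by
    simp only [mul_assoc (β _ : ℂ)]
    exact memLp_top_mul_continuous hβ (by fun_prop)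
  have h1 := (HasH1Deriv.const L K).sub (HasH1Deriv.integral hP)
  have h2 := HasH1Deriv.integral hQ
  have hcosh : Continuous fun x : ℝ => Complex.cosh (r * x) := by fun_prop
  have h3 := ((h1.mul_left (hasDerivAt_sinhDiv r) hcosh).add
    (h2.mul_left (hasDerivAt_cosh_mul_sinhDiv r) (by fun_prop))).smul (1 / (a : ℂ))
  have h4 := ((h1.mul_left (hasDerivAt_cosh_mul_sinhDiv r) (by fun_prop)).add
    ((h2.mul_left (hasDerivAt_sinhDiv r) hcosh).smul (r ^ 2))).smul (1 / (a : ℂ))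
  refine ⟨_, (h3.congr_deriv ?_).congr_fun fun x hx => ?_, h4.congr_deriv ?_⟩
  · refine Eventually.of_forall fun x => ?_
    simp only [Pi.smul_apply, Pi.add_apply, Pi.sub_apply, Pi.zero_apply, smul_eq_mul]
    ring
  · rw [waveFun1_eq hL hβ a hr hx]
    simp only [Pi.smul_apply, Pi.add_apply, Pi.sub_apply, smul_eq_mul, hK]
  · filter_upwards [ae_leb_mem L] with x hx
    rw [waveFun1_eq hL hβ a hr hx]
    simp only [Pi.smul_apply, Pi.add_apply, Pi.sub_apply, Pi.zero_apply, smul_eq_mul, waveFun2]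
    rw [← hK]
    linear_combination -(1 / (a : ℂ)) * (β x * Complex.sinh (ev * x)) * cosh_sq_sub_sinhDiv_sq r x

theorem waveFun1_zero (hL : 0 < L) (hβ : MemLp (fun x => (β x : ℂ)) ⊤ (leb L)) {ev r : ℂ}
    (a : ℝ) (hr : sinhDiv r L ≠ 0) : waveFun1 L β ev r a 0 = 0 := by
  rw [waveFun1_eq hL hβ a hr (left_mem_Icc.2 hL.le), sinhDiv_zero_right]
  simp

theorem waveFun1_right (ev r : ℂ) (a : ℝ) : waveFun1 L β ev r a L = 0 := by
  simp [waveFun1, sinhDiv_zero_right]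

theorem integral_cosh_mul {ρ : ℝ} (hρ : ρ ≠ 0) (x : ℝ) :
    ∫ s in (0 : ℝ)..x, Real.cosh (ρ * s) = Real.sinh (ρ * x) / ρ := by
  have h1 : ∀ s, HasDerivAt (fun s => Real.sinh (ρ * s) / ρ) (Real.cosh (ρ * s)) s := fun s => by
    have h2 : HasDerivAt (fun s : ℝ => ρ * s) ρ s := by
      simpa using (hasDerivAt_id s).const_mul ρ
    have := (h2.sinh).div_const ρ
    rwa [mul_div_cancel_right₀ _ hρ] at this
  rw [intervalIntegral.integral_eq_sub_of_hasDerivAt (fun s _ => h1 s)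
    (Continuous.intervalIntegrable (by fun_prop) _ _)]
  simp

theorem norm_sinhDiv_le {r : ℂ} (hr : 0 < r.re) (x : ℝ) :
    ‖sinhDiv r x‖ ≤ Real.cosh (r.re * x) / ‖r‖ := by
  have h0 : r ≠ 0 := fun h => by simp [h] at hr
  rw [le_div_iff₀ (norm_pos_iff.2 h0), mul_comm ‖sinhDiv r x‖, ← norm_mul, mul_sinhDiv]
  simpa using norm_sinh_le (r * x)

theorem le_norm_sinhDiv {r : ℂ} (hr : 0 < r.re) (x : ℝ) :
    Real.sinh (r.re * x) / ‖r‖ ≤ ‖sinhDiv r x‖ := by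
  have h0 : r ≠ 0 := fun h => by simp [h] at hr
  rw [div_le_iff₀ (norm_pos_iff.2 h0), mul_comm ‖sinhDiv r x‖, ← norm_mul, mul_sinhDiv]
  simpa using sinh_re_le_norm_sinh (r * x)

/-- The estimate of Green's function of `f'' - r² f` with Dirichlet boundary conditions. -/
theorem norm_waveFun1_le (hL : 0 < L) (hβ : MemLp (fun x => (β x : ℂ)) ⊤ (leb L)) {M : ℝ}
    (hM : ∀ᵐ x ∂leb L, ‖(β x : ℂ)‖ ≤ M) {ev r : ℂ} (a : ℝ) {K : ℝ}
    (hK : ∀ x ∈ Icc 0 L, ‖Complex.sinh (ev * x)‖ ≤ K) (hr : 0 < r.re) {x : ℝ} (hx : x ∈ Icc 0 L) :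
    ‖waveFun1 L β ev r a x‖ ≤ M * K / (|a| * (‖r‖ * r.re)) := by
  have hS := continuous_sinhDiv r
  have hLm : L ∈ Icc 0 L := right_mem_Icc.2 hL.le
  have hr0 : 0 < ‖r‖ := hr.trans_le ((le_abs_self _).trans (Complex.abs_re_le_norm r))
  have hsL : 0 < Real.sinh (r.re * L) := Real.sinh_pos_iff.2 (by positivity)
  have hSL : 0 < ‖sinhDiv r L‖ := (div_pos hsL hr0).trans_le (le_norm_sinhDiv hr L)
  have hSL0 : sinhDiv r L ≠ 0 := norm_pos_iff.1 hSL
  set q : ℝ → ℂ := fun s => (β s : ℂ) * Complex.sinh (ev * s) with hq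
  have hqi : ∀ (u : ℝ → ℂ), Continuous u → ∀ y ∈ Icc 0 L,
      IntervalIntegrable (fun s => q s * u s) volume 0 y := fun u hu y hy => by
    simp only [hq, mul_assoc (β _ : ℂ)]
    exact intervalIntegrable_of_memLp (memLp_top_mul_continuous hβ (by fun_prop)) hy
  have hqM : ∀ᵐ s, s ∈ Ioc 0 L → ‖q s‖ ≤ M * K := by
    have h1 : ∀ᵐ s ∂volume.restrict (Ioc 0 L), ‖(β s : ℂ)‖ ≤ M := by
      rwa [← leb_eq_restrict_Ioc]
    rw [ae_restrict_iff' measurableSet_Ioc] at h1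
    filter_upwards [h1] with s hs hsm
    rw [hq, norm_mul]
    exact mul_le_mul (hs hsm) (hK s (Ioc_subset_Icc_self hsm)) (norm_nonneg _)
      ((norm_nonneg _).trans (hs hsm))
  -- No sign is assumed on `M` or `K`. Since `(0, L]` has positive measure, the bound on `‖q s‖`
  -- holds at some point of it.
  have hMK : 0 ≤ M * K := by
    obtain ⟨s, hs⟩ : ∃ s ∈ Ioc 0 L, ‖q s‖ ≤ M * K := by
      by_contra! hcon
      have h1 : ∀ᵐ s, s ∉ Ioc 0 L := by
        filter_upwards [hqM] with s hs hsm using (hcon s hsm).not_ge (hs hsm)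
      have h2 : volume (Ioc 0 L) = 0 := by
        rw [measure_eq_zero_iff_ae_notMem]
        exact h1
      rw [Real.volume_Ioc, ENNReal.ofReal_eq_zero] at h2
      linarith
    exact (norm_nonneg _).trans hs.2
  -- Splitting the integral over `(0, L)` at `x` and applying `sinhDiv_green` on `(x, L)` gives the
  -- symmetric Green's representation.
  have hrep : waveFun1 L β ev r a x = 1 / (a * sinhDiv r L) *
      (sinhDiv r x * (∫ s in x..L, q s * sinhDiv r (L - s)) +
        sinhDiv r (L - x) * ∫ s in (0 : ℝ)..x, q s * sinhDiv r s) := by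
    have e1 : (∫ s in x..L, q s * sinhDiv r (x - s)) * sinhDiv r L +
        sinhDiv r (L - x) * (∫ s in x..L, q s * sinhDiv r s) =
        sinhDiv r x * (∫ s in x..L, q s * sinhDiv r (L - s)) := by
      rw [← intervalIntegral.integral_mul_const, ← intervalIntegral.integral_const_mul,
        ← intervalIntegral.integral_const_mul, ← intervalIntegral.integral_add]
      · refine intervalIntegral.integral_congr fun s _ => ?_
        linear_combination q s * sinhDiv_green r L x s
      · exact ((hqi _ (by fun_prop) x hx).symm.trans (hqi _ (by fun_prop) L hLm)).mul_const _
      · exact ((hqi _ (by fun_prop) x hx).symm.trans (hqi _ (by fun_prop) L hLm)).const_mul _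
    have e2 : (∫ s in (0 : ℝ)..L, q s * sinhDiv r s) = (∫ s in (0 : ℝ)..x, q s * sinhDiv r s) +
        ∫ s in x..L, q s * sinhDiv r s :=
      (intervalIntegral.integral_add_adjacent_intervals (hqi _ (by fun_prop) x hx)
        ((hqi _ (by fun_prop) x hx).symm.trans (hqi _ (by fun_prop) L hLm))).symm
    rw [← e1]
    change 1 / (a : ℂ) * (∫ s in x..L, q s * sinhDiv r (x - s)) +
      sinhDiv r (L - x) / (a * sinhDiv r L) * (∫ s in (0 : ℝ)..L, q s * sinhDiv r s) = _
    rw [e2]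
    field_simp
    ring
  have hI2 : ‖∫ s in (0 : ℝ)..x, q s * sinhDiv r s‖ ≤
      M * K / ‖r‖ * (Real.sinh (r.re * x) / r.re) := by
    rw [← integral_cosh_mul hr.ne', ← intervalIntegral.integral_const_mul]
    refine intervalIntegral.norm_integral_le_of_norm_le hx.1 ?_
      (Continuous.intervalIntegrable (by fun_prop) _ _)
    filter_upwards [hqM] with s hs hsm
    rw [norm_mul, div_mul_eq_mul_div, mul_div_assoc]
    exact mul_le_mul (hs ⟨hsm.1, hsm.2.trans hx.2⟩) (norm_sinhDiv_le hr s) (norm_nonneg _) hMK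
  have hI1 : ‖∫ s in x..L, q s * sinhDiv r (L - s)‖ ≤
      M * K / ‖r‖ * (Real.sinh (r.re * (L - x)) / r.re) := by
    have e1 : ∫ s in x..L, Real.cosh (r.re * (L - s)) = Real.sinh (r.re * (L - x)) / r.re := by
      rw [intervalIntegral.integral_comp_sub_left (fun s => Real.cosh (r.re * s)), sub_self,
        integral_cosh_mul hr.ne']
    rw [← e1, ← intervalIntegral.integral_const_mul]
    refine intervalIntegral.norm_integral_le_of_norm_le hx.2 ?_
      (Continuous.intervalIntegrable (by fun_prop) _ _)
    filter_upwards [hqM] with s hs hsm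
    rw [norm_mul, div_mul_eq_mul_div, mul_div_assoc]
    exact mul_le_mul (hs ⟨hx.1.trans_lt hsm.1, hsm.2⟩) (norm_sinhDiv_le hr _) (norm_nonneg _) hMK
  -- The two products of `cosh` and `sinh` add up to `sinh (Re r * L)` by the addition formula, so
  -- no exponential growth in `Re r` survives division by `sinhDiv r L`.
  have hsum : ‖sinhDiv r x * (∫ s in x..L, q s * sinhDiv r (L - s)) +
        sinhDiv r (L - x) * ∫ s in (0 : ℝ)..x, q s * sinhDiv r s‖ ≤
      M * K / (‖r‖ ^ 2 * r.re) * Real.sinh (r.re * L) := by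
    have e1 : Real.sinh (r.re * L) = Real.cosh (r.re * x) * Real.sinh (r.re * (L - x)) +
        Real.cosh (r.re * (L - x)) * Real.sinh (r.re * x) := by
      have : r.re * L = r.re * x + r.re * (L - x) := by ring
      rw [this, Real.sinh_add]
      ring
    refine (norm_add_le _ _).trans ?_
    rw [norm_mul, norm_mul, e1]
    calc _ ≤ Real.cosh (r.re * x) / ‖r‖ * (M * K / ‖r‖ * (Real.sinh (r.re * (L - x)) / r.re)) +
          Real.cosh (r.re * (L - x)) / ‖r‖ * (M * K / ‖r‖ * (Real.sinh (r.re * x) / r.re)) :=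
          add_le_add (mul_le_mul (norm_sinhDiv_le hr _) hI1 (norm_nonneg _) (by positivity))
            (mul_le_mul (norm_sinhDiv_le hr _) hI2 (norm_nonneg _) (by positivity))
      _ = _ := by
          field_simp
  rw [hrep, norm_mul, norm_div, norm_one, norm_mul, Complex.norm_real, Real.norm_eq_abs]
  have h1 : Real.sinh (r.re * L) / ‖sinhDiv r L‖ ≤ ‖r‖ := by
    rw [div_le_iff₀ hSL]
    have := le_norm_sinhDiv hr L
    rwa [div_le_iff₀ hr0, mul_comm ‖sinhDiv r L‖] at this
  calc _ ≤ 1 / (|a| * ‖sinhDiv r L‖) * (M * K / (‖r‖ ^ 2 * r.re) * Real.sinh (r.re * L)) := by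
        gcongr
    _ = M * K / (|a| * (‖r‖ ^ 2 * r.re)) * (Real.sinh (r.re * L) / ‖sinhDiv r L‖) := by
        field_simp
    _ ≤ M * K / (|a| * (‖r‖ ^ 2 * r.re)) * ‖r‖ := by gcongr
    _ = _ := by
        rcases eq_or_ne a 0 with h | h
        · simp [h]
        · have := abs_pos.2 h
          field_simp

end WaveFun

/-! ### Eigenvectors -/

section Eigenvectors

variable {L : ℝ}

theorem Represents.congr {X : H0 L} {f g h f₁ g₁ h₁ : ℝ → ℂ} (H : Represents X f g h)
    (hf : ∀ x ∈ Icc 0 L, f x = f₁ x) (hg : ∀ x ∈ Icc 0 L, g x = g₁ x)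
    (hh : ∀ x ∈ Icc 0 L, h x = h₁ x) : Represents X f₁ g₁ h₁ := by
  refine ⟨?_, fun x => (H.2.1 x).trans (hg x x.2), ?_⟩
  · filter_upwards [H.1, ae_leb_mem L] with x h1 hx using h1.trans (hf x hx)
  · filter_upwards [H.2.2, ae_leb_mem L] with x h1 hx using h1.trans (hh x hx)

theorem hasH1Deriv_waveFun2 (ev : ℂ) (a : ℝ) :
    HasH1Deriv L (waveFun2 ev a) (fun x => ev / a * Complex.cosh (ev * x)) := by
  have h1 : HasH1Deriv L (fun x => Complex.sinh (ev * x)) (fun x => ev * Complex.cosh (ev * x)) :=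
    .of_hasDerivAt (hasDerivAt_sinh_mul ev) (by fun_prop)
  refine (h1.smul (1 / (a : ℂ))).congr_deriv (Eventually.of_forall fun x => ?_)
  simp only [Pi.smul_apply, smul_eq_mul]
  ring

/-- The heat equation holds because `f'' = r² f - β g` and `r² = ev - c`. At `L` the boundary
expression is `ev / a` times the left-hand side of `hbc`. -/
theorem cascadeRel_wave (hL : 0 < L) (c : ℝ) {β : ℝ → ℝ}
    (hβ : MemLp (fun x => (β x : ℂ)) ⊤ (leb L)) (α : ℝ) {ev r : ℂ} (a : ℝ)
    (hr : sinhDiv r L ≠ 0) (hrev : r ^ 2 = ev - c)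
    (hbc : Complex.cosh (ev * L) + α * Complex.sinh (ev * L) = 0) {X : H0 L}
    (hX : Represents X (waveFun1 L β ev r a) (waveFun2 ev a) (waveFun3 ev a)) :
    CascadeRel L c β α X (ev • X) := by
  obtain ⟨f', hf, hf'⟩ := hasH1Deriv_waveFun1 hL hβ (ev := ev) a hr
  have hcosh : HasH1Deriv L (fun x => Complex.cosh (ev * x))
      (fun x => ev * Complex.sinh (ev * x)) :=
    .of_hasDerivAt (hasDerivAt_cosh_mul ev) (by fun_prop)
  have h3 : waveFun3 ev a = ev • waveFun2 ev a := by
    funext x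
    simp only [waveFun3, waveFun2, Pi.smul_apply, smul_eq_mul]
    ring
  refine ⟨_, f', _, _, _, fun x => ev * waveFun3 ev a x, _, _, ⟨hf, hf'⟩,
    ⟨hasH1Deriv_waveFun2 ev a, ?_⟩, h3 ▸ (hasH1Deriv_waveFun2 ev a).smul ev,
    ⟨waveFun1_zero hL hβ a hr, waveFun1_right ev r a, ?_, ?_, ?_⟩, hX, (hX.smul ev).congr ?_ ?_ ?_⟩
  · refine (hcosh.smul (ev / (a : ℂ))).congr_deriv (Eventually.of_forall fun x => ?_)
    simp only [Pi.smul_apply, smul_eq_mul, waveFun3]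
    ring
  · simp [waveFun2]
  · simp [waveFun3]
  · simp only [waveFun3]
    linear_combination ev / (a : ℂ) * hbc
  · intro x _
    simp only [Pi.smul_apply, smul_eq_mul]
    rw [hrev]
    ring
  · intro x _
    rw [h3]
  · intro x _
    simp

theorem hasH1Deriv_heatFun (L : ℝ) (n : ℕ+) : ∃ f' : ℝ → ℂ, HasH1Deriv L (heatFun L n) f' ∧
    HasH1Deriv L f' (fun x => -((n : ℝ) * Real.pi / L : ℝ) ^ 2 * heatFun L n x) := by
  set k : ℝ := n * Real.pi / L with hk
  have hlin : ∀ x : ℝ, HasDerivAt (fun x : ℝ => k * x) k x := fun x => by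
    simpa using (hasDerivAt_id x).const_mul k
  refine ⟨fun x => ((√(2 / L) * (Real.cos (k * x) * k) : ℝ) : ℂ),
    .of_hasDerivAt (fun x => ?_) (by fun_prop), .of_hasDerivAt (fun x => ?_) ?_⟩
  · exact ((hlin x).sin.const_mul √(2 / L)).ofReal_comp
  · have := ((((hlin x).cos).mul_const k).const_mul √(2 / L)).ofReal_comp
    convert! this using 1
    simp only [heatFun, ← hk]
    push_cast
    ring
  · unfold heatFun
    fun_prop

theorem cascadeRel_heat (hL : 0 < L) (c : ℝ) (β : ℝ → ℝ) (α : ℝ) (n : ℕ+) {X : H0 L}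
    (hX : Represents X (heatFun L n) 0 0) : CascadeRel L c β α X (heatEv L c n • X) := by
  obtain ⟨f', hf, hf'⟩ := hasH1Deriv_heatFun L n
  refine ⟨_, f', _, _, _, _, _, _, ⟨hf, hf'⟩, ⟨.zero L, .zero L⟩, .zero L, ⟨?_, ?_, rfl, rfl, ?_⟩,
    hX, (hX.smul (heatEv L c n)).congr ?_ ?_ ?_⟩
  · simp [heatFun]
  · have h1 : (n : ℝ) * Real.pi / L * L = (n : ℕ) * Real.pi := by field_simp
    rw [heatFun, h1, Real.sin_nat_mul_pi]
    simp
  · simp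
  · intro x _
    simp only [Pi.smul_apply, smul_eq_mul, heatEv, Pi.zero_apply]
    push_cast
    ring
  · intro x _
    simp
  · intro x _
    simp

end Eigenvectors

/-! ### Orthonormal bases -/

/-- The Hilbert basis of a product of two Hilbert spaces. -/
theorem exists_hilbertBasis_prod {E F : Type*} [NormedAddCommGroup E] [InnerProductSpace ℂ E]
    [CompleteSpace E] [NormedAddCommGroup F] [InnerProductSpace ℂ F] [CompleteSpace F]
    {ι κ : Type*} (b : HilbertBasis ι ℂ E) (d : HilbertBasis κ ℂ F) :
    ∃ B : HilbertBasis (ι ⊕ κ) ℂ (WithLp 2 (E × F)),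
      (∀ i, B (Sum.inl i) = WithLp.toLp 2 (b i, 0)) ∧
      ∀ j, B (Sum.inr j) = WithLp.toLp 2 (0, d j) := by
  classical
  set v : ι ⊕ κ → WithLp 2 (E × F) :=
    Sum.elim (fun i => WithLp.toLp 2 (b i, 0)) (fun j => WithLp.toLp 2 (0, d j)) with hv
  have h1 : Orthonormal ℂ v := by
    rw [orthonormal_iff_ite]
    have hb := orthonormal_iff_ite.1 b.orthonormal
    have hd := orthonormal_iff_ite.1 d.orthonormal
    rintro (i | i) (j | j) <;> simp [hv, hb, hd, WithLp.prod_inner_apply]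
  have h2 : (Submodule.span ℂ (range v))ᗮ = ⊥ := by
    rw [Submodule.eq_bot_iff]
    intro x hx
    rw [Submodule.mem_orthogonal] at hx
    have hx' : ∀ i, inner ℂ (v i) x = 0 := fun i =>
      hx _ (Submodule.subset_span (mem_range_self i))
    apply (WithLp.equiv 2 _).injective
    refine Prod.ext ?_ ?_
    · apply b.repr.injective
      ext i
      have := hx' (Sum.inl i)
      simp only [hv, Sum.elim_inl, WithLp.prod_inner_apply, inner_zero_left, add_zero] at this
      rw [b.repr_apply_apply]
      simpa using this
    · apply d.repr.injective
      ext i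
      have := hx' (Sum.inr i)
      simp only [hv, Sum.elim_inr, WithLp.prod_inner_apply, inner_zero_left, zero_add] at this
      rw [d.repr_apply_apply]
      simpa using this
  exact ⟨HilbertBasis.mkOfOrthogonalEqBot h1 h2, by simp [hv], by simp [hv]⟩

section Trig

variable {L : ℝ}

/-- The function `exp (i k π x / L)`. -/
def expFun (L : ℝ) (k : ℤ) (x : ℝ) : ℂ := Complex.exp (Complex.I * k * Real.pi / L * x)

theorem continuous_expFun (L : ℝ) (k : ℤ) : Continuous (expFun L k) := by
  unfold expFun
  fun_prop

theorem expFun_mul (k l : ℤ) (x : ℝ) : expFun L k x * expFun L l x = expFun L (k + l) x := by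
  rw [expFun, expFun, expFun, ← Complex.exp_add]
  congr 1
  push_cast
  ring

theorem conj_expFun (k : ℤ) (x : ℝ) :
    (starRingEnd ℂ) (expFun L k x) = expFun L (-k) x := by
  rw [expFun, expFun, ← Complex.exp_conj]
  congr 1
  simp

theorem expFun_zero (x : ℝ) : expFun L 0 x = 1 := by simp [expFun]

/-- A single exponential with odd `k` does not integrate to zero over `(0, L)`. The symmetrized one
amounts to integrating over `(-L, L)`; its primitive `2 sinh (z x) / z` vanishes at both ends
because `z L = k π i`. -/
theorem integral_expFun_add (hL : 0 < L) (k : ℤ) :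
    ∫ x in (0 : ℝ)..L, (expFun L k x + expFun L (-k) x) = if k = 0 then 2 * (L : ℂ) else 0 := by
  have hLc : (L : ℂ) ≠ 0 := by exact_mod_cast hL.ne'
  split_ifs with h
  · simp [h, expFun_zero]
    ring
  · have hk : (k : ℂ) ≠ 0 := by exact_mod_cast h
    have hπ : (Real.pi : ℂ) ≠ 0 := by exact_mod_cast Real.pi_ne_zero
    set z : ℂ := Complex.I * k * Real.pi / L with hz
    have hz0 : z ≠ 0 := div_ne_zero (mul_ne_zero (mul_ne_zero Complex.I_ne_zero hk) hπ) hLc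
    have h1 : ∀ x : ℝ, HasDerivAt (fun x : ℝ => 2 * Complex.sinh (z * x) / z)
        (expFun L k x + expFun L (-k) x) x := fun x => by
      have h2 := ((hasDerivAt_sinh_mul z x).const_mul 2).div_const z
      convert! h2 using 1
      rw [Complex.cosh, expFun, expFun, ← hz]
      have : Complex.I * ((-k : ℤ) : ℂ) * Real.pi / L = -z := by
        rw [hz]
        push_cast
        ring
      rw [this, neg_mul]
      field_simp
    rw [intervalIntegral.integral_eq_sub_of_hasDerivAt (fun x _ => h1 x)
      (((continuous_expFun L k).add (continuous_expFun L (-k))).intervalIntegrable _ _)]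
    have h3 : z * L = k * Real.pi * Complex.I := by
      rw [hz]
      field_simp
    rw [h3, Complex.sinh_mul_I, Complex.sin_int_mul_pi]
    simp

theorem inner_toLp_left (hL : 0 ≤ L) {f : ℝ → ℂ} (hf : MemLp f 2 (leb L)) (w : L2 L) :
    inner ℂ (hf.toLp f) w = ∫ x in (0 : ℝ)..L, (starRingEnd ℂ) (f x) * w x := by
  rw [L2.inner_def, ← integral_leb hL]
  apply integral_congr_ae
  filter_upwards [hf.coeFn_toLp] with x hx
  rw [hx, RCLike.inner_apply, mul_comm]

theorem inner_toLp_toLp (hL : 0 ≤ L) {f g : ℝ → ℂ} (hf : MemLp f 2 (leb L))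
    (hg : MemLp g 2 (leb L)) :
    inner ℂ (hf.toLp f) (hg.toLp g) = ∫ x in (0 : ℝ)..L, (starRingEnd ℂ) (f x) * g x := by
  rw [inner_toLp_left hL]
  refine integral_congr_leb ?_ (right_mem_Icc.2 hL)
  filter_upwards [hg.coeFn_toLp] with x hx
  rw [hx]

/-- Completeness of the trigonometric system on `(-L, L)`, split into its two halves. -/
theorem eq_zero_of_integral_expFun (hL : 0 < L) {p q : ℝ → ℂ} (hp : MemLp p 2 (leb L))
    (hq : MemLp q 2 (leb L))
    (h : ∀ m : ℤ, (∫ x in (0 : ℝ)..L, expFun L (-m) x * p x) +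
      ∫ x in (0 : ℝ)..L, expFun L m x * q x = 0) :
    p =ᵐ[leb L] 0 ∧ q =ᵐ[leb L] 0 := by
  set P : ℝ → ℂ := (Ioc 0 L).indicator p with hP
  set Q : ℝ → ℂ := (Ioc 0 L).indicator q with hQ
  have hPm : MemLp P 2 volume := by
    rw [hP, memLp_indicator_iff_restrict measurableSet_Ioc, ← leb_eq_restrict_Ioc]
    exact hp
  have hQm : MemLp Q 2 volume := by
    rw [hQ, memLp_indicator_iff_restrict measurableSet_Ioc, ← leb_eq_restrict_Ioc]
    exact hq
  -- `F` is `p` on `(0, L]` and the reflection of `q` on the negative side. The hypothesis says that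
  -- every Fourier coefficient of `F` on `(-L, L]` vanishes, and Parseval then gives `F = 0` almost
  -- everywhere.
  set F : ℝ → ℂ := fun x => P x + Q (-x) with hF
  have hFm : MemLp F 2 volume :=
    hPm.add (hQm.comp_measurePreserving (Measure.measurePreserving_neg volume))
  have hlt : -L < L := by linarith
  have hFpos : ∀ x ∈ Ioc 0 L, F x = p x := fun x hx => by
    have : -x ∉ Ioc 0 L := fun h => by linarith [h.1, hx.1]
    simp [hF, hP, hQ, hx, this]
  have hFneg : ∀ x ∈ Ioc 0 L, F (-x) = q x := fun x hx => by
    have : -x ∉ Ioc 0 L := fun h => by linarith [h.1, hx.1]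
    simp [hF, hP, hQ, hx, this]
  have hFi : ∀ (m : ℤ) (u v : ℝ), IntervalIntegrable (fun x => expFun L m x * F x) volume u v :=
    fun m u v => by
      refine IntervalIntegrable.continuousOn_mul ?_ (continuous_expFun L m).continuousOn
      exact intervalIntegrable_iff.2 (((hFm.locallyIntegrable (by norm_num)).integrableOn_isCompact
        isCompact_uIcc).mono_set uIoc_subset_uIcc)
  have hcoef : ∀ m : ℤ, fourierCoeffOn hlt F m = 0 := fun m => by
    have h1 : ∀ x : ℝ, fourier (-m) (x : AddCircle (L - -L)) = expFun L (-m) x := fun x => by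
      rw [fourier_coe_apply, expFun]
      congr 1
      have : (L : ℂ) ≠ 0 := by exact_mod_cast hL.ne'
      push_cast
      field_simp
      ring
    rw [fourierCoeffOn_eq_integral]
    simp only [h1, smul_eq_mul]
    have h2 : ∫ x in (0 : ℝ)..L, expFun L (-m) x * F x =
        ∫ x in (0 : ℝ)..L, expFun L (-m) x * p x := by
      rw [intervalIntegral.integral_of_le hL.le, intervalIntegral.integral_of_le hL.le]
      exact setIntegral_congr_fun measurableSet_Ioc fun x hx => by simp only [hFpos x hx]
    have h3 : ∫ x in -L..0, expFun L (-m) x * F x = ∫ x in (0 : ℝ)..L, expFun L m x * q x := by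
      have h4 := intervalIntegral.integral_comp_neg (fun x => expFun L (-m) x * F x)
        (a := 0) (b := L)
      rw [neg_zero] at h4
      rw [← h4, intervalIntegral.integral_of_le hL.le, intervalIntegral.integral_of_le hL.le]
      refine setIntegral_congr_fun measurableSet_Ioc fun x hx => ?_
      have h5 : expFun L (-m) (-x) = expFun L m x := by
        rw [expFun, expFun]
        congr 1
        push_cast
        ring
      simp only [hFneg x hx, h5]
    rw [← intervalIntegral.integral_add_adjacent_intervals (hFi (-m) (-L) 0) (hFi (-m) 0 L), h2,
      h3, add_comm, h m, smul_zero]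
  have hpars := hasSum_sq_fourierCoeffOn hlt (hFm.restrict (Ioc (-L) L))
  simp only [hcoef, norm_zero, ne_eq, OfNat.ofNat_ne_zero, not_false_eq_true, zero_pow] at hpars
  have hint0 := hpars.unique hasSum_zero
  have hFsq : Integrable (fun x => ‖F x‖ ^ 2) (volume.restrict (Ioc (-L) L)) := by
    have := (hFm.restrict (Ioc (-L) L)).integrable_norm_pow (p := 2) (by norm_num)
    simpa using this
  have hFae : ∀ᵐ x, x ∈ Ioc (-L) L → F x = 0 := by
    have h1 : ∫ x in -L..L, ‖F x‖ ^ 2 = 0 := by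
      have h2 : (L - -L)⁻¹ ≠ 0 := inv_ne_zero (by linarith)
      exact (smul_eq_zero.1 hint0).resolve_left h2
    rw [intervalIntegral.integral_of_le hlt.le, integral_eq_zero_iff_of_nonneg
      (fun x => by positivity) hFsq,
      Filter.EventuallyEq, ae_restrict_iff' measurableSet_Ioc] at h1
    filter_upwards [h1] with x hx hxm
    simpa using hx hxm
  have hFae' : ∀ᵐ x, -x ∈ Ioc (-L) L → F (-x) = 0 :=
    (Measure.measurePreserving_neg volume).quasiMeasurePreserving.ae hFae
  constructor
  · rw [leb_eq_restrict_Ioc, Filter.EventuallyEq, ae_restrict_iff' measurableSet_Ioc]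
    filter_upwards [hFae] with x hx hxm
    rw [← hFpos x hxm]
    exact hx ⟨by linarith [hxm.1], hxm.2⟩
  · rw [leb, Filter.EventuallyEq, ae_restrict_iff' measurableSet_Ioo]
    filter_upwards [hFae'] with x hx hxm
    rw [← hFneg x (Ioo_subset_Ioc_self hxm)]
    exact hx ⟨by linarith [hxm.2], by linarith [hxm.1]⟩

theorem memLp_expFun (L : ℝ) (k : ℤ) (z : ℂ) : MemLp (fun x => z * expFun L k x) 2 (leb L) :=
  memLp_leb_of_continuousOn (continuous_const.mul (continuous_expFun L k)).continuousOn 2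

theorem integral_expFun_mul_Lp (k : ℤ) (z : ℂ) (w : L2 L) :
    ∫ x in (0 : ℝ)..L, (starRingEnd ℂ) (z * expFun L k x) * w x =
      (starRingEnd ℂ) z * ∫ x in (0 : ℝ)..L, expFun L (-k) x * w x := by
  rw [← intervalIntegral.integral_const_mul]
  refine intervalIntegral.integral_congr fun x _ => ?_
  simp only [map_mul, conj_expFun]
  ring

/-- The trigonometric orthonormal basis of `L²(0, L) × L²(0, L) ≅ L²(-L, L)`, up to phases. -/
theorem exists_hilbertBasis_exp (hL : 0 < L) {u : ℤ → ℂ} (hu : ∀ m, ‖u m‖ = 1) :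
    ∃ B : HilbertBasis ℤ ℂ (WithLp 2 (L2 L × L2 L)), ∀ m, B m =
      WithLp.toLp 2 ((memLp_expFun L m (u m / √(2 * L))).toLp,
        (memLp_expFun L (-m) (u m / √(2 * L))).toLp) := by
  set v : ℤ → WithLp 2 (L2 L × L2 L) := fun m =>
    WithLp.toLp 2 ((memLp_expFun L m (u m / √(2 * L))).toLp,
        (memLp_expFun L (-m) (u m / √(2 * L))).toLp) with hv
  have hs : ((√(2 * L) : ℝ) : ℂ) ^ 2 = 2 * L := by
    rw [← Complex.ofReal_pow, Real.sq_sqrt (by positivity)]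
    push_cast
    rfl
  have hs0 : ((√(2 * L) : ℝ) : ℂ) ≠ 0 := by
    exact_mod_cast (Real.sqrt_pos.2 (by positivity : 0 < 2 * L)).ne'
  have h1 : Orthonormal ℂ v := by
    rw [orthonormal_iff_ite]
    intro m n
    have e1 : inner ℂ (v m) (v n) = (starRingEnd ℂ) (u m / √(2 * L)) * (u n / √(2 * L)) *
        ∫ x in (0 : ℝ)..L, (expFun L (n - m) x + expFun L (-(n - m)) x) := by
      rw [WithLp.prod_inner_apply]
      simp only [hv]
      rw [inner_toLp_toLp hL.le, inner_toLp_toLp hL.le, ← intervalIntegral.integral_add,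
        ← intervalIntegral.integral_const_mul]
      · refine intervalIntegral.integral_congr fun x _ => ?_
        simp only [map_mul, conj_expFun, neg_neg]
        have e2 : expFun L (n - m) x = expFun L (-m) x * expFun L n x := by
          rw [expFun_mul]; congr 1; ring
        have e3 : expFun L (-(n - m)) x = expFun L m x * expFun L (-n) x := by
          rw [expFun_mul]; congr 1; ring
        rw [e2, e3]
        ring
      · simp only [map_mul, conj_expFun]
        have c1 := continuous_expFun L (-m)
        have c2 := continuous_expFun L n
        exact Continuous.intervalIntegrable (by fun_prop) _ _
      · simp only [map_mul, conj_expFun]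
        have c1 := continuous_expFun L (- -m)
        have c2 := continuous_expFun L (-n)
        exact Continuous.intervalIntegrable (by fun_prop) _ _
    rw [e1, integral_expFun_add hL]
    by_cases h : m = n
    · subst h
      have e2 : (starRingEnd ℂ) (u m) * u m = 1 := by
        rw [mul_comm, Complex.mul_conj, Complex.normSq_eq_norm_sq, hu m]
        simp
      simp only [sub_self, if_true, map_div₀, Complex.conj_ofReal]
      rw [← hs]
      field_simp
      linear_combination e2
    · have h' : n - m ≠ 0 := sub_ne_zero.2 (Ne.symm h)
      simp [h, h']
  have h2 : (Submodule.span ℂ (range v))ᗮ = ⊥ := by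
    rw [Submodule.eq_bot_iff]
    intro x hx
    rw [Submodule.mem_orthogonal] at hx
    have hx' : ∀ m : ℤ, (∫ y in (0 : ℝ)..L, expFun L (-m) y * x.fst y) +
        ∫ y in (0 : ℝ)..L, expFun L m y * x.snd y = 0 := fun m => by
      have h3 := hx _ (Submodule.subset_span (mem_range_self m))
      rw [WithLp.prod_inner_apply] at h3
      simp only [hv] at h3
      rw [inner_toLp_left hL.le, inner_toLp_left hL.le, integral_expFun_mul_Lp,
        integral_expFun_mul_Lp, neg_neg, ← mul_add] at h3
      refine (mul_eq_zero.1 h3).resolve_left ?_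
      refine (map_ne_zero (starRingEnd ℂ)).2 (div_ne_zero (norm_ne_zero_iff.1 ?_) hs0)
      rw [hu m]
      exact one_ne_zero
    obtain ⟨h3, h4⟩ := eq_zero_of_integral_expFun hL (Lp.memLp x.fst) (Lp.memLp x.snd) hx'
    apply (WithLp.equiv 2 _).injective
    exact Prod.ext (Lp.ext (h3.trans (Lp.coeFn_zero ℂ 2 (leb L)).symm))
      (Lp.ext (h4.trans (Lp.coeFn_zero ℂ 2 (leb L)).symm))
  exact ⟨HilbertBasis.mkOfOrthogonalEqBot h1 h2, by simp [hv]⟩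

theorem heatFun_eq_expFun (n : ℕ+) (x : ℝ) : heatFun L n x =
    √(2 / L) / (2 * Complex.I) * (expFun L n x - expFun L (-n) x) := by
  have h1 : ((Real.sin (n * Real.pi / L * x) : ℝ) : ℂ) =
      (expFun L n x - expFun L (-n) x) / (2 * Complex.I) := by
    rw [Complex.ofReal_sin, Complex.sin, expFun, expFun]
    have e1 : Complex.I * ((n : ℤ) : ℂ) * Real.pi / L * x =
      ((n * Real.pi / L * x : ℝ) : ℂ) * Complex.I := by
      push_cast
      ring
    have e2 : Complex.I * ((-n : ℤ) : ℂ) * Real.pi / L * x =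
      -((n * Real.pi / L * x : ℝ) : ℂ) * Complex.I := by
      push_cast
      ring
    rw [e1, e2]
    field_simp
    rw [Complex.I_sq]
    ring
  rw [heatFun, Complex.ofReal_mul, h1]
  ring

theorem continuous_heatFun (L : ℝ) (n : ℕ+) : Continuous (heatFun L n) := by
  unfold heatFun
  fun_prop

theorem memLp_heatFun (L : ℝ) (n : ℕ+) : MemLp (heatFun L n) 2 (leb L) :=
  memLp_leb_of_continuousOn (continuous_heatFun L n).continuousOn 2

theorem conj_heatFun (n : ℕ+) (x : ℝ) : (starRingEnd ℂ) (heatFun L n x) = heatFun L n x := by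
  rw [heatFun, Complex.conj_ofReal]

/-- The sine basis of `L²(0, L)`. -/
theorem exists_hilbertBasis_heatFun (hL : 0 < L) :
    ∃ B : HilbertBasis ℕ+ ℂ (L2 L), ∀ n, B n = (memLp_heatFun L n).toLp := by
  have hLc : (L : ℂ) ≠ 0 := by exact_mod_cast hL.ne'
  set v : ℕ+ → L2 L := fun n => (memLp_heatFun L n).toLp with hv
  have hs : ((√(2 / L) : ℝ) : ℂ) ^ 2 = 2 / L := by
    rw [← Complex.ofReal_pow, Real.sq_sqrt (by positivity)]
    push_cast
    rfl
  have hs0 : ((√(2 / L) : ℝ) : ℂ) ≠ 0 := by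
    exact_mod_cast (Real.sqrt_pos.2 (by positivity : 0 < 2 / L)).ne'
  have h1 : Orthonormal ℂ v := by
    rw [orthonormal_iff_ite]
    intro m n
    have e1 : inner ℂ (v m) (v n) = 1 / (2 * L) *
        ((∫ x in (0 : ℝ)..L, (expFun L (m - n) x + expFun L (-(m - n)) x)) -
          ∫ x in (0 : ℝ)..L, (expFun L (m + n) x + expFun L (-(m + n)) x)) := by
      simp only [hv]
      rw [inner_toLp_toLp hL.le, ← intervalIntegral.integral_sub,
        ← intervalIntegral.integral_const_mul]
      · refine intervalIntegral.integral_congr fun x _ => ?_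
        simp only [conj_heatFun]
        simp only [heatFun_eq_expFun]
        have e2 : expFun L (m - n) x = expFun L m x * expFun L (-n) x := by
          rw [expFun_mul]; rfl
        have e3 : expFun L (-(m - n)) x = expFun L (-m) x * expFun L n x := by
          rw [expFun_mul]; congr 1; ring
        have e4 : expFun L (-(m + n)) x = expFun L (-m) x * expFun L (-n) x := by
          rw [expFun_mul]; congr 1; ring
        rw [e2, e3, e4, ← expFun_mul]
        have hI : (√(2 / L) / (2 * Complex.I) : ℂ) ^ 2 = -(1 / (2 * L)) := by
          rw [div_pow, hs, mul_pow, Complex.I_sq]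
          field_simp
        linear_combination (expFun L m x - expFun L (-m) x) *
          (expFun L n x - expFun L (-n) x) * hI
      all_goals exact ((continuous_expFun L _).add (continuous_expFun L _)).intervalIntegrable _ _
    rw [e1, integral_expFun_add hL, integral_expFun_add hL]
    have h3 : ((m : ℤ) + n) ≠ 0 := by
      have := m.pos
      omega
    rw [if_neg h3, sub_zero]
    by_cases h : m = n
    · subst h
      simp only [sub_self, if_true]
      field_simp
    · have h' : ((m : ℤ) - n) ≠ 0 := by
        rw [sub_ne_zero]
        exact_mod_cast h
      simp [h, h']
  have h2 : (Submodule.span ℂ (range v))ᗮ = ⊥ := by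
    rw [Submodule.eq_bot_iff]
    intro w hw
    rw [Submodule.mem_orthogonal] at hw
    have hi : ∀ k : ℤ, IntervalIntegrable (fun x => expFun L k x * w x) volume 0 L := fun k =>
      intervalIntegrable_of_memLp
        (MemLp.continuousOn_mul (continuous_expFun L k).continuousOn (Lp.memLp w))
        (right_mem_Icc.2 hL.le)
    have hpos : ∀ n : ℕ+, ∫ x in (0 : ℝ)..L, expFun L (n : ℤ) x * w x =
        ∫ x in (0 : ℝ)..L, expFun L (-(n : ℤ)) x * w x := fun n => by
      have h3 := hw _ (Submodule.subset_span (mem_range_self n))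
      simp only [hv] at h3
      rw [inner_toLp_left hL.le] at h3
      have h4 : ∫ x in (0 : ℝ)..L, (starRingEnd ℂ) (heatFun L n x) * w x =
          √(2 / L) / (2 * Complex.I) * ((∫ x in (0 : ℝ)..L, expFun L (n : ℤ) x * w x) -
            ∫ x in (0 : ℝ)..L, expFun L (-(n : ℤ)) x * w x) := by
        rw [← intervalIntegral.integral_sub (hi _) (hi _), ← intervalIntegral.integral_const_mul]
        refine intervalIntegral.integral_congr fun x _ => ?_
        simp only [conj_heatFun]
        simp only [heatFun_eq_expFun]
        ring
      rw [h4] at h3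
      refine sub_eq_zero.1 ((mul_eq_zero.1 h3).resolve_left ?_)
      exact div_ne_zero hs0 (mul_ne_zero two_ne_zero Complex.I_ne_zero)
    -- Taking `q = -w` amounts to the odd extension of `w`. Orthogonality to the sines says that its
    -- moments against the exponentials of index `n` and `-n` agree.
    have hall : ∀ m : ℤ, (∫ x in (0 : ℝ)..L, expFun L (-m) x * w x) +
        ∫ x in (0 : ℝ)..L, expFun L m x * (-w x) = 0 := fun m => by
      simp only [mul_neg, intervalIntegral.integral_neg]
      rw [← sub_eq_add_neg, sub_eq_zero]
      rcases lt_trichotomy m 0 with hm | hm | hm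
      · obtain ⟨n, rfl⟩ : ∃ n : ℕ+, m = -(n : ℤ) :=
          ⟨⟨(-m).toNat, by omega⟩, by simp; omega⟩
        rw [neg_neg, hpos n]
      · rw [hm, neg_zero]
      · obtain ⟨n, rfl⟩ : ∃ n : ℕ+, m = (n : ℤ) := ⟨⟨m.toNat, by omega⟩, by simp; omega⟩
        exact (hpos n).symm
    have h3 := (eq_zero_of_integral_expFun hL (Lp.memLp w) (Lp.memLp w).neg hall).1
    exact Lp.ext (h3.trans (Lp.coeFn_zero ℂ 2 (leb L)).symm)
  exact ⟨HilbertBasis.mkOfOrthogonalEqBot h1 h2, by simp [hv]⟩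

end Trig

/-- An absolutely summable family is the image of a Hilbert basis under a bounded operator. -/
theorem exists_clm_hilbertBasis_eq {E F ι : Type*} [NormedAddCommGroup E] [InnerProductSpace ℂ E]
    [NormedAddCommGroup F] [NormedSpace ℂ F] [CompleteSpace F] (b : HilbertBasis ι ℂ E)
    {v : ι → F} (hv : Summable fun i => ‖v i‖) : ∃ C : E →L[ℂ] F, ∀ i, C (b i) = v i := by
  classical
  -- `C` is the sum of the rank-one operators `⟨b i, ·⟩ v i`. It converges absolutely in operator
  -- norm because `‖b i‖ = 1`.
  have h1 : Summable fun i => (innerSL ℂ (b i)).smulRight (v i) := by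
    refine Summable.of_norm (hv.congr fun i => ?_)
    rw [ContinuousLinearMap.norm_smulRight_apply, innerSL_apply_norm, b.orthonormal.1 i, one_mul]
  refine ⟨∑' i, (innerSL ℂ (b i)).smulRight (v i), fun j => ?_⟩
  have h2 := h1.hasSum.mapL (ContinuousLinearMap.apply ℂ F (b j))
  refine h2.unique ?_
  have h3 : ∀ i, (ContinuousLinearMap.apply ℂ F (b j)) ((innerSL ℂ (b i)).smulRight (v i)) =
      if i = j then v j else 0 := fun i => by
    have := orthonormal_iff_ite.1 b.orthonormal i j
    simp only [ContinuousLinearMap.apply_apply, ContinuousLinearMap.smulRight_apply,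
      innerSL_apply_apply, this]
    split_ifs with h
    · rw [h, one_smul]
    · rw [zero_smul]
  simp only [h3]
  exact hasSum_ite_eq j (v j)

/-! ### The isomorphism of the state space with `ℓ²` -/

section Isomorphism

variable {L : ℝ}

theorem memLp_top_exp (L : ℝ) (κ : ℂ) :
    MemLp (fun x : ℝ => Complex.exp (κ * x)) ⊤ (leb L) :=
  memLp_leb_of_continuousOn (by fun_prop) ⊤

/-- Multiplication by `exp (κ x)`. -/
def mulExp (L : ℝ) (κ : ℂ) : L2 L →L[ℂ] L2 L := mulOp _ (memLp_top_exp L κ)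

theorem mulExp_coe (κ : ℂ) (w : L2 L) :
    mulExp L κ w =ᵐ[leb L] fun x => Complex.exp (κ * x) * w x :=
  mulOp_coe _ _ w

theorem mulExp_mulExp {κ κ' : ℂ} (h : κ + κ' = 0) (w : L2 L) : mulExp L κ (mulExp L κ' w) = w := by
  apply Lp.ext
  filter_upwards [mulExp_coe κ (mulExp L κ' w), mulExp_coe κ' w] with x h1 h2
  rw [h1, h2, ← mul_assoc, ← Complex.exp_add, ← add_mul, h]
  simp

/-- The isomorphism `(p, q) ↦ (g, h)` with `g' = s (e^{κx} p + e^{-κx} q)` and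
`h = s (e^{κx} p - e^{-κx} q)`. -/
theorem exists_waveEquiv (L : ℝ) (κ : ℂ) {s : ℂ} (hs : s ≠ 0) :
    ∃ N : WithLp 2 (L2 L × L2 L) ≃L[ℂ] WithLp 2 (H10 L × L2 L), ∀ p q,
      H10.deriv (N (WithLp.toLp 2 (p, q))).fst = s • (mulExp L κ p + mulExp L (-κ) q) ∧
      (N (WithLp.toLp 2 (p, q))).snd = s • (mulExp L κ p - mulExp L (-κ) q) := by
  set e₁ := ContinuousLinearMap.fst ℂ (L2 L) (L2 L)
  set e₂ := ContinuousLinearMap.snd ℂ (L2 L) (L2 L)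
  set A : L2 L × L2 L →L[ℂ] L2 L × L2 L :=
    (s • (mulExp L κ ∘L e₁ + mulExp L (-κ) ∘L e₂)).prod
      (s • (mulExp L κ ∘L e₁ - mulExp L (-κ) ∘L e₂)) with hA
  set B : L2 L × L2 L →L[ℂ] L2 L × L2 L :=
    ((2 * s)⁻¹ • mulExp L (-κ) ∘L (e₁ + e₂)).prod ((2 * s)⁻¹ • mulExp L κ ∘L (e₁ - e₂)) with hB
  have hAx : ∀ x, A x = (s • (mulExp L κ x.1 + mulExp L (-κ) x.2),
    s • (mulExp L κ x.1 - mulExp L (-κ) x.2)) := fun x => rfl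
  have hBx : ∀ x, B x = ((2 * s)⁻¹ • mulExp L (-κ) (x.1 + x.2),
    (2 * s)⁻¹ • mulExp L κ (x.1 - x.2)) := fun x => rfl
  have e1 : (2 * s)⁻¹ * s * 2 = 1 := by field_simp
  have h1 : ∀ x, B (A x) = x := fun x => by
    rw [hAx, hBx]
    refine Prod.ext ?_ ?_
    · have : s • (mulExp L κ x.1 + mulExp L (-κ) x.2) + s • (mulExp L κ x.1 - mulExp L (-κ) x.2)
          = (s * 2) • mulExp L κ x.1 := by module
      simp only [this]
      rw [map_smul, mulExp_mulExp (by ring), smul_smul, ← mul_assoc, e1, one_smul]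
    · have : s • (mulExp L κ x.1 + mulExp L (-κ) x.2) - s • (mulExp L κ x.1 - mulExp L (-κ) x.2)
          = (s * 2) • mulExp L (-κ) x.2 := by module
      simp only [this]
      rw [map_smul, mulExp_mulExp (by ring), smul_smul, ← mul_assoc, e1, one_smul]
  have h2 : ∀ x, A (B x) = x := fun x => by
    rw [hBx, hAx]
    simp only [map_smul]
    rw [mulExp_mulExp (by ring), mulExp_mulExp (by ring)]
    refine Prod.ext ?_ ?_
    · have : s • ((2 * s)⁻¹ • (x.1 + x.2) + (2 * s)⁻¹ • (x.1 - x.2))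
          = ((2 * s)⁻¹ * s * 2) • x.1 := by module
      simp only [this]
      rw [e1, one_smul]
    · have : s • ((2 * s)⁻¹ • (x.1 + x.2) - (2 * s)⁻¹ • (x.1 - x.2))
          = ((2 * s)⁻¹ * s * 2) • x.2 := by module
      simp only [this]
      rw [e1, one_smul]
  refine ⟨(WithLp.prodContinuousLinearEquiv 2 ℂ (L2 L) (L2 L)).trans
    ((ContinuousLinearEquiv.equivOfInverse A B h1 h2).trans
    (((H10.derivEquiv L).symm.toContinuousLinearEquiv.prodCongr
      (ContinuousLinearEquiv.refl ℂ (L2 L))).trans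
    (WithLp.prodContinuousLinearEquiv 2 ℂ (H10 L) (L2 L)).symm)), fun p q => ⟨?_, rfl⟩⟩
  exact (H10.derivEquiv L).apply_symm_apply _

/-- The isomorphism `(f, F) ↦ (f + C F, N F)`. -/
theorem exists_shearEquiv {E F G : Type*} [NormedAddCommGroup E] [InnerProductSpace ℂ E]
    [NormedAddCommGroup F] [InnerProductSpace ℂ F] [NormedAddCommGroup G] [InnerProductSpace ℂ G]
    (N : F ≃L[ℂ] G) (C : F →L[ℂ] E) :
    ∃ S : WithLp 2 (E × F) ≃L[ℂ] WithLp 2 (E × G), ∀ x y,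
      S (WithLp.toLp 2 (x, y)) = WithLp.toLp 2 (x + C y, N y) := by
  set A : E × F →L[ℂ] E × G :=
    (ContinuousLinearMap.fst ℂ E F + C ∘L ContinuousLinearMap.snd ℂ E F).prod
      ((N : F →L[ℂ] G) ∘L ContinuousLinearMap.snd ℂ E F)
  -- The map is block triangular, so its inverse is explicit and no smallness of `C` is needed.
  set B : E × G →L[ℂ] E × F :=
    (ContinuousLinearMap.fst ℂ E G -
      C ∘L (N.symm : G →L[ℂ] F) ∘L ContinuousLinearMap.snd ℂ E G).prod
      ((N.symm : G →L[ℂ] F) ∘L ContinuousLinearMap.snd ℂ E G)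
  have hA : ∀ x, A x = (x.1 + C x.2, N x.2) := fun x => rfl
  have hB : ∀ x, B x = (x.1 - C (N.symm x.2), N.symm x.2) := fun x => rfl
  refine ⟨(WithLp.prodContinuousLinearEquiv 2 ℂ E F).trans
    ((ContinuousLinearEquiv.equivOfInverse A B (fun x => ?_) (fun x => ?_)).trans
    (WithLp.prodContinuousLinearEquiv 2 ℂ E G).symm), fun x y => rfl⟩
  · simp [hA, hB]
  · simp [hA, hB]

/-- An isomorphism of the state space with `ℓ²` that maps the eigenvectors to the unit vectors. -/
theorem exists_equiv_ellTwo (hL : 0 < L) {κ : ℂ} {γ : ℝ} (hγ : 0 < γ) {ev : ℤ → ℂ} {a : ℤ → ℝ}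
    (hev : ∀ m, ev m = κ + Complex.I * m * Real.pi / L) (hev0 : ∀ m, ev m ≠ 0)
    (ha : ∀ m, a m = γ * ‖ev m‖) {φ : ℤ → ℝ → ℂ} (hφ : ∀ m, MemLp (φ m) 2 (leb L))
    (hsum : Summable fun m => ‖(hφ m).toLp‖) :
    ∃ (R : H0 L ≃L[ℂ] EllTwo (ℕ+ ⊕ ℤ)) (Φ : ℕ+ ⊕ ℤ → H0 L),
      (∀ i, R (Φ i) = lp.single 2 i (1 : ℂ)) ∧
      (∀ n, Represents (Φ (Sum.inl n)) (heatFun L n) 0 0) ∧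
      ∀ m, Represents (Φ (Sum.inr m)) (φ m) (waveFun2 (ev m) (a m)) (waveFun3 (ev m) (a m)) := by
  have hLs : 0 < √(2 * L) := Real.sqrt_pos.2 (by positivity)
  have hLs0 : ((√(2 * L) : ℝ) : ℂ) ≠ 0 := by exact_mod_cast hLs.ne'
  have hγ0 : (γ : ℂ) ≠ 0 := by exact_mod_cast hγ.ne'
  have hn : ∀ m, ((‖ev m‖ : ℝ) : ℂ) ≠ 0 := fun m => by exact_mod_cast norm_ne_zero_iff.2 (hev0 m)
  obtain ⟨b₁, hb₁⟩ := exists_hilbertBasis_heatFun hL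
  -- The phase `ev m / ‖ev m‖` is what remains of `ev m / a m` after the factor `1 / γ` is taken
  -- out.
  obtain ⟨b₂, hb₂⟩ := exists_hilbertBasis_exp hL (u := fun m => ev m / ‖ev m‖) fun m => by
    rw [norm_div, Complex.norm_real, norm_norm, div_self (norm_ne_zero_iff.2 (hev0 m))]
  obtain ⟨b, hbl, hbr⟩ := exists_hilbertBasis_prod b₁ b₂
  obtain ⟨C, hC⟩ := exists_clm_hilbertBasis_eq b₂ hsum
  -- In `s`, the factor `√(2 L)` undoes the normalization of `b₂`, the `1/2` is that of `cosh` and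
  -- `sinh`, and `1 / γ` comes from `a m`.
  obtain ⟨N, hN⟩ := exists_waveEquiv L κ (s := √(2 * L) / (2 * γ))
    (div_ne_zero hLs0 (mul_ne_zero two_ne_zero hγ0))
  obtain ⟨S, hS⟩ := exists_shearEquiv N C
  have hexp : ∀ m (x : ℝ), Complex.exp (κ * x) * expFun L m x = Complex.exp (ev m * x) :=
    fun m x => by
      rw [expFun, ← Complex.exp_add, hev m]
      congr 1
      ring
  have hexp' : ∀ m (x : ℝ), Complex.exp (-κ * x) * expFun L (-m) x = Complex.exp (-(ev m * x)) :=
    fun m x => by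
      rw [expFun, ← Complex.exp_add, hev m]
      congr 1
      push_cast
      ring
  refine ⟨S.symm.trans b.repr.toContinuousLinearEquiv, fun i => S (b i), fun i => ?_, fun n => ?_,
    fun m => ?_⟩
  · have : b.repr (S.symm (S (b i))) = lp.single 2 i (1 : ℂ) := by
      rw [S.symm_apply_apply]
      exact b.repr_self i
    exact this
  · simp only [hbl, hS, map_zero, add_zero]
    refine ⟨?_, fun x => rfl, Lp.coeFn_zero ℂ 2 (leb L)⟩
    rw [hb₁]
    exact (memLp_heatFun L n).coeFn_toLp
  · simp only [hbr, hS, zero_add, hC]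
    obtain ⟨h1, h2⟩ := hN (memLp_expFun L m (ev m / ‖ev m‖ / √(2 * L))).toLp
      (memLp_expFun L (-m) (ev m / ‖ev m‖ / √(2 * L))).toLp
    rw [← hb₂] at h1 h2
    refine ⟨(hφ m).coeFn_toLp, ?_, ?_⟩
    · rw [H10.toFun_eq_iff hL (hasH1Deriv_waveFun2 (ev m) (a m)) (by simp [waveFun2])]
      change ⇑(H10.deriv (N (b₂ m)).fst) =ᵐ[leb L] _
      rw [h1]
      set p := (memLp_expFun L m (ev m / ‖ev m‖ / √(2 * L))).toLp
      set q := (memLp_expFun L (-m) (ev m / ‖ev m‖ / √(2 * L))).toLp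
      filter_upwards [Lp.coeFn_smul (√(2 * L) / (2 * γ) : ℂ) (mulExp L κ p + mulExp L (-κ) q),
        Lp.coeFn_add (mulExp L κ p) (mulExp L (-κ) q), mulExp_coe κ p, mulExp_coe (-κ) q,
        (memLp_expFun L m (ev m / ‖ev m‖ / √(2 * L))).coeFn_toLp,
        (memLp_expFun L (-m) (ev m / ‖ev m‖ / √(2 * L))).coeFn_toLp] with x e1 e2 e3 e4 e5 e6
      rw [e1, Pi.smul_apply, e2, Pi.add_apply, e3, e4, e5, e6, mul_left_comm, hexp,
        mul_left_comm, hexp', Complex.cosh, smul_eq_mul, ha m]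
      have := hn m
      push_cast
      field_simp
    · change ⇑(N (b₂ m)).snd =ᵐ[leb L] _
      rw [h2]
      set p := (memLp_expFun L m (ev m / ‖ev m‖ / √(2 * L))).toLp
      set q := (memLp_expFun L (-m) (ev m / ‖ev m‖ / √(2 * L))).toLp
      filter_upwards [Lp.coeFn_smul (√(2 * L) / (2 * γ) : ℂ) (mulExp L κ p - mulExp L (-κ) q),
        Lp.coeFn_sub (mulExp L κ p) (mulExp L (-κ) q), mulExp_coe κ p, mulExp_coe (-κ) q,
        (memLp_expFun L m (ev m / ‖ev m‖ / √(2 * L))).coeFn_toLp,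
        (memLp_expFun L (-m) (ev m / ‖ev m‖ / √(2 * L))).coeFn_toLp] with x e1 e2 e3 e4 e5 e6
      rw [e1, Pi.smul_apply, e2, Pi.sub_apply, e3, e4, e5, e6, mul_left_comm, hexp,
        mul_left_comm, hexp', waveFun3, Complex.sinh, smul_eq_mul, ha m]
      have := hn m
      push_cast
      field_simp

end Isomorphism

/-! ### The spectrum -/

section Spectrum

variable {L : ℝ}

theorem heatEv_injective (hL : 0 < L) (c : ℝ) : Function.Injective (heatEv L c) := by
  intro m n h
  have h1 : c - (m : ℝ) ^ 2 * Real.pi ^ 2 / L ^ 2 = c - (n : ℝ) ^ 2 * Real.pi ^ 2 / L ^ 2 :=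
    Complex.ofReal_injective h
  have h2 : ((m : ℕ) : ℝ) ^ 2 = ((n : ℕ) : ℝ) ^ 2 := by
    have := Real.pi_pos
    field_simp at h1
    refine mul_right_cancel₀ (pow_ne_zero 2 this.ne') ?_
    linarith
  have h3 : (m : ℕ) = n := by
    exact_mod_cast (pow_left_inj₀ (Nat.cast_nonneg _) (Nat.cast_nonneg _) two_ne_zero).1 h2
  exact PNat.coe_injective h3

/-- Distinct squares of integers differ by at least `1`, so the eigenvalues are uniformly separated
by `π² / L²`. -/
theorem isClosed_range_heatEv (hL : 0 < L) (c : ℝ) : IsClosed (range (heatEv L c)) := by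
  have hε : 0 < Real.pi ^ 2 / L ^ 2 := by positivity
  refine Metric.isClosed_of_pairwise_le_dist hε ?_
  rintro _ ⟨m, rfl⟩ _ ⟨n, rfl⟩ hmn
  have hne : (m : ℤ) ^ 2 - (n : ℤ) ^ 2 ≠ 0 := by
    rw [sub_ne_zero]
    intro h
    apply hmn
    congr 1
    have h3 : ((m : ℕ) : ℤ) = (n : ℕ) :=
      (pow_left_inj₀ (by positivity) (by positivity) two_ne_zero).1 h
    exact PNat.coe_injective (by exact_mod_cast h3)
  have h1 : (1 : ℝ) ≤ |((m : ℕ) : ℝ) ^ 2 - ((n : ℕ) : ℝ) ^ 2| := by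
    exact_mod_cast Int.one_le_abs hne
  rw [heatEv, heatEv, Complex.dist_eq, ← Complex.ofReal_sub, Complex.norm_real, Real.norm_eq_abs]
  have h2 : c - (m : ℝ) ^ 2 * Real.pi ^ 2 / L ^ 2 - (c - (n : ℝ) ^ 2 * Real.pi ^ 2 / L ^ 2) =
      -((((m : ℕ) : ℝ) ^ 2 - ((n : ℕ) : ℝ) ^ 2) * (Real.pi ^ 2 / L ^ 2)) := by ring
  rw [h2, abs_neg, abs_mul, abs_of_pos hε]
  exact le_mul_of_one_le_left hε.le h1

theorem dist_affine_int (hL : 0 < L) {κ : ℂ} {ev : ℤ → ℂ}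
    (hev : ∀ m, ev m = κ + Complex.I * m * Real.pi / L) {m n : ℤ} (hmn : m ≠ n) :
    Real.pi / L ≤ dist (ev m) (ev n) := by
  have hε : 0 < Real.pi / L := by positivity
  have h1 : (1 : ℝ) ≤ |((m - n : ℤ) : ℝ)| := by
    exact_mod_cast Int.one_le_abs (sub_ne_zero.2 hmn)
  have h2 : ev m - ev n = Complex.I * ((((m - n : ℤ) : ℝ) * (Real.pi / L) : ℝ) : ℂ) := by
    rw [hev, hev]
    push_cast
    ring
  rw [Complex.dist_eq, h2, norm_mul, Complex.norm_I, one_mul, Complex.norm_real, Real.norm_eq_abs,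
    abs_mul, abs_of_pos hε]
  exact le_mul_of_one_le_left hε.le h1

/-- Each family is uniformly separated, so the union is already closed; being countable, it is
totally disconnected. -/
theorem isTotallyDisconnected_closure_spectrum (hL : 0 < L) (c : ℝ) {κ : ℂ} {ev : ℤ → ℂ}
    (hev : ∀ m, ev m = κ + Complex.I * m * Real.pi / L) :
    IsTotallyDisconnected (closure (range (Sum.elim (heatEv L c) ev))) := by
  have h1 : IsClosed (range ev) := by
    refine Metric.isClosed_of_pairwise_le_dist (ε := Real.pi / L) (by positivity) ?_
    rintro _ ⟨m, rfl⟩ _ ⟨n, rfl⟩ hmn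
    exact dist_affine_int hL hev fun h => hmn (congrArg ev h)
  rw [Set.Sum.elim_range, ((isClosed_range_heatEv hL c).union h1).closure_eq]
  exact ((countable_range _).union (countable_range _)).isTotallyDisconnected

/-- If `r ≠ 0`, a zero of `sinh (r L)` means that `r L` is a nonzero integer multiple of `π i`,
hence `z = r² + c` is a heat eigenvalue. If `r = 0` the value is `L`. -/
theorem sinhDiv_ne_zero_of_not_eigenvalue (hL : 0 < L) {c : ℝ} {z r : ℂ} (hr : r ^ 2 = z - c)
    (hz : ∀ n : ℕ+, z ≠ heatEv L c n) : sinhDiv r L ≠ 0 := by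
  intro h
  have hLc : (L : ℂ) ≠ 0 := by exact_mod_cast hL.ne'
  by_cases hr0 : r = 0
  · rw [sinhDiv, if_pos hr0] at h
    exact hLc h
  have h1 : Complex.sinh (r * L) = 0 := by rw [← mul_sinhDiv, h, mul_zero]
  have h2 : Complex.sin (r * L * Complex.I) = 0 := by
    rw [Complex.sin_mul_I, h1, zero_mul]
  obtain ⟨k, hk⟩ := Complex.sin_eq_zero_iff.1 h2
  have hk0 : k ≠ 0 := by
    rintro rfl
    simp only [Int.cast_zero, zero_mul, mul_eq_zero, hr0, hLc, Complex.I_ne_zero, or_self] at hk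
  have hn : 0 < k.natAbs := Int.natAbs_pos.2 hk0
  apply hz ⟨k.natAbs, hn⟩
  have h4 : z = r ^ 2 + c := by rw [hr]; ring
  have h6 : heatEv L c ⟨k.natAbs, hn⟩ = c - (k : ℂ) ^ 2 * Real.pi ^ 2 / L ^ 2 := by
    simp [heatEv]
  rw [h4, h6]
  have h5 : (r * L) ^ 2 = -(k * Real.pi) ^ 2 := by
    rw [← hk, mul_pow _ Complex.I, Complex.I_sq]
    ring
  field_simp
  linear_combination h5

/-- `Im z = Im r² = 2 Re r Im r` and `|Im r| ≤ ‖r‖`. This bounds the denominator of the Green's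
function estimate from below, linearly in `m`. -/
theorem norm_mul_re_ge {r z : ℂ} {c : ℝ} (hr : r ^ 2 = z - c) (hr0 : 0 ≤ r.re) :
    |z.im| / 2 ≤ ‖r‖ * r.re := by
  have h1 : z.im = 2 * r.re * r.im := by
    have := congrArg Complex.im hr
    simp only [pow_two, Complex.mul_im, Complex.sub_im, Complex.ofReal_im] at this
    linarith
  rw [h1, abs_mul, abs_mul, abs_of_nonneg hr0, abs_two]
  have := mul_le_mul_of_nonneg_right (Complex.abs_im_le_norm r) hr0
  linarith

end Spectrum

/-! ### Both boundary conditions -/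

section Unified

variable {L c : ℝ} {β : ℝ → ℝ} {κ : ℂ} {γ δ : ℝ} {ev r : ℤ → ℂ} {a : ℤ → ℝ}

/-- The eigenvalues lie on a vertical line, so `sinh (ev m * x)` is bounded uniformly in `m`. The
decay comes from `|a m| ≥ γ δ |m|` and `‖r m‖ Re (r m) ≥ δ |m| / 2`. -/
theorem exists_bound_waveFun1 (hL : 0 < L) (hβ : MemLp (fun x => (β x : ℂ)) ⊤ (leb L))
    (hγ : 0 < γ) (hδ : 0 < δ) (hev : ∀ m, ev m = κ + Complex.I * m * Real.pi / L)
    (ha : ∀ m, a m = γ * ‖ev m‖) (him : ∀ m : ℤ, δ * |(m : ℝ)| ≤ |(ev m).im|)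
    (hr : ∀ m, r m ^ 2 = ev m - c ∧ 0 ≤ (r m).re) :
    ∃ C : ℝ, ∀ m : ℤ, m ≠ 0 → ∀ x ∈ Icc 0 L,
      ‖waveFun1 L β (ev m) (r m) (a m) x‖ ≤ C / (m : ℝ) ^ 2 := by
  set M := (eLpNormEssSup (fun x => (β x : ℂ)) (leb L)).toReal with hMdef
  have hM : ∀ᵐ x ∂leb L, ‖(β x : ℂ)‖ ≤ M := by
    have hlt : eLpNormEssSup (fun x => (β x : ℂ)) (leb L) < ⊤ := by
      rw [← eLpNorm_exponent_top]
      exact hβ.2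
    filter_upwards [ae_le_eLpNormEssSup (f := fun x => (β x : ℂ)) (μ := leb L)] with x hx
    have := ENNReal.toReal_mono hlt.ne hx
    simpa using this
  set K := Real.cosh (κ.re * L) with hKdef
  have hre : ∀ m, (ev m).re = κ.re := fun m => by
    have h1 : Complex.I * m * Real.pi / L = (((m : ℝ) * Real.pi / L : ℝ) : ℂ) * Complex.I := by
      push_cast
      ring
    rw [hev, h1, Complex.add_re, Complex.re_ofReal_mul, Complex.I_re, mul_zero, add_zero]
  have hK : ∀ m, ∀ x ∈ Icc 0 L, ‖Complex.sinh (ev m * (x : ℝ))‖ ≤ K := fun m x hx => by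
    refine (norm_sinh_le _).trans ?_
    rw [Complex.re_mul_ofReal, hre, hKdef, Real.cosh_le_cosh, abs_mul, abs_mul,
      abs_of_nonneg hx.1, abs_of_pos hL]
    exact mul_le_mul_of_nonneg_left hx.2 (abs_nonneg _)
  have hMK : 0 ≤ M * K := mul_nonneg ENNReal.toReal_nonneg (Real.cosh_pos _).le
  refine ⟨M * K / (γ * δ * (δ / 2)), fun m hm x hx => ?_⟩
  have hm' : 0 < |(m : ℝ)| := abs_pos.2 (by exact_mod_cast hm)
  have hi := him m
  have hδm : 0 < δ * |(m : ℝ)| := by positivity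
  have h1 := norm_mul_re_ge (hr m).1 (hr m).2
  have h2 : δ * |(m : ℝ)| / 2 ≤ ‖r m‖ * (r m).re := by linarith
  have hrpos : 0 < (r m).re := by
    refine (hr m).2.lt_of_ne' fun h => ?_
    rw [h, mul_zero] at h2
    linarith
  have h3 : γ * (δ * |(m : ℝ)|) ≤ |a m| := by
    rw [ha m, abs_of_nonneg (mul_nonneg hγ.le (norm_nonneg _))]
    exact mul_le_mul_of_nonneg_left (hi.trans (Complex.abs_im_le_norm _)) hγ.le
  refine (norm_waveFun1_le hL hβ hM (a m) (hK m) hrpos hx).trans ?_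
  rw [div_div]
  refine div_le_div_of_nonneg_left hMK (by positivity) ?_
  calc γ * δ * (δ / 2) * (m : ℝ) ^ 2 = γ * (δ * |(m : ℝ)|) * (δ * |(m : ℝ)| / 2) := by
        rw [← sq_abs (m : ℝ)]
        ring
    _ ≤ |a m| * (‖r m‖ * (r m).re) := mul_le_mul h3 h2 (by positivity) (abs_nonneg _)

/-- Both operators at once. The hypotheses isolate what the proof needs of the wave eigenvalues: an
arithmetic progression on a vertical line avoiding `0`, the characteristic equation, normalizations
proportional to the modulus, growth of the imaginary part, and disjointness from the heat
eigenvalues. -/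
theorem exists_rieszSpectral_semigroup (hL : 0 < L) (hβ : MemLp β ⊤ (leb L)) {α : ℝ} (hα : 0 ≤ α)
    (hγ : 0 < γ) (hδ : 0 < δ) (hev : ∀ m, ev m = κ + Complex.I * m * Real.pi / L)
    (hev0 : ∀ m, ev m ≠ 0)
    (hbc : ∀ m, Complex.cosh (ev m * L) + α * Complex.sinh (ev m * L) = 0)
    (ha : ∀ m, a m = γ * ‖ev m‖) (him : ∀ m : ℤ, δ * |(m : ℝ)| ≤ |(ev m).im|)
    (hne : ∀ m n, ev m ≠ heatEv L c n) (hr : ∀ m, r m ^ 2 = ev m - c ∧ 0 ≤ (r m).re) :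
    ∃ Φ Ψ : ℕ+ ⊕ ℤ → H0 L, IsEigenFamily β ev r a Φ ∧ IsRieszBasis Φ ∧ IsDualRieszBasis Φ Ψ ∧
      IsRieszSpectral (cascadeOp L c β α) (Sum.elim (heatEv L c) ev) Φ ∧
      (∃ C : ℝ, ∀ m : ℤ, m ≠ 0 → ∀ x ∈ Icc 0 L,
        ‖waveFun1 L β (ev m) (r m) (a m) x‖ ≤ C / (m : ℝ) ^ 2) ∧
      ∃ T : ℝ≥0 → H0 L →L[ℂ] H0 L, IsC0Semigroup T ∧ IsGenerator (cascadeOp L c β α) T ∧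
        HasModalExpansion T (Sum.elim (heatEv L c) ev) Φ Ψ := by
  classical
  have hβ' : MemLp (fun x => (β x : ℂ)) ⊤ (leb L) := hβ.ofReal
  have hS : ∀ m, sinhDiv (r m) L ≠ 0 := fun m =>
    sinhDiv_ne_zero_of_not_eigenvalue hL (hr m).1 (hne m)
  obtain ⟨C, hC⟩ := exists_bound_waveFun1 hL hβ' hγ hδ hev ha him hr
  have hφ : ∀ m, MemLp (waveFun1 L β (ev m) (r m) (a m)) 2 (leb L) := fun m => by
    obtain ⟨f', hf, -⟩ := hasH1Deriv_waveFun1 hL hβ' (ev := ev m) (a m) (hS m)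
    exact hf.memLp
  have hsum : Summable fun m => ‖(hφ m).toLp‖ := by
    set D := (leb L).real univ ^ (2 : ℝ≥0∞).toReal⁻¹ with hD
    have h1 : Summable fun m : ℤ => D * (|C| * (1 / (m : ℝ) ^ 2)) :=
      ((Real.summable_one_div_int_pow.2 one_lt_two).mul_left _).mul_left _
    refine h1.of_norm_bounded_eventually ?_
    -- The decay bound says nothing about `m = 0`; one exceptional term does not affect summability.
    refine (Set.finite_singleton (0 : ℤ)).subset fun m hm => ?_
    by_contra hm0
    apply hm
    rw [mem_ofPred_eq, norm_norm]
    refine Lp.norm_le_of_ae_bound (by positivity) ?_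
    filter_upwards [(hφ m).coeFn_toLp, ae_leb_mem L] with x hx hxm
    rw [hx, mul_one_div]
    refine (hC m hm0 x hxm).trans ?_
    gcongr
    exact le_abs_self C
  obtain ⟨R, Φ, hR, hΦl, hΦr⟩ := exists_equiv_ellTwo hL hγ hev hev0 ha hφ hsum
  -- Besides bounding all real parts, this choice makes `ω + 1` positive and larger than `c`, as
  -- `eq_zero_of_cascadeRel_smul` requires.
  set ω : ℝ := |c| + |κ.re| with hω
  have hωev : ∀ i, (Sum.elim (heatEv L c) ev i).re ≤ ω := by
    rintro (n | m)
    · rw [Sum.elim_inl, heatEv, Complex.ofReal_re]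
      have : 0 ≤ (n : ℝ) ^ 2 * Real.pi ^ 2 / L ^ 2 := by positivity
      linarith [le_abs_self c, abs_nonneg κ.re]
    · have h1 : Complex.I * m * Real.pi / L = (((m : ℝ) * Real.pi / L : ℝ) : ℂ) * Complex.I := by
        push_cast
        ring
      rw [Sum.elim_inr, hev, h1, Complex.add_re, Complex.re_ofReal_mul, Complex.I_re, mul_zero,
        add_zero]
      linarith [le_abs_self κ.re, abs_nonneg c]
  have hgraph : ∀ i, (Φ i, Sum.elim (heatEv L c) ev i • Φ i) ∈ (cascadeOp L c β α).graph := by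
    rintro (n | m)
    · rw [cascadeOp_graph hL]
      exact cascadeRel_heat hL c β α n (hΦl n)
    · rw [cascadeOp_graph hL]
      exact cascadeRel_wave hL c hβ' α (a m) (hS m) (hr m).1 (hbc m) (hΦr m)
  have hinj : Function.Injective (Sum.elim (heatEv L c) ev) := by
    rintro (n | m) (n' | m') h
    · rw [heatEv_injective hL c h]
    · exact absurd h.symm (hne m' n)
    · exact absurd h (hne m n')
    · by_contra hmn
      have h1 := dist_affine_int hL hev fun h : m = m' => hmn (congrArg Sum.inr h)
      have h2 : 0 < Real.pi / L := by positivity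
      simp only [Sum.elim_inr] at h
      rw [h, dist_self] at h1
      linarith
  have hclosed := cascadeOp_isClosed hL c hβ' α
  have hz : ω < ((ω + 1 : ℝ) : ℂ).re := by
    rw [Complex.ofReal_re]
    linarith
  have hzA : ∀ x, (x, ((ω + 1 : ℝ) : ℂ) • x) ∈ (cascadeOp L c β α).graph → x = 0 := fun x hx => by
    rw [cascadeOp_graph hL] at hx
    refine eq_zero_of_cascadeRel_smul hL hα ?_ ?_ hx
    · positivity
    · linarith [le_abs_self c, abs_nonneg κ.re]
  refine ⟨Φ, dualFamily R, ⟨hΦl, hΦr⟩, isRieszBasis_of_equiv R hR, isDualRieszBasis_dualFamily R hR,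
    isRieszSpectral_of_eigenvectors R hωev hR hclosed hgraph hz hzA hinj
      (isTotallyDisconnected_closure_spectrum hL c hev),
    ⟨C, hC⟩, diagSemigroup R hωev, isC0Semigroup_diagSemigroup R hωev, fun x y => ?_,
    hasModalExpansion_diagSemigroup R hωev hR⟩
  rw [tendsto_diagSemigroup_iff,
    mem_graph_iff_of_eigenvectors R hωev hR hclosed hgraph hz hzA]

end Unified

/-! ### The two families of hyperbolic eigenvalues -/

section Parameters

variable {L : ℝ}

theorem waveEv0_eq (L : ℝ) (m : ℤ) : waveEv0 L m =
    Complex.I * Real.pi / (2 * L) + Complex.I * m * Real.pi / L := by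
  rw [waveEv0]
  ring

theorem waveEv0_eq_real_mul_I (L : ℝ) (m : ℤ) :
    waveEv0 L m = (((2 * m + 1) * Real.pi / (2 * L) : ℝ) : ℂ) * Complex.I := by
  rw [waveEv0]
  push_cast
  ring

theorem im_waveEv0 (L : ℝ) (m : ℤ) : (waveEv0 L m).im = (2 * m + 1) * Real.pi / (2 * L) := by
  rw [waveEv0_eq_real_mul_I, Complex.im_ofReal_mul, Complex.I_im, mul_one]

theorem im_waveEv0_ne_zero (hL : 0 < L) (m : ℤ) : (waveEv0 L m).im ≠ 0 := by
  rw [im_waveEv0]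
  have h1 : (2 * (m : ℝ) + 1) ≠ 0 := by
    have : (2 * m + 1 : ℤ) ≠ 0 := by omega
    exact_mod_cast this
  have := Real.pi_pos
  positivity

theorem heatEv_im (L c : ℝ) (n : ℕ+) : (heatEv L c n).im = 0 := by
  rw [heatEv, Complex.ofReal_im]

theorem cosh_waveEv0 (hL : 0 < L) (m : ℤ) : Complex.cosh (waveEv0 L m * L) = 0 := by
  have hLc : (L : ℂ) ≠ 0 := by exact_mod_cast hL.ne'
  have h1 : waveEv0 L m * L = ((2 * m + 1) * Real.pi / 2) * Complex.I := by
    rw [waveEv0]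
    field_simp
  rw [h1, Complex.cosh_mul_I, Complex.cos_eq_zero_iff]
  exact ⟨m, rfl⟩

theorem normConst0_eq (hL : 0 < L) (m : ℤ) : normConst0 L m = √L * ‖waveEv0 L m‖ := by
  have h1 := Real.sqrt_pos.2 hL
  rw [waveEv0_eq_real_mul_I, norm_mul, Complex.norm_I, mul_one, Complex.norm_real,
    Real.norm_eq_abs, abs_div, abs_mul, abs_of_pos Real.pi_pos,
    abs_of_pos (by positivity : 0 < 2 * L), normConst0]
  have h2 : √L ^ 2 = L := Real.sq_sqrt hL.le
  rw [mul_div_assoc', div_eq_div_iff (by positivity) (by positivity)]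
  linear_combination -2 * |2 * (m : ℝ) + 1| * Real.pi * h2

/-- `|m| ≤ |2m + 1|` for every integer `m`, with equality at `m = -1`. -/
theorem le_abs_im_waveEv0 (hL : 0 < L) (m : ℤ) :
    Real.pi / (2 * L) * |(m : ℝ)| ≤ |(waveEv0 L m).im| := by
  have h1 : |(m : ℝ)| ≤ |2 * (m : ℝ) + 1| := by
    have : |m| ≤ |2 * m + 1| := by
      rcases abs_cases m with h | h <;> rcases abs_cases (2 * m + 1) with h' | h' <;> omega
    exact_mod_cast this
  rw [im_waveEv0, abs_div, abs_mul, abs_of_pos Real.pi_pos, abs_of_pos (by positivity : 0 < 2 * L),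
    div_mul_eq_mul_div, mul_comm]
  gcongr

variable {α : ℝ}

theorem decay_pos (hL : 0 < L) (hα : 1 < α) : 0 < decay L α := by
  have h1 : Real.log ((α - 1) / (α + 1)) < 0 := by
    refine Real.log_neg (div_pos (by linarith) (by linarith)) ?_
    rw [div_lt_one (by linarith)]
    linarith
  rw [decay, neg_mul]
  have : 0 < 1 / (2 * L) := by positivity
  nlinarith

theorem waveEv_eq (L α : ℝ) (m : ℤ) :
    waveEv L α m = ((-decay L α : ℝ) : ℂ) + Complex.I * m * Real.pi / L := by
  rw [waveEv, decay, neg_mul, neg_neg]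

theorem waveEv_eq_add_mul_I (L α : ℝ) (m : ℤ) :
    waveEv L α m = ((-decay L α : ℝ) : ℂ) + ((m * Real.pi / L : ℝ) : ℂ) * Complex.I := by
  rw [waveEv_eq]
  push_cast
  ring

theorem re_waveEv (L α : ℝ) (m : ℤ) : (waveEv L α m).re = -decay L α := by
  rw [waveEv_eq_add_mul_I, Complex.add_re, Complex.ofReal_re, Complex.re_ofReal_mul, Complex.I_re,
    mul_zero, add_zero]

theorem im_waveEv (L α : ℝ) (m : ℤ) : (waveEv L α m).im = m * Real.pi / L := by
  rw [waveEv_eq_add_mul_I, Complex.add_im, Complex.ofReal_im, Complex.im_ofReal_mul, Complex.I_im,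
    mul_one, zero_add]

/-- After multiplication by `exp (λ L)` the condition becomes `(α + 1) exp (2 λ L) = α - 1`. The
eigenvalues solve it because `2 λ_m L = log ((α - 1) / (α + 1)) + 2 π i m`. -/
theorem boundary_waveEv (hL : 0 < L) (hα : 1 < α) (m : ℤ) :
    Complex.cosh (waveEv L α m * L) + α * Complex.sinh (waveEv L α m * L) = 0 := by
  have hLc : (L : ℂ) ≠ 0 := by exact_mod_cast hL.ne'
  have hq : 0 < (α - 1) / (α + 1) := div_pos (by linarith) (by linarith)
  have h1 : Complex.exp (waveEv L α m * L) * Complex.exp (waveEv L α m * L) =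
      (((α - 1) / (α + 1) : ℝ) : ℂ) := by
    have h2 : waveEv L α m * L + waveEv L α m * L =
        ((Real.log ((α - 1) / (α + 1)) : ℝ) : ℂ) + m * (2 * Real.pi * Complex.I) := by
      rw [waveEv]
      push_cast
      field_simp
      ring
    rw [← Complex.exp_add, h2, Complex.exp_add, Complex.exp_int_mul_two_pi_mul_I, mul_one,
      ← Complex.ofReal_exp, Real.exp_log hq]
  have h3 : Complex.exp (waveEv L α m * L) * Complex.exp (-(waveEv L α m * L)) = 1 := by
    rw [← Complex.exp_add, add_neg_cancel, Complex.exp_zero]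
  have hα1 : (α + 1 : ℂ) ≠ 0 := by exact_mod_cast (by linarith : α + 1 ≠ 0)
  have h4 : (α + 1 : ℂ) * (Complex.exp (waveEv L α m * L) * Complex.exp (waveEv L α m * L)) =
      α - 1 := by
    rw [h1]
    push_cast
    field_simp
  refine (mul_eq_zero.1 (?_ : Complex.exp (waveEv L α m * L) *
    (Complex.cosh (waveEv L α m * L) + α * Complex.sinh (waveEv L α m * L)) = 0)).resolve_left
    (Complex.exp_ne_zero _)
  rw [Complex.cosh, Complex.sinh]
  linear_combination h4 / 2 + (1 - α) / 2 * h3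

/-- `|λ_m|² = μ² + m² π² / L²` is the only part of the normalization that depends on `m`; the
remaining factor serves as `γ`. -/
theorem normConst_eq (hL : 0 < L) (hα : 1 < α) (m : ℤ) : normConst L α m =
    √(Real.sinh (2 * decay L α * L)) / √(2 * decay L α) * ‖waveEv L α m‖ := by
  have hμ := decay_pos hL hα
  have h1 : ‖waveEv L α m‖ = √(decay L α ^ 2 * L ^ 2 + (m : ℝ) ^ 2 * Real.pi ^ 2) / L := by
    rw [Complex.norm_def, Complex.normSq_apply, re_waveEv, im_waveEv]
    have : -decay L α * -decay L α + (m : ℝ) * Real.pi / L * (m * Real.pi / L) =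
        (decay L α ^ 2 * L ^ 2 + (m : ℝ) ^ 2 * Real.pi ^ 2) / L ^ 2 := by
      field_simp
    rw [this, Real.sqrt_div (by positivity), Real.sqrt_sq hL.le]
  have h2 : 0 < √(2 * decay L α) := Real.sqrt_pos.2 (by positivity)
  rw [normConst, h1, Real.sqrt_mul
    (by positivity : 0 ≤ decay L α ^ 2 * L ^ 2 + (m : ℝ) ^ 2 * Real.pi ^ 2)]
  field_simp

end Parameters

end WaveHeat

end

/-! ### The two boundary conditions as instances of the unified result -/

theorem mainTheorem5 (L c : ℝ) (β : ℝ → ℝ) (hL : 0 < L)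
    (hβ : MeasureTheory.MemLp β ⊤ (WaveHeat.leb L)) :
    -- the operator `A₀`
    (∀ r : ℤ → ℂ, (∀ m, r m ^ 2 = WaveHeat.waveEv0 L m - c ∧ 0 ≤ (r m).re) →
      ∃ Φ Ψ : ℕ+ ⊕ ℤ → WaveHeat.H0 L,
        WaveHeat.IsEigenFamily β (WaveHeat.waveEv0 L) r (WaveHeat.normConst0 L) Φ ∧
        WaveHeat.IsRieszBasis Φ ∧
        WaveHeat.IsDualRieszBasis Φ Ψ ∧
        WaveHeat.IsRieszSpectral (WaveHeat.opA0 L c β)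
          (Sum.elim (WaveHeat.heatEv L c) (WaveHeat.waveEv0 L)) Φ ∧
        (∃ C : ℝ, ∀ m : ℤ, m ≠ 0 → ∀ x ∈ Set.Icc 0 L,
          ‖WaveHeat.waveFun1 L β (WaveHeat.waveEv0 L m) (r m) (WaveHeat.normConst0 L m) x‖
            ≤ C / (m : ℝ) ^ 2) ∧
        ∃ T : NNReal → WaveHeat.H0 L →L[ℂ] WaveHeat.H0 L,
          WaveHeat.IsC0Semigroup T ∧
          WaveHeat.IsGenerator (WaveHeat.opA0 L c β) T ∧
          WaveHeat.HasModalExpansion T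
            (Sum.elim (WaveHeat.heatEv L c) (WaveHeat.waveEv0 L)) Φ Ψ) ∧
    -- the operator `A` with velocity feedback
    (∀ α : ℝ, 1 < α →
      (∀ n : ℕ+, c ≠ 1 / (2 * L) * Real.log ((α - 1) / (α + 1))
        + (n : ℝ) ^ 2 * Real.pi ^ 2 / L ^ 2) →
      ∀ r : ℤ → ℂ, (∀ m, r m ^ 2 = WaveHeat.waveEv L α m - c ∧ 0 ≤ (r m).re) →
      ∃ Φ Ψ : ℕ+ ⊕ ℤ → WaveHeat.H0 L,
        WaveHeat.IsEigenFamily β (WaveHeat.waveEv L α) r (WaveHeat.normConst L α) Φ ∧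
        WaveHeat.IsRieszBasis Φ ∧
        WaveHeat.IsDualRieszBasis Φ Ψ ∧
        WaveHeat.IsRieszSpectral (WaveHeat.opA L c β α)
          (Sum.elim (WaveHeat.heatEv L c) (WaveHeat.waveEv L α)) Φ ∧
        (∃ C : ℝ, ∀ m : ℤ, m ≠ 0 → ∀ x ∈ Set.Icc 0 L,
          ‖WaveHeat.waveFun1 L β (WaveHeat.waveEv L α m) (r m) (WaveHeat.normConst L α m) x‖
            ≤ C / (m : ℝ) ^ 2) ∧
        ∃ T : NNReal → WaveHeat.H0 L →L[ℂ] WaveHeat.H0 L,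
          WaveHeat.IsC0Semigroup T ∧
          WaveHeat.IsGenerator (WaveHeat.opA L c β α) T ∧
          WaveHeat.HasModalExpansion T
            (Sum.elim (WaveHeat.heatEv L c) (WaveHeat.waveEv L α)) Φ Ψ) := by
  refine ⟨fun r hr => ?_, fun α hα hc r hr => ?_⟩
  -- Here `κ = i π / (2 L)`. No exclusion on `c` is needed: the wave eigenvalues have nonzero
  -- imaginary part, so they differ from `0` and from the real heat eigenvalues.
  · refine WaveHeat.exists_rieszSpectral_semigroup (α := 0) (γ := √L) hL hβ le_rfl
      (Real.sqrt_pos.2 hL) (by positivity : 0 < Real.pi / (2 * L)) (WaveHeat.waveEv0_eq L)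
      (fun m h => WaveHeat.im_waveEv0_ne_zero hL m (by rw [h, Complex.zero_im])) (fun m => ?_)
      (WaveHeat.normConst0_eq hL) (WaveHeat.le_abs_im_waveEv0 hL) (fun m n h => ?_) hr
    · rw [WaveHeat.cosh_waveEv0 hL]
      simp
    · exact WaveHeat.im_waveEv0_ne_zero hL m (by rw [h, WaveHeat.heatEv_im])
  · have hμ := WaveHeat.decay_pos hL hα
    have hs : 0 < Real.sinh (2 * WaveHeat.decay L α * L) := Real.sinh_pos_iff.2 (by positivity)
    refine WaveHeat.exists_rieszSpectral_semigroup (δ := Real.pi / L) hL hβ (by linarith)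
      (div_pos (Real.sqrt_pos.2 hs) (Real.sqrt_pos.2 (by positivity))) (by positivity)
      (WaveHeat.waveEv_eq L α) (fun m h => ?_) (WaveHeat.boundary_waveEv hL hα)
      (WaveHeat.normConst_eq hL hα) (fun m => ?_) (fun m n h => ?_) hr
    · have := WaveHeat.re_waveEv L α m
      rw [h, Complex.zero_re] at this
      linarith
    · rw [WaveHeat.im_waveEv, abs_div, abs_mul, abs_of_pos Real.pi_pos, abs_of_pos hL]
      exact le_of_eq (by ring)
    -- A coincidence of eigenvalues forces equal real parts, `-μ = c - n² π² / L²`, which is the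
    -- excluded case of condition (1).
    · apply hc n
      have h1 := congrArg Complex.re h
      rw [WaveHeat.re_waveEv, WaveHeat.decay, WaveHeat.heatEv, Complex.ofReal_re] at h1
      linarith
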